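/- For complex $a,b,c,d,e$ with $d,e\notin\{0,-1,-2,\dots\}$ write $${}_3F_2\!\left(\begin{matrix}a,b,c\\ d,e\end{matrix}\middle|1\right)=\sum_{k\ge 0}\frac{(a)_k(b)_k(c)_k}{(d)_k(e)_k\,k!},\qquad s=d+e-a-b-c,$$ the series being used when it terminates or $\operatorname{Re}s>0$. For integers $m,n$ put $$X_{m,n}(a,b,c)={}_3F_2\!\left(\begin{matrix}a,b,c\\1+m+a-b,\ 1+m+n+a-c\end{matrix}\middle|1\right),\qquad W_{m,n}(a,b,c)={}_3F_2\!\left(\begin{matrix}a,b,c\\\tfrac12(a+b+1+m),\ 2c+n\end{matrix}\middle|1\right).$$ In each of the four cases below, let $U\subset\mathbb C^3$ be the set of all $(a,b,c)$ for which neither bottom parameter nor the excess $s$ is a nonpositive integer, and which satisfy the additional restrictions stated. Below, $1/\Gamma(z)=0$ for $z=0,-1,-2,\dots$. Then the right-hand side is analytic on $U$; at every point of $U$ where $\operatorname{Re}s>0$ or the series terminates, the series converges and its sum is the right-hand side; and the right-hand side is the only analytic function on $U$ that equals the sum of the series wherever $\operatorname{Re}s>0$. (1) With no further restriction, $$X_{-1,0}=\frac{2^{-a}\sqrt\pi\,\Gamma(a-c)\Gamma(a-b)\Gamma(\frac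 a2-b-c)}{\Gamma(\frac a2+\frac12)\Gamma(\frac a2-b)\Gamma(\frac a2-c)\Gamma(a-b-c)}+\frac{2^{-a}\sqrt\pi\,\Gamma(a-c)\Gamma(a-b)\Gamma(\frac a2-b-c+\frac12)}{\Gamma(\frac a2)\Gamma(\frac12+\frac a2-b)\Gamma(\frac12+\frac a2-c)\Gamma(a-b-c)}.$$ (2) If $b,c\notin\{1,2\}$ and $s=6+a-2b-2c\ne 2$, $$\begin{aligned}X_{2,0}={}&-\frac{2\sqrt\pi\,\Gamma(\frac72+\frac a2-b-c)\Gamma(3+a-c)\Gamma(3+a-b)}{(b-2)(c-2)(b-1)(c-1)2^{a}\,\Gamma(a+3-b-c)\Gamma(\frac32+\frac a2-c)\Gamma(\frac32+\frac a2-b)\Gamma(\frac a2)}\\&+\left(\frac{(2+a-2c)(2+a-2b)(a+5-2b-2c)\sqrt\pi}{4(b-2)(c-2)(b-1)(c-1)2^{a}}-\frac{(a+6-2b-2c)\sqrt\pi}{8(b-2)(c-2)2^{a-2}}\right)\frac{\Gamma(2+\frac a2-b-c)\Gamma(3+a-b)\Gamma(3+a-c)}{\Gamma(\frac a2+\frac12)\Gamma(a+3-b-c)\Gamma(\frac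 a2+2-c)\Gamma(\frac a2+2-b)}.\end{aligned}$$ (3) With no further restriction, $$\begin{aligned}W_{-1,0}={}&\left(\frac1{\Gamma(\frac12-\frac a2+c)\Gamma(c-\frac b2)\Gamma(\frac b2)\Gamma(\frac a2+\frac12)}+\frac1{\Gamma(\frac12-\frac b2+c)\Gamma(\frac b2+\frac12)\Gamma(\frac a2)\Gamma(c-\frac a2)}\right)\\&\times\sqrt\pi\,\Gamma(c-\tfrac a2-\tfrac b2)\Gamma(\tfrac a2+\tfrac b2)\Gamma(c+\tfrac12).\end{aligned}$$ (4) If $a-b\ne\pm1$ and $s=c+\frac32-\frac a2-\frac b2\notin\{1,2\}$, $$\begin{aligned}W_{2,0}={}&\left(-\frac{a^2+b^2-2ca-2cb+2c-1}{\Gamma(\frac a2+\frac12)\Gamma(\frac12-\frac a2+c)\Gamma(\frac12-\frac b2+c)\Gamma(\frac b2+\frac12)}-\frac8{\Gamma(\frac a2)\Gamma(\frac b2)\Gamma(c-\frac b2)\Gamma(c-\frac a2)}\right)\\&\times\frac{\sqrt\pi\,\Gamma(c-\frac12-\frac a2-\frac b2)\Gamma(\frac a2+\frac b2+\frac32)\Gamma(c+\frac12)}{(b-a-1)(b-a+1)}.\end{aligned}$$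 Moreover, for $(m,n)=(-1,0)$ and $(2,0)$ the closed forms satisfy $$W_{m,n}(a,b,c)=X_{m,n}\!\left(2c+n-a,\ \tfrac{b-a+m+1}2,\ \tfrac{1+m-a-b}2+c+n\right)\frac{\Gamma(c+n+\frac12(1+m-a-b))\,\Gamma(2c+n)\,\Gamma(\frac12(a+b+1+m))}{\Gamma(a)\,\Gamma(c+n+\frac12(1+m+b-a))\,\Gamma(2c+n+\frac12(1+m-a-b))}$$ whenever $(a,b,c)$ and the argument of $X_{m,n}$ lie in the respective sets $U$. -/

import Mathlib

noncomputable section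

/-- `z` is one of the numbers `0, -1, -2, …` (the poles of the gamma function). -/
def IsNonposInt (z : ℂ) : Prop := ∃ k : ℕ, z = -(k : ℂ)

/-- Top parameters `a, b, c` and bottom parameters `d, e` of a `₃F₂`. -/
structure HypParams where
  a : ℂ
  b : ℂ
  c : ℂ
  d : ℂ
  e : ℂ

/-- The `k`-th term of the series `₃F₂(a, b, c; d, e | 1)`, that is,
`(a)ₖ (b)ₖ (c)ₖ / ((d)ₖ (e)ₖ k!)` with rising factorials. -/
def HypParams.term (P : HypParams) (k : ℕ) : ℂ :=
  (ascPochhammer ℂ k).eval P.a * (ascPochhammer ℂ k).eval P.b * (ascPochhammer ℂ k).eval P.c /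
    ((ascPochhammer ℂ k).eval P.d * (ascPochhammer ℂ k).eval P.e * (k.factorial : ℂ))

/-- The parametric excess `d + e - a - b - c`. -/
def HypParams.excess (P : HypParams) : ℂ := P.d + P.e - P.a - P.b - P.c

/-- One of the top parameters is a nonpositive integer. -/
def HypParams.Terminates (P : HypParams) : Prop :=
  IsNonposInt P.a ∨ IsNonposInt P.b ∨ IsNonposInt P.c

/-- The parameters at which the analytic continuation of `₃F₂(a, b, c; d, e | 1)` in its
parameters has no pole: neither a bottom parameter nor the excess is a nonpositive integer. -/
def HypParams.Admissible (P : HypParams) : Prop :=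
  ¬ IsNonposInt P.d ∧ ¬ IsNonposInt P.e ∧ ¬ IsNonposInt P.excess

/-- The parameters of the element `X(a, b, c, m, n)` contiguous to Dixon's sum;
`p = (a, b, c)`. -/
def dixonParams (m n : ℤ) (p : ℂ × ℂ × ℂ) : HypParams where
  a := p.1
  b := p.2.1
  c := p.2.2
  d := 1 + m + p.1 - p.2.1
  e := 1 + m + n + p.1 - p.2.2

/-- The parameters of the element `W(a, b, c, m, n)` contiguous to Watson's sum;
`p = (a, b, c)`. -/
def watsonParams (m n : ℤ) (p : ℂ × ℂ × ℂ) : HypParams where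
  a := p.1
  b := p.2.1
  c := p.2.2
  d := (p.1 + p.2.1 + 1 + m) / 2
  e := 2 * p.2.2 + n

/-- `f` represents the three-parameter family of sums `₃F₂(P p | 1)` on `U`: it is analytic on `U`,
it is the sum of the series at each point of `U` where the series converges (positive real part
of the excess, or a terminating series), and it is the only analytic continuation to `U` of the
sum of the series from the part of `U` where the excess has positive real part. -/
def RepresentsThreeFTwo (P : ℂ × ℂ × ℂ → HypParams) (U : Set (ℂ × ℂ × ℂ))
    (f : ℂ × ℂ × ℂ → ℂ) : Prop :=
  AnalyticOnNhd ℂ f U ∧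
  (∀ p ∈ U, (0 < (P p).excess.re ∨ (P p).Terminates) → HasSum (P p).term (f p)) ∧
  (∀ F : ℂ × ℂ × ℂ → ℂ, AnalyticOnNhd ℂ F U →
    (∀ p ∈ U, 0 < (P p).excess.re → HasSum (P p).term (F p)) → Set.EqOn F f U)

/-- The parameter set for the closed form of `X₋₁,₀`. -/
def dixonDomainNegOne : Set (ℂ × ℂ × ℂ) := {p | (dixonParams (-1) 0 p).Admissible}

/-- The parameter set for the closed form of `X₂,₀`: its right-hand side is undefined for
`b = 1, 2`, for `c = 1, 2`, and for excess `2`, where a gamma factor has a pole. -/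
def dixonDomainTwo : Set (ℂ × ℂ × ℂ) :=
  {p | (dixonParams 2 0 p).Admissible ∧ (dixonParams 2 0 p).excess ≠ 2 ∧
    p.2.1 ≠ 1 ∧ p.2.1 ≠ 2 ∧ p.2.2 ≠ 1 ∧ p.2.2 ≠ 2}

/-- The parameter set for the closed form of `W₋₁,₀`. -/
def watsonDomainNegOne : Set (ℂ × ℂ × ℂ) := {p | (watsonParams (-1) 0 p).Admissible}

/-- The parameter set for the closed form of `W₂,₀`: its right-hand side is undefined for
`a - b = 1` and `a - b = -1`, and for excess `1` and `2`, where a gamma factor has a pole. -/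
def watsonDomainTwo : Set (ℂ × ℂ × ℂ) :=
  {p | (watsonParams 2 0 p).Admissible ∧ (watsonParams 2 0 p).excess ≠ 1 ∧
    (watsonParams 2 0 p).excess ≠ 2 ∧ p.1 - p.2.1 ≠ 1 ∧ p.1 - p.2.1 ≠ -1}

/-! In the closed forms the quotient by a gamma value at a pole is `0`, since Mathlib sets
`Γ(-k) = 0` and `x / 0 = 0`; this is the usual convention `1 / Γ(-k) = 0`. On the above parameter
sets no gamma function in a numerator is evaluated at a pole, and no other denominator is zero. -/

/-- The closed form of `X₋₁,₀`. -/
def dixonClosedNegOne (p : ℂ × ℂ × ℂ) : ℂ :=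
  let a := p.1
  let b := p.2.1
  let c := p.2.2;
  (2 : ℂ) ^ (-a) * (Real.sqrt Real.pi : ℂ) * Complex.Gamma (a - c) * Complex.Gamma (a - b) *
      Complex.Gamma (a / 2 - c - b) /
    (Complex.Gamma (a / 2 + 1 / 2) * Complex.Gamma (a / 2 - b) * Complex.Gamma (a / 2 - c) *
      Complex.Gamma (a - b - c)) +
  (2 : ℂ) ^ (-a) * (Real.sqrt Real.pi : ℂ) * Complex.Gamma (a - c) * Complex.Gamma (a - b) *
      Complex.Gamma (a / 2 - c - b + 1 / 2) /
    (Complex.Gamma (a / 2) * Complex.Gamma (1 / 2 + a / 2 - b) * Complex.Gamma (a - b - c) *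
      Complex.Gamma (1 / 2 + a / 2 - c))

/-- The closed form of `X₂,₀`. -/
def dixonClosedTwo (p : ℂ × ℂ × ℂ) : ℂ :=
  let a := p.1
  let b := p.2.1
  let c := p.2.2;
  (-2) * ((Real.sqrt Real.pi : ℂ) * Complex.Gamma (7 / 2 + a / 2 - b - c) *
      Complex.Gamma (3 + a - c) * Complex.Gamma (3 + a - b) /
    ((-2 + b) * (-2 + c) * (2 : ℂ) ^ a * (b - 1) * (c - 1) * Complex.Gamma (a + 3 - b - c) *
      Complex.Gamma (3 / 2 + a / 2 - c) * Complex.Gamma (3 / 2 + a / 2 - b) *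
      Complex.Gamma (a / 2))) +
  (1 / 4 * ((2 + a - 2 * c) * (-2 * b + a + 2) * (a + 5 - 2 * c - 2 * b) *
      (Real.sqrt Real.pi : ℂ) /
      ((-2 + b) * (-2 + c) * (2 : ℂ) ^ a * (b - 1) * (c - 1))) -
    1 / 8 * ((-2 * b - 2 * c + a + 6) * (Real.sqrt Real.pi : ℂ) /
      ((-2 + b) * (-2 + c) * (2 : ℂ) ^ (-2 + a)))) *
    (Complex.Gamma (2 + a / 2 - c - b) * Complex.Gamma (3 + a - b) * Complex.Gamma (3 + a - c) /
      (Complex.Gamma (a / 2 + 1 / 2) * Complex.Gamma (a + 3 - b - c) *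
        Complex.Gamma (a / 2 + 2 - c) * Complex.Gamma (a / 2 - b + 2)))

/-- The closed form of `W₋₁,₀`. -/
def watsonClosedNegOne (p : ℂ × ℂ × ℂ) : ℂ :=
  let a := p.1
  let b := p.2.1
  let c := p.2.2;
  (1 / (Complex.Gamma (1 / 2 - a / 2 + c) * Complex.Gamma (c - b / 2) * Complex.Gamma (b / 2) *
      Complex.Gamma (a / 2 + 1 / 2)) +
    1 / (Complex.Gamma (1 / 2 - b / 2 + c) * Complex.Gamma (b / 2 + 1 / 2) *
      Complex.Gamma (a / 2) * Complex.Gamma (c - a / 2))) *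
    Complex.Gamma (-a / 2 - b / 2 + c) * Complex.Gamma (a / 2 + b / 2) *
    Complex.Gamma (c + 1 / 2) * (Real.sqrt Real.pi : ℂ)

/-- The closed form of `W₂,₀`. -/
def watsonClosedTwo (p : ℂ × ℂ × ℂ) : ℂ :=
  let a := p.1
  let b := p.2.1
  let c := p.2.2;
  (-((a ^ 2 - 2 * c * a - 2 * c * b - 1 + 2 * c + b ^ 2) /
      (Complex.Gamma (a / 2 + 1 / 2) * Complex.Gamma (1 / 2 - a / 2 + c) *
        Complex.Gamma (1 / 2 - b / 2 + c) * Complex.Gamma (b / 2 + 1 / 2))) -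
    8 / (Complex.Gamma (b / 2) * Complex.Gamma (a / 2) * Complex.Gamma (c - b / 2) *
      Complex.Gamma (c - a / 2))) *
    (Real.sqrt Real.pi : ℂ) * Complex.Gamma (-1 / 2 - a / 2 - b / 2 + c) *
    Complex.Gamma (a / 2 + b / 2 + 3 / 2) * Complex.Gamma (c + 1 / 2) /
    ((-1 - a + b) * (-a + b + 1))

/-- The parameters of the Dixon-contiguous element to which `W(a, b, c, m, n)` is related. -/
def watsonToDixon (m n : ℤ) (p : ℂ × ℂ × ℂ) : ℂ × ℂ × ℂ :=
  (2 * p.2.2 + n - p.1, (p.2.1 - p.1 + m + 1) / 2, (1 + m - p.1 - p.2.1) / 2 + p.2.2 + n)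

/-- The gamma factor in the relation between `W(a, b, c, m, n)` and the Dixon-contiguous
element. -/
def watsonDixonFactor (m n : ℤ) (p : ℂ × ℂ × ℂ) : ℂ :=
  let a := p.1
  let b := p.2.1
  let c := p.2.2;
  Complex.Gamma (c + n + 1 / 2 * (1 + m - a - b)) * Complex.Gamma (2 * c + n) *
      Complex.Gamma (1 / 2 * (a + b + 1 + m)) /
    (Complex.Gamma a * Complex.Gamma (c + n + 1 / 2 * (1 + m + b - a)) *
      Complex.Gamma (2 * c + n + 1 / 2 * (1 + m - a - b)))

end

/-! The sums of Dixon and Watson are found from a first-order recurrence in one parameter together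
with the limit as that parameter tends to infinity. Each recurrence is a telescoping identity: the
combined `k`-th summand equals `G k - G (k - 1)`, where `G` is a polynomial in `k` times the term of
an auxiliary hypergeometric series, and `G` tends to `0` (`HasSum.eq_of_partial_sums`). For a `₃F₂`
the vanishing comes from the decay `k ^ (-Re s - 1)` of the terms. Iteration gives quotients of
rising factorials, which Gauss's limit for `1 / Γ` converts to gamma values
(`mul_prod_inv_gamma_eq_of_tendsto`).

Dixon: the series `D(a)` and its very-well-poised companion `V(a)` satisfy `D(a) ~ V(a + 1)` and
`V(a) ~ D(a + 1)` up to rational factors, so `D(a)` is a multiple of `D(a + 2)`, and `D → 1` as `a →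
∞`. Watson: `W(c)` is a multiple of `W(c + 1)`, with limit `₂F₁(a, b; (a + b + 1)/2 | 1/2)`. That
limit is obtained by reading the same relation backwards at `c = (a + b + 1)/2`, where Watson's
series collapses to Gauss's series at `1`.

The contiguous sums follow: `X₋₁,₀` is the mean of `V` and `D` at `a - 1`, and each of the other
three is a combination of two known sums by a telescoping relation. The extra restrictions for
`X₂,₀` and `W₂,₀` exclude zeros of its leading coefficient.

For continuation, `1 / Γ` is entire, so the closed forms are analytic on `U`. Through each point of
`U` runs a complex line that leaves `U` at countably many points and along which the excess grows
linearly. A plane minus a countable set is connected, so the one-variable identity theorem on the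
line gives uniqueness. If the line also fixes a terminating top parameter, it gives the value of the
terminating series too. The relation between `W` and `X` is checked on the closed forms, where the
substitution matches gamma arguments up to integer shifts and duplication accounts for `Γ(a)` and
`Γ(2c)`. -/

open Filter Topology Complex


/-! ### Rising factorials and Gauss's limit for the reciprocal gamma function. -/

/-- The rising factorial `(z)ₙ = z (z + 1) ⋯ (z + n - 1)`. -/
noncomputable def poch (z : ℂ) (n : ℕ) : ℂ := (ascPochhammer ℂ n).eval z

@[simp] theorem poch_zero (z : ℂ) : poch z 0 = 1 := by simp [poch]

theorem poch_succ (z : ℂ) (n : ℕ) : poch z (n + 1) = poch z n * (z + n) := by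
  simp [poch, ascPochhammer_succ_eval]

theorem poch_succ_left (z : ℂ) (n : ℕ) : poch z (n + 1) = z * poch (z + 1) n := by
  simp [poch, ascPochhammer_succ_left, Polynomial.eval_comp]

theorem poch_add_one_mul (z : ℂ) (n : ℕ) : z * poch (z + 1) n = poch z n * (z + n) := by
  rw [← poch_succ_left, poch_succ]

theorem poch_ne_zero {z : ℂ} (hz : ¬ IsNonposInt z) (n : ℕ) : poch z n ≠ 0 := by
  induction n with
  | zero => simp
  | succ n ih =>
    rw [poch_succ]
    refine mul_ne_zero ih fun h => hz ⟨n, eq_neg_of_add_eq_zero_left h⟩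

theorem add_natCast_ne_zero {z : ℂ} (hz : ¬ IsNonposInt z) (n : ℕ) : z + n ≠ 0 :=
  fun h => hz ⟨n, eq_neg_of_add_eq_zero_left h⟩

theorem poch_neg_natCast_eq_zero {m n : ℕ} (h : m < n) : poch (-(m : ℂ)) n = 0 :=
  ascPochhammer_eval_neg_coe_nat_of_lt h

theorem poch_eq_prod (z : ℂ) (n : ℕ) : poch z n = ∏ j ∈ Finset.range n, (z + j) := by
  induction n with
  | zero => simp
  | succ n ih => rw [poch_succ, ih, Finset.prod_range_succ]

theorem gamma_ne_zero {z : ℂ} (hz : ¬ IsNonposInt z) : Gamma z ≠ 0 :=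
  Gamma_ne_zero fun m h => hz ⟨m, h⟩

theorem not_isNonposInt_of_re_pos {z : ℂ} (hz : 0 < z.re) : ¬ IsNonposInt z := by
  rintro ⟨k, rfl⟩
  simp at hz
  exact absurd hz (not_lt.2 (Nat.cast_nonneg k))

theorem not_isNonposInt_add_natCast {z : ℂ} (hz : ¬ IsNonposInt z) (n : ℕ) :
    ¬ IsNonposInt (z + n) := by
  rintro ⟨k, hk⟩
  exact hz ⟨k + n, by push_cast; linear_combination hk⟩

theorem not_isNonposInt_add_one {z : ℂ} (hz : ¬ IsNonposInt z) : ¬ IsNonposInt (z + 1) := by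
  simpa using not_isNonposInt_add_natCast hz 1

/-- Gauss's limit formula for `1 / Γ`, valid at every `z`. -/
theorem tendsto_poch_div (z : ℂ) :
    Tendsto (fun n : ℕ => poch z (n + 1) / ((n : ℂ) ^ z * (n.factorial : ℂ))) atTop
      (𝓝 (Gamma z)⁻¹) := by
  have key : ∀ n : ℕ, poch z (n + 1) / ((n : ℂ) ^ z * (n.factorial : ℂ)) = (GammaSeq z n)⁻¹ := by
    intro n
    rw [GammaSeq, inv_div, poch_eq_prod]
  by_cases hz : IsNonposInt z
  · obtain ⟨m, rfl⟩ := hz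
    rw [Gamma_neg_nat_eq_zero, inv_zero]
    -- At a pole both sides are `0`: `Γ(-m) = 0` by the default value, and `(-m)ₙ₊₁` vanishes once
    -- `n ≥ m`.
    refine tendsto_const_nhds.congr' ?_
    filter_upwards [eventually_ge_atTop m] with n hn
    rw [poch_neg_natCast_eq_zero (by omega), zero_div]
  · simp_rw [key]
    exact (GammaSeq_tendsto_Gamma z).inv₀ (gamma_ne_zero hz)

/-- If `A ∏ (pᵢ)ₙ = B n ∏ (qᵢ)ₙ` for all `n`, with equally many parameters of equal sum, then
`A / ∏ Γ(pᵢ) = (lim B) / ∏ Γ(qᵢ)`. -/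
theorem mul_prod_inv_gamma_eq_of_tendsto {ι : Type*} [Fintype ι] (p q : ι → ℂ)
    (hpq : ∑ i, p i = ∑ i, q i) {A L : ℂ} {B : ℕ → ℂ} (hB : Tendsto B atTop (𝓝 L))
    (h : ∀ n, A * ∏ i, poch (p i) n = B n * ∏ i, poch (q i) n) :
    A * ∏ i, (Gamma (p i))⁻¹ = L * ∏ i, (Gamma (q i))⁻¹ := by
  have hp : Tendsto (fun n : ℕ => ∏ i, poch (p i) (n + 1) / ((n : ℂ) ^ (p i) * (n.factorial : ℂ)))
      atTop (𝓝 (∏ i, (Gamma (p i))⁻¹)) :=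
    tendsto_finsetProd _ fun i _ => tendsto_poch_div (p i)
  have hq : Tendsto (fun n : ℕ => ∏ i, poch (q i) (n + 1) / ((n : ℂ) ^ (q i) * (n.factorial : ℂ)))
      atTop (𝓝 (∏ i, (Gamma (q i))⁻¹)) :=
    tendsto_finsetProd _ fun i _ => tendsto_poch_div (q i)
  refine tendsto_nhds_unique (hp.const_mul A)
    (((hB.comp (tendsto_add_atTop_nat 1)).mul hq).congr' ?_)
  filter_upwards [eventually_ge_atTop 1] with n hn
  have hn0 : (n : ℂ) ≠ 0 := by exact_mod_cast (by omega : n ≠ 0)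
  -- The product of the normalising factors depends only on the sum and the number of the
  -- parameters, so it is the same for `p` and `q`.
  have hpow : ∀ r : ι → ℂ, ∏ i, ((n : ℂ) ^ (r i) * (n.factorial : ℂ)) =
      (n : ℂ) ^ (∑ i, r i) * (n.factorial : ℂ) ^ Fintype.card ι := by
    intro r
    rw [Finset.prod_mul_distrib, Finset.prod_const, Finset.card_univ]
    congr 1
    simp_rw [cpow_def_of_ne_zero hn0]
    rw [← Complex.exp_sum, Finset.mul_sum]
  simp only [Function.comp, Finset.prod_div_distrib, hpow, hpq, ← mul_div_assoc, h]

/-! ### Growth of the terms, summability and telescoping. -/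

theorem HypParams.term_eq (P : HypParams) (k : ℕ) :
    P.term k = poch P.a k * poch P.b k * poch P.c k /
      (poch P.d k * poch P.e k * (k.factorial : ℂ)) := rfl

@[simp] theorem HypParams.term_zero (P : HypParams) : P.term 0 = 1 := by
  simp [HypParams.term_eq]

/-- The quotient of consecutive terms of the series. -/
noncomputable def HypParams.ratio (P : HypParams) (k : ℕ) : ℂ :=
  (P.a + k) * (P.b + k) * (P.c + k) / ((P.d + k) * (P.e + k) * (k + 1))

theorem HypParams.term_succ (P : HypParams) (k : ℕ) :
    P.term (k + 1) = P.term k * P.ratio k := by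
  simp only [HypParams.term_eq, HypParams.ratio, poch_succ, div_mul_div_comm, Nat.factorial_succ]
  push_cast
  ring_nf

/-- Both series start with `1`, so a comparison of ratios propagates to the terms. This supplies the
dominating series for the limits `a → ∞` and `c → ∞`. -/
theorem HypParams.norm_term_le {P Q : HypParams} (h : ∀ k, ‖P.ratio k‖ ≤ ‖Q.ratio k‖) (k : ℕ) :
    ‖P.term k‖ ≤ ‖Q.term k‖ := by
  induction k with
  | zero => simp
  | succ k ih =>
    rw [P.term_succ, Q.term_succ, norm_mul, norm_mul]
    exact mul_le_mul ih (h k) (norm_nonneg _) (norm_nonneg _)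

/-- The terms behave like a constant times `k ^ (-s - 1)`, where `s` is the excess. -/
theorem HypParams.tendsto_term_mul (P : HypParams) (hd : ¬ IsNonposInt P.d)
    (he : ¬ IsNonposInt P.e) :
    ∃ L : ℂ, Tendsto (fun n : ℕ => P.term (n + 1) * ((n : ℂ) ^ P.excess * (n + 1))) atTop
      (𝓝 L) := by
  have h := (((tendsto_poch_div P.a).mul (tendsto_poch_div P.b)).mul (tendsto_poch_div P.c)).div
    ((tendsto_poch_div P.d).mul (tendsto_poch_div P.e))
    (mul_ne_zero (inv_ne_zero (gamma_ne_zero hd)) (inv_ne_zero (gamma_ne_zero he)))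
  -- The limit is `Γ(d) Γ(e) / (Γ(a) Γ(b) Γ(c))`, which is `0` for a terminating series; hence only
  -- an upper bound is drawn from it. The factor `n + 1` is `(n + 1)! / n!`.
  refine ⟨_, h.congr' ?_⟩
  filter_upwards [eventually_ge_atTop 1] with n hn
  have hn0 : (n : ℂ) ≠ 0 := by exact_mod_cast (by omega : n ≠ 0)
  have hf : (n.factorial : ℂ) ≠ 0 := by exact_mod_cast n.factorial_ne_zero
  have hn1 : (n : ℂ) + 1 ≠ 0 := by exact_mod_cast n.succ_ne_zero
  have hz : ∀ z : ℂ, (n : ℂ) ^ z ≠ 0 := fun z => by simp [cpow_eq_zero_iff, hn0]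
  have h1 := poch_ne_zero hd (n + 1)
  have h2 := poch_ne_zero he (n + 1)
  rw [HypParams.term_eq, HypParams.excess, cpow_sub _ _ hn0, cpow_sub _ _ hn0, cpow_sub _ _ hn0,
    cpow_add _ _ hn0, Nat.factorial_succ]
  have := hz P.a; have := hz P.b; have := hz P.c; have := hz P.d; have := hz P.e
  simp only [Pi.div_apply]
  push_cast
  field_simp

theorem HypParams.isBigO_term (P : HypParams) (hd : ¬ IsNonposInt P.d) (he : ¬ IsNonposInt P.e) :
    (fun n : ℕ => P.term (n + 1)) =O[atTop] fun n : ℕ => (n : ℝ) ^ (-P.excess.re - 1) := by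
  obtain ⟨L, hL⟩ := P.tendsto_term_mul hd he
  have h1 := hL.isBigO_one ℝ
  have h2 := h1.mul (Asymptotics.isBigO_of_le atTop (f := fun n : ℕ =>
    (((n : ℝ) ^ (-P.excess.re - 1) : ℝ) : ℂ)) (g := fun n : ℕ => (n : ℝ) ^ (-P.excess.re - 1))
    fun n => (norm_real _).le)
  refine Asymptotics.IsBigO.trans ?_ (h2.congr_right fun n => one_mul _)
  refine Asymptotics.IsBigO.of_bound 1 ?_
  filter_upwards [eventually_ge_atTop 1] with n hn
  have hn0 : (0 : ℝ) < n := by exact_mod_cast hn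
  have hn0' : 0 < n := hn
  have : ‖((n : ℂ) ^ P.excess * (n + 1))‖ * (n : ℝ) ^ (-P.excess.re - 1) ≥ 1 := by
    rw [norm_mul, norm_natCast_cpow_of_pos hn0']
    have e : ‖(n : ℂ) + 1‖ = (n : ℝ) + 1 := by
      rw [← Nat.cast_succ, Complex.norm_natCast]; push_cast; rfl
    rw [e, Real.rpow_sub hn0, Real.rpow_neg hn0.le, Real.rpow_one]
    have := Real.rpow_pos_of_pos hn0 P.excess.re
    field_simp
    linarith
  rw [one_mul, norm_mul, norm_mul, norm_real, norm_mul, Real.norm_of_nonneg (by positivity), mul_assoc]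
  exact le_mul_of_one_le_right (norm_nonneg _) (by simpa using this)

theorem HypParams.summable_norm (P : HypParams) (hd : ¬ IsNonposInt P.d) (he : ¬ IsNonposInt P.e)
    (hs : 0 < P.excess.re) : Summable fun k => ‖P.term k‖ := by
  rw [← summable_nat_add_iff 1]
  exact summable_of_isBigO_nat (Real.summable_nat_rpow.2 (by linarith)) (P.isBigO_term hd he).norm_left

theorem HypParams.summable (P : HypParams) (hd : ¬ IsNonposInt P.d) (he : ¬ IsNonposInt P.e)
    (hs : 0 < P.excess.re) : Summable P.term :=
  (P.summable_norm hd he hs).of_norm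

/-- The terms are `o(k ^ m)` when the real part of the excess exceeds `- m - 1`. -/
theorem HypParams.tendsto_pow_mul_term (P : HypParams) (hd : ¬ IsNonposInt P.d)
    (he : ¬ IsNonposInt P.e) (m : ℕ) (hs : (m : ℝ) < P.excess.re + 1) :
    Tendsto (fun k : ℕ => (k : ℂ) ^ m * P.term k) atTop (𝓝 0) := by
  rw [← tendsto_add_atTop_iff_nat 1]
  have h1 : (fun n : ℕ => ((n + 1 : ℕ) : ℂ) ^ m) =O[atTop] fun n : ℕ => (n : ℝ) ^ (m : ℝ) := by
    refine Asymptotics.IsBigO.of_bound (2 ^ m) ?_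
    filter_upwards [eventually_ge_atTop 1] with n hn
    have hn0 : (1 : ℝ) ≤ n := by exact_mod_cast hn
    rw [norm_pow, Complex.norm_natCast, Real.rpow_natCast, norm_pow, Real.norm_of_nonneg (by positivity), ← mul_pow]
    push_cast
    gcongr
    linarith
  refine (h1.mul (P.isBigO_term hd he)).trans_tendsto ?_
  have : Tendsto (fun n : ℕ => (n : ℝ) ^ (-(P.excess.re + 1 - m))) atTop (𝓝 0) :=
    (tendsto_rpow_neg_atTop (by linarith)).comp tendsto_natCast_atTop_atTop
  refine this.congr' ?_
  filter_upwards [eventually_ge_atTop 1] with n hn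
  have hn0 : (0 : ℝ) < n := by exact_mod_cast hn
  rw [← Real.rpow_add hn0]
  congr 1; ring

/-- The sum of the series. -/
noncomputable def HypParams.sum (P : HypParams) : ℂ := ∑' k, P.term k

theorem HypParams.hasSum (P : HypParams) (hd : ¬ IsNonposInt P.d) (he : ¬ IsNonposInt P.e)
    (hs : 0 < P.excess.re) : HasSum P.term P.sum :=
  (P.summable hd he hs).hasSum

/-- The summation device behind every contiguous relation below: the hypotheses say that the partial
sum through index `n` is `G n`. The applications have `L = 0`. -/
theorem HasSum.eq_of_partial_sums {u G : ℕ → ℂ} {S L : ℂ} (hu : HasSum u S)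
    (h0 : u 0 = G 0) (h : ∀ n, u (n + 1) = G (n + 1) - G n) (hG : Tendsto G atTop (𝓝 L)) :
    S = L := by
  have hsum : ∀ n, ∑ k ∈ Finset.range (n + 1), u k = G n := by
    intro n
    induction n with
    | zero => simpa using h0
    | succ n ih => rw [Finset.sum_range_succ, ih, h]; ring
  exact tendsto_nhds_unique (hu.tendsto_sum_nat.comp (tendsto_add_atTop_nat 1))
    (hG.congr fun n => (hsum n).symm)


theorem HypParams.tendsto_cubic_mul_term (P : HypParams) (hd : ¬ IsNonposInt P.d)
    (he : ¬ IsNonposInt P.e) (hs : 2 < P.excess.re) (α β γ δ : ℂ) :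
    Tendsto (fun n : ℕ => (α + β * n + γ * n ^ 2 + δ * n ^ 3) * P.term n) atTop (𝓝 0) := by
  have h := fun (m : ℕ) (hm : (m : ℝ) ≤ 3) => P.tendsto_pow_mul_term hd he m (by linarith)
  have := ((((h 0 (by norm_num)).const_mul α).add ((h 1 (by norm_num)).const_mul β)).add
    ((h 2 (by norm_num)).const_mul γ)).add ((h 3 (by norm_num)).const_mul δ)
  simp only [mul_zero, add_zero] at this
  exact this.congr fun n => by ring

theorem HypParams.tendsto_quadratic_mul_term (P : HypParams) (hd : ¬ IsNonposInt P.d)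
    (he : ¬ IsNonposInt P.e) (hs : 1 < P.excess.re) (α β γ : ℂ) :
    Tendsto (fun n : ℕ => (α + β * n + γ * n ^ 2) * P.term n) atTop (𝓝 0) := by
  have h := fun (m : ℕ) (hm : (m : ℝ) ≤ 2) => P.tendsto_pow_mul_term hd he m (by linarith)
  have := (((h 0 (by norm_num)).const_mul α).add ((h 1 (by norm_num)).const_mul β)).add
    ((h 2 (by norm_num)).const_mul γ)
  simp only [mul_zero, add_zero] at this
  exact this.congr fun n => by ring

/-- The factor `z + 1` stays on the left so that nothing is lost at `z = -1`. This is why some term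
identities below carry a factor `a + 1` or `c + 1`. -/
theorem poch_add_two_mul (z : ℂ) (n : ℕ) :
    (z + 1) * poch (z + 2) (n + 1) = poch (z + 1) n * (z + 1 + n) * (z + 2 + n) := by
  have h := poch_add_one_mul (z + 1) (n + 1)
  rw [show z + 1 + 1 = z + 2 by ring, poch_succ (z + 1)] at h
  rw [h]; push_cast; ring

theorem ne_zero_of_not_isNonposInt {z : ℂ} (hz : ¬ IsNonposInt z) : z ≠ 0 := by
  simpa using add_natCast_ne_zero hz 0

/-! ### Dixon's theorem and its very-well-poised companion. -/

/-- Dixon's well-poised series `₃F₂(a, b, c; 1 + a - b, 1 + a - c | 1)`. -/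
noncomputable def dixonSum (a b c : ℂ) : ℂ := (HypParams.mk a b c (1 + a - b) (1 + a - c)).sum

/-- The companion `∑ (2 (a + 1)ₖ - (a)ₖ) (b)ₖ (c)ₖ / ((1 + a - b)ₖ (1 + a - c)ₖ k!)` of
Dixon's series; for `a ≠ 0` the first factor is `(a)ₖ (a + 2 k) / a`. -/
noncomputable def veryWellPoisedSum (a b c : ℂ) : ℂ :=
  2 * (HypParams.mk (a + 1) b c (1 + a - b) (1 + a - c)).sum - dixonSum a b c

/-- First half of the step `a → a + 2`. The difference of the two sides telescopes against the
series with top `a + 1, b, c` and bottom `2 + a - b, 2 + a - c`. -/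
theorem dixonSum_eq_veryWellPoisedSum {a b c : ℂ} (hb : ¬ IsNonposInt (1 + a - b))
    (hc : ¬ IsNonposInt (1 + a - c)) (hs : 0 < (2 + a - 2 * b - 2 * c).re) :
    (1 + a - b) * (1 + a - c) * dixonSum a b c =
      (a + 1) * (1 + a - b - c) * veryWellPoisedSum (a + 1) b c := by
  have hb1 : ¬ IsNonposInt (1 + (a + 1) - b) := by
    convert not_isNonposInt_add_one hb using 2; ring
  have hc1 : ¬ IsNonposInt (1 + (a + 1) - c) := by
    convert not_isNonposInt_add_one hc using 2; ring
  have h0 := HypParams.hasSum ⟨a, b, c, 1 + a - b, 1 + a - c⟩ hb hc (by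
    simp only [HypParams.excess]; ring_nf at hs ⊢; exact hs)
  have h1 := HypParams.hasSum ⟨a + 1 + 1, b, c, 1 + (a + 1) - b, 1 + (a + 1) - c⟩ hb1 hc1 (by
    simp only [HypParams.excess]; ring_nf at hs ⊢; exact hs)
  have ex : (HypParams.mk (a + 1) b c (1 + (a + 1) - b) (1 + (a + 1) - c)).excess =
      2 + a - 2 * b - 2 * c + 1 := by simp only [HypParams.excess]; ring
  have hex : 1 < (HypParams.mk (a + 1) b c (1 + (a + 1) - b) (1 + (a + 1) - c)).excess.re := by
    rw [ex, add_re, one_re]; linarith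
  have h2 := HypParams.hasSum ⟨a + 1, b, c, 1 + (a + 1) - b, 1 + (a + 1) - c⟩ hb1 hc1
    (by linarith)
  have h := ((h0.mul_left ((1 + a - b) * (1 + a - c))).sub
    (((h1.mul_left 2).sub h2).mul_left ((a + 1) * (1 + a - b - c))))
  -- The certificate is `(b + n)(c + n)` times the term. The auxiliary excess is `1` more than that
  -- of Dixon's series at `a`, just enough for a quadratic factor.
  have hG := HypParams.tendsto_quadratic_mul_term
    ⟨a + 1, b, c, 1 + (a + 1) - b, 1 + (a + 1) - c⟩ hb1 hc1 hex (b * c) (b + c) 1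
  refine sub_eq_zero.1 (h.eq_of_partial_sums ?_ ?_ hG)
  · simp; ring
  · intro n
    set Q : HypParams := ⟨a + 1, b, c, 1 + (a + 1) - b, 1 + (a + 1) - c⟩ with hQ
    have n1 : (n : ℂ) + 1 ≠ 0 := by exact_mod_cast n.succ_ne_zero
    have nf : (n.factorial : ℂ) ≠ 0 := by exact_mod_cast n.factorial_ne_zero
    have d0 := ne_zero_of_not_isNonposInt hb
    have e0 := ne_zero_of_not_isNonposInt hc
    have dn := add_natCast_ne_zero hb1 n
    have en := add_natCast_ne_zero hc1 n
    have dp := poch_ne_zero hb1 n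
    have ep := poch_ne_zero hc1 n
    have t0 : (HypParams.mk a b c (1 + a - b) (1 + a - c)).term (n + 1) = Q.term n *
        (a * (b + n) * (c + n) / ((1 + a - b) * (1 + a - c) * (n + 1))) := by
      simp only [HypParams.term_eq, hQ, poch_succ_left a, poch_succ_left (1 + a - b),
        poch_succ_left (1 + a - c), poch_succ b, poch_succ c, Nat.factorial_succ]
      rw [show 1 + a - b + 1 = 1 + (a + 1) - b by ring, show 1 + a - c + 1 = 1 + (a + 1) - c by ring]
      push_cast
      field_simp
    have t1 : (a + 1) * (HypParams.mk (a + 1 + 1) b c (1 + (a + 1) - b) (1 + (a + 1) - c)).term (n + 1) =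
        Q.term n * ((a + 1 + n) * (a + 2 + n) * (b + n) * (c + n) /
          ((1 + (a + 1) - b + n) * (1 + (a + 1) - c + n) * (n + 1))) := by
      have := poch_add_two_mul a n
      rw [show a + 2 = a + 1 + 1 by ring] at this
      simp only [HypParams.term_eq, hQ, poch_succ b, poch_succ c, poch_succ (1 + (a + 1) - b),
        poch_succ (1 + (a + 1) - c), Nat.factorial_succ]
      push_cast
      field_simp
      linear_combination poch b n * (b + n) * poch c n * (c + n) * this
    have t2 := Q.term_succ n
    rw [HypParams.ratio] at t2
    simp only [hQ] at t2 ⊢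
    rw [← hQ] at t2 ⊢
    have key : (1 + a - b) * (1 + a - c) *
          (a * (b + n) * (c + n) / ((1 + a - b) * (1 + a - c) * (n + 1))) -
        (1 + a - b - c) * (2 * ((a + 1 + n) * (a + 2 + n) * (b + n) * (c + n) /
          ((1 + (a + 1) - b + n) * (1 + (a + 1) - c + n) * (n + 1))) -
          (a + 1) * ((a + 1 + n) * (b + n) * (c + n) /
          ((1 + (a + 1) - b + n) * (1 + (a + 1) - c + n) * (n + 1)))) =
        (b + n + 1) * (c + n + 1) * ((a + 1 + n) * (b + n) * (c + n) /
          ((1 + (a + 1) - b + n) * (1 + (a + 1) - c + n) * (n + 1))) - (b + n) * (c + n) := by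
      field_simp
      ring
    rw [t0, t2]
    push_cast
    linear_combination (-2 * (1 + a - b - c)) * t1 + Q.term n * key


/-- Second half of the step `a → a + 2`, telescoping against the Dixon series at `a + 1`. -/
theorem veryWellPoisedSum_eq_dixonSum {a b c : ℂ} (hb : ¬ IsNonposInt (1 + a - b))
    (hc : ¬ IsNonposInt (1 + a - c)) (hs : 0 < (1 + a - 2 * b - 2 * c).re) :
    (1 + a - b) * (1 + a - c) * (a + 1 - 2 * b - 2 * c) * veryWellPoisedSum a b c =
      (1 + a - b - c) * (a + 1 - 2 * b) * (a + 1 - 2 * c) * dixonSum (a + 1) b c := by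
  have hb1 : ¬ IsNonposInt (1 + (a + 1) - b) := by
    convert not_isNonposInt_add_one hb using 2; ring
  have hc1 : ¬ IsNonposInt (1 + (a + 1) - c) := by
    convert not_isNonposInt_add_one hc using 2; ring
  have h1 := HypParams.hasSum ⟨a + 1, b, c, 1 + a - b, 1 + a - c⟩ hb hc (by
    simp only [HypParams.excess]; ring_nf at hs ⊢; exact hs)
  have ex0 : (HypParams.mk a b c (1 + a - b) (1 + a - c)).excess =
      1 + a - 2 * b - 2 * c + 1 := by simp only [HypParams.excess]; ring
  have h0 := HypParams.hasSum ⟨a, b, c, 1 + a - b, 1 + a - c⟩ hb hc (by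
    rw [ex0, add_re, one_re]; linarith)
  have ex : (HypParams.mk (a + 1) b c (1 + (a + 1) - b) (1 + (a + 1) - c)).excess =
      1 + a - 2 * b - 2 * c + 1 + 1 := by simp only [HypParams.excess]; ring
  have hex : 2 < (HypParams.mk (a + 1) b c (1 + (a + 1) - b) (1 + (a + 1) - c)).excess.re := by
    rw [ex, add_re, add_re, one_re]; linarith
  have h2 := HypParams.hasSum ⟨a + 1, b, c, 1 + (a + 1) - b, 1 + (a + 1) - c⟩ hb1 hc1
    (by linarith)
  have h := (((h1.mul_left 2).sub h0).mul_left
      ((1 + a - b) * (1 + a - c) * (a + 1 - 2 * b - 2 * c))).sub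
    (h2.mul_left ((1 + a - b - c) * (a + 1 - 2 * b) * (a + 1 - 2 * c)))
  -- The coefficients are those of `(b + n)(c + n)(2b + 2c - 3a - 3 - 2n)`. The excess here exceeds
  -- `2` in real part, which pays for the cubic factor.
  have hG := HypParams.tendsto_cubic_mul_term
    ⟨a + 1, b, c, 1 + (a + 1) - b, 1 + (a + 1) - c⟩ hb1 hc1 hex
    (b * c * (2 * b + 2 * c - 3 * a - 3))
    ((b + c) * (2 * b + 2 * c - 3 * a - 3) - 2 * (b * c))
    ((2 * b + 2 * c - 3 * a - 3) - 2 * (b + c)) (-2)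
  refine sub_eq_zero.1 (h.eq_of_partial_sums ?_ ?_ hG)
  · simp; ring
  · intro n
    set Q : HypParams := ⟨a + 1, b, c, 1 + (a + 1) - b, 1 + (a + 1) - c⟩ with hQ
    have n1 : (n : ℂ) + 1 ≠ 0 := by exact_mod_cast n.succ_ne_zero
    have nf : (n.factorial : ℂ) ≠ 0 := by exact_mod_cast n.factorial_ne_zero
    have d0 := ne_zero_of_not_isNonposInt hb
    have e0 := ne_zero_of_not_isNonposInt hc
    have dn := add_natCast_ne_zero hb1 n
    have en := add_natCast_ne_zero hc1 n
    have dp := poch_ne_zero hb1 n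
    have ep := poch_ne_zero hc1 n
    have t0 : (HypParams.mk a b c (1 + a - b) (1 + a - c)).term (n + 1) = Q.term n *
        (a * (b + n) * (c + n) / ((1 + a - b) * (1 + a - c) * (n + 1))) := by
      simp only [HypParams.term_eq, hQ, poch_succ_left a, poch_succ_left (1 + a - b),
        poch_succ_left (1 + a - c), poch_succ b, poch_succ c, Nat.factorial_succ]
      rw [show 1 + a - b + 1 = 1 + (a + 1) - b by ring,
        show 1 + a - c + 1 = 1 + (a + 1) - c by ring]
      push_cast
      field_simp
    have t1 : (HypParams.mk (a + 1) b c (1 + a - b) (1 + a - c)).term (n + 1) = Q.term n *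
        ((a + 1 + n) * (b + n) * (c + n) / ((1 + a - b) * (1 + a - c) * (n + 1))) := by
      simp only [HypParams.term_eq, hQ, poch_succ (a + 1), poch_succ_left (1 + a - b),
        poch_succ_left (1 + a - c), poch_succ b, poch_succ c, Nat.factorial_succ]
      rw [show 1 + a - b + 1 = 1 + (a + 1) - b by ring,
        show 1 + a - c + 1 = 1 + (a + 1) - c by ring]
      push_cast
      field_simp
    have key : (1 + a - b) * (1 + a - c) * (a + 1 - 2 * b - 2 * c) *
          (2 * ((a + 1 + n) * (b + n) * (c + n) / ((1 + a - b) * (1 + a - c) * (n + 1))) -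
          a * (b + n) * (c + n) / ((1 + a - b) * (1 + a - c) * (n + 1))) -
        (1 + a - b - c) * (a + 1 - 2 * b) * (a + 1 - 2 * c) * Q.ratio n =
        (b + n + 1) * (c + n + 1) * (2 * b + 2 * c - 3 * a - 3 - 2 * (n + 1)) * Q.ratio n -
          (b + n) * (c + n) * (2 * b + 2 * c - 3 * a - 3 - 2 * n) := by
      simp only [HypParams.ratio, hQ]
      field_simp
      ring
    rw [t0, t1, Q.term_succ n]
    push_cast
    linear_combination Q.term n * key

theorem tendsto_natCast_mul_add_inv (z : ℂ) {m : ℕ} (hm : m ≠ 0) :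
    Tendsto (fun N : ℕ => (z + m * N)⁻¹) atTop (𝓝 0) := by
  refine tendsto_inv₀_cobounded.comp ?_
  rw [← tendsto_norm_atTop_iff_cobounded]
  have h1 : Tendsto (fun N : ℕ => (N : ℝ) - ‖z‖) atTop atTop :=
    tendsto_atTop_add_const_right _ _ tendsto_natCast_atTop_atTop
  refine tendsto_atTop_mono (fun N => ?_) h1
  have h2 : ‖(m : ℂ) * N‖ ≤ ‖z + m * N‖ + ‖z‖ := by
    simpa using norm_sub_le (z + m * N) z
  have h3 : ‖(m : ℂ) * N‖ = m * N := by simp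
  have h4 : (1 : ℝ) ≤ m := by exact_mod_cast Nat.one_le_iff_ne_zero.2 hm
  nlinarith [(Nat.cast_nonneg N : (0 : ℝ) ≤ N)]

/-- In each term ratio one numerator factor grows with `N` but two denominator factors do, so every
term except the zeroth tends to `0`. Dominated convergence gives the limit of the sum. -/
theorem tendsto_dixonSum (a b c : ℂ) :
    Tendsto (fun N : ℕ => dixonSum (a + 2 * N) b c) atTop (𝓝 1) := by
  -- `M` is chosen so that the majorant `Q` has positive bottom parameters and excess with real part
  -- at least `2`.
  set M : ℝ := 2 + |a.im| + 2 * ‖b‖ + 2 * ‖c‖ with hM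
  set Q : HypParams := ⟨(M + |a.im| : ℝ), b, c, (M - ‖b‖ : ℝ), (M - ‖c‖ : ℝ)⟩ with hQ
  have hb0 := norm_nonneg b
  have hc0 := norm_nonneg c
  have hy0 := abs_nonneg a.im
  have hbre := abs_le.1 (abs_re_le_norm b)
  have hcre := abs_le.1 (abs_re_le_norm c)
  have hsum : Summable fun k => ‖Q.term k‖ := by
    refine Q.summable_norm ?_ ?_ ?_
    · exact not_isNonposInt_of_re_pos (by simp only [hQ, ofReal_re]; linarith)
    · exact not_isNonposInt_of_re_pos (by simp only [hQ, ofReal_re]; linarith)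
    · simp only [HypParams.excess, hQ, sub_re, add_re, ofReal_re]; linarith [hbre.2, hcre.2]
  have hlim : ∀ k : ℕ, Tendsto (fun N : ℕ => (HypParams.mk (a + 2 * N) b c (1 + (a + 2 * N) - b)
      (1 + (a + 2 * N) - c)).term k) atTop (𝓝 (if k = 0 then 1 else 0)) := by
    have hr : ∀ k : ℕ, Tendsto (fun N : ℕ => (HypParams.mk (a + 2 * N) b c (1 + (a + 2 * N) - b)
      (1 + (a + 2 * N) - c)).ratio k) atTop (𝓝 0) := by
      intro k
      have h1 := tendsto_natCast_mul_add_inv (1 + a - b + k) two_ne_zero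
      have h2 := tendsto_natCast_mul_add_inv (1 + a - c + k) two_ne_zero
      have h3 := ((h1.const_mul (b - 1)).const_add 1).mul h2
      have h4 := h3.const_mul ((b + k) * (c + k) / (k + 1))
      simp only [mul_zero] at h4
      refine h4.congr' ?_
      have hne : ∀ᶠ N : ℕ in atTop, (1 + a - b + k + (2 : ℕ) * N : ℂ) ≠ 0 := by
        filter_upwards [eventually_gt_atTop ⌈‖1 + a - b + k‖⌉₊] with N hN h
        have h5 : (1 + a - b + k : ℂ) = -(2 * N) := by
          push_cast at h; linear_combination h
        have h6 := Nat.lt_of_ceil_lt hN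
        rw [h5, norm_neg, norm_mul, Complex.norm_natCast] at h6
        simp at h6
        linarith [(Nat.cast_nonneg N : (0 : ℝ) ≤ N)]
      filter_upwards [hne] with N hN
      simp only [HypParams.ratio]
      push_cast at hN ⊢
      rw [show (1 + (a + 2 * N) - b + k : ℂ) = 1 + a - b + k + 2 * N by ring,
        show (1 + (a + 2 * N) - c + k : ℂ) = 1 + a - c + k + 2 * N by ring,
        show (a + 2 * N + k : ℂ) = (1 + a - b + k + 2 * N) + (b - 1) by ring]
      generalize (1 + a - b + k + 2 * N : ℂ) = X at *
      generalize (1 + a - c + k + 2 * N : ℂ) = Y at *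
      have : (1 + (b - 1) * X⁻¹) = (X + (b - 1)) * X⁻¹ := by field_simp
      rw [this, div_eq_mul_inv, div_eq_mul_inv, mul_inv, mul_inv]
      ring
    intro k
    induction k with
    | zero => simp
    | succ k ih =>
      simp_rw [HypParams.term_succ]
      simpa using ih.mul (hr k)
  have hdom := tendsto_tsum_of_dominated_convergence hsum hlim ?_
  · simpa [dixonSum, HypParams.sum, tsum_ite_eq] using hdom
  filter_upwards [eventually_ge_atTop ⌈M + ‖a‖⌉₊] with N hN
  have hN' : M + ‖a‖ ≤ N := Nat.ceil_le.1 hN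
  have hare := abs_le.1 (abs_re_le_norm a)
  refine HypParams.norm_term_le fun k => ?_
  have hk : (0 : ℝ) ≤ k := Nat.cast_nonneg k
  simp only [HypParams.ratio, hQ, norm_div, norm_mul]
  set T : ℝ := a.re + 2 * N with hT
  have hTM : M ≤ T := by linarith [hare.1]
  have e1 : ‖a + 2 * N + k‖ ≤ T + |a.im| + k := by
    refine (norm_le_abs_re_add_abs_im _).trans ?_
    have : (a + 2 * N + k).re = T + k := by simp [hT]
    rw [this, abs_of_nonneg (by linarith)]
    have : (a + 2 * N + k).im = a.im := by simp
    rw [this]; linarith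
  have e2 : ∀ z : ℂ, T - ‖z‖ + k ≤ ‖1 + (a + 2 * N) - z + k‖ := by
    intro z
    refine le_trans ?_ (re_le_norm _)
    have : (1 + (a + 2 * N) - z + k).re = 1 + T - z.re + k := by simp [hT]
    rw [this]
    linarith [(abs_le.1 (abs_re_le_norm z)).2]
  have e3 : ‖((M + |a.im| : ℝ) : ℂ) + k‖ = M + |a.im| + k := by
    rw [← ofReal_natCast, ← ofReal_add, norm_real, Real.norm_of_nonneg (by linarith)]
  have e4 : ∀ z : ℂ, ‖z‖ ≤ M → ‖((M - ‖z‖ : ℝ) : ℂ) + k‖ = M - ‖z‖ + k := by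
    intro z hz
    rw [← ofReal_natCast, ← ofReal_add, norm_real, Real.norm_of_nonneg (by linarith)]
  rw [e3, e4 b (by linarith), e4 c (by linarith)]
  have p1 : 0 < M - ‖b‖ + k := by linarith
  have p2 : 0 < M - ‖c‖ + k := by linarith
  have p3 : 0 < T - ‖b‖ + k := by linarith
  have p4 : 0 < T - ‖c‖ + k := by linarith
  have q1 : ‖a + 2 * N + k‖ / ‖1 + (a + 2 * N) - b + k‖ ≤
      (M + |a.im| + k) / (M - ‖b‖ + k) := by
    -- The quotient decreases in `T`, so it is largest at `T = M`, which is the value in `Q`.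
    calc _ ≤ (T + |a.im| + k) / (T - ‖b‖ + k) := 
        div_le_div₀ (by linarith) e1 p3 (e2 b)
      _ ≤ _ := by
        rw [div_le_div_iff₀ p3 p1]
        nlinarith
  have q2 : (‖1 + (a + 2 * N) - c + k‖)⁻¹ ≤ (M - ‖c‖ + k)⁻¹ := by
    refine inv_anti₀ p2 (le_trans ?_ (e2 c)); linarith
  calc ‖a + 2 * N + k‖ * ‖b + k‖ * ‖c + k‖ /
        (‖1 + (a + 2 * N) - b + k‖ * ‖1 + (a + 2 * N) - c + k‖ * ‖(k : ℂ) + 1‖)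
      = (‖a + 2 * N + k‖ / ‖1 + (a + 2 * N) - b + k‖) * (‖1 + (a + 2 * N) - c + k‖)⁻¹ *
        (‖b + k‖ * ‖c + k‖ / ‖(k : ℂ) + 1‖) := by
        simp only [div_eq_mul_inv, mul_inv]; ring
    _ ≤ ((M + |a.im| + k) / (M - ‖b‖ + k)) * (M - ‖c‖ + k)⁻¹ *
        (‖b + k‖ * ‖c + k‖ / ‖(k : ℂ) + 1‖) := by gcongr
    _ = _ := by simp only [div_eq_mul_inv, mul_inv]; ring


theorem gamma_duplication (z : ℂ) :
    Gamma (z / 2) * Gamma (z / 2 + 1 / 2) =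
      Gamma z * (2 : ℂ) ^ (1 - z) * (Real.sqrt Real.pi : ℂ) := by
  have h := Complex.Gamma_mul_Gamma_add_half (z / 2)
  rwa [show 2 * (z / 2) = z by ring] at h

/-- Valid at every `z`, poles included, so arguments of `1 / Γ` can be shifted without exclusions.
Shifting `Γ` in a numerator needs a nonzero argument. -/
theorem inv_gamma_eq (z : ℂ) : (Gamma z)⁻¹ = z * (Gamma (z + 1))⁻¹ :=
  one_div_Gamma_eq_self_mul_one_div_Gamma_add_one z

theorem sqrt_pi_ne_zero : (Real.sqrt Real.pi : ℂ) ≠ 0 := by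
  exact_mod_cast (Real.sqrt_pos.2 Real.pi_pos).ne'

theorem two_cpow_ne_zero (z : ℂ) : (2 : ℂ) ^ z ≠ 0 := by simp [cpow_eq_zero_iff]

/-- The companion at `a + 1` is eliminated between the two preceding relations. -/
theorem dixonSum_add_two {a b c : ℂ} (hb : ¬ IsNonposInt (1 + a - b))
    (hc : ¬ IsNonposInt (1 + a - c)) (hs : 0 < (2 + a - 2 * b - 2 * c).re) :
    dixonSum a b c * ((1 + a - b) * (2 + a - b) * (1 + a - c) * (2 + a - c) *
        (2 + a - 2 * b - 2 * c)) =
      dixonSum (a + 2) b c * ((a + 1) * (1 + a - b - c) * (2 + a - b - c) *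
        (2 + a - 2 * b) * (2 + a - 2 * c)) := by
  have hb1 : ¬ IsNonposInt (1 + (a + 1) - b) := by
    convert not_isNonposInt_add_one hb using 2; ring
  have hc1 : ¬ IsNonposInt (1 + (a + 1) - c) := by
    convert not_isNonposInt_add_one hc using 2; ring
  have h1 := dixonSum_eq_veryWellPoisedSum hb hc hs
  have h2 := veryWellPoisedSum_eq_dixonSum hb1 hc1 (by ring_nf at hs ⊢; exact hs)
  rw [show a + 1 + 1 = a + 2 by ring] at h2
  linear_combination ((2 + a - b) * (2 + a - c) * (2 + a - 2 * b - 2 * c)) * h1 +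
    (a + 1) * (1 + a - b - c) * h2

theorem dixonSum_mul_prod_poch {a b c : ℂ} (hb : ¬ IsNonposInt (1 + a - b))
    (hc : ¬ IsNonposInt (1 + a - c)) (hs : 0 < (2 + a - 2 * b - 2 * c).re) (n : ℕ) :
    dixonSum a b c * (poch ((1 + a - b) / 2) n * poch ((1 + a - b) / 2 + 1 / 2) n *
        poch ((1 + a - c) / 2) n * poch ((1 + a - c) / 2 + 1 / 2) n *
        poch (1 + a / 2 - b - c) n) =
      dixonSum (a + 2 * n) b c * (poch ((1 + a - b - c) / 2) n *
        poch ((1 + a - b - c) / 2 + 1 / 2) n * poch (1 + a / 2 - b) n * poch (1 + a / 2 - c) n *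
        poch ((1 + a) / 2) n) := by
  induction n with
  | zero => simp
  | succ n ih =>
    have hb1 : ¬ IsNonposInt (1 + (a + 2 * n) - b) := by
      convert not_isNonposInt_add_natCast hb (2 * n) using 2; push_cast; ring
    have hc1 : ¬ IsNonposInt (1 + (a + 2 * n) - c) := by
      convert not_isNonposInt_add_natCast hc (2 * n) using 2; push_cast; ring
    have hs1 : 0 < (2 + (a + 2 * n) - 2 * b - 2 * c).re := by
      have : (2 + (a + 2 * n) - 2 * b - 2 * c).re = (2 + a - 2 * b - 2 * c).re + 2 * n := by
        simp; ring
      rw [this]; positivity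
    have h := dixonSum_add_two hb1 hc1 hs1
    simp only [poch_succ]
    push_cast
    rw [show a + 2 * (n + 1 : ℂ) = a + 2 * n + 2 by ring]
    -- Each of the five linear factors in the recurrence is halved to become a factor of a rising
    -- factorial in `n`; hence the division by `2 ^ 5 = 32`.
    linear_combination (((1 + a - b) / 2 + n) * ((1 + a - b) / 2 + 1 / 2 + n) *
        ((1 + a - c) / 2 + n) * ((1 + a - c) / 2 + 1 / 2 + n) * (1 + a / 2 - b - c + n)) * ih +
      (poch ((1 + a - b - c) / 2) n *
        poch ((1 + a - b - c) / 2 + 1 / 2) n * poch (1 + a / 2 - b) n * poch (1 + a / 2 - c) n *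
        poch ((1 + a) / 2) n) / 32 * h

/-- Dixon's theorem. -/
theorem dixonSum_eq {a b c : ℂ} (hb : ¬ IsNonposInt (1 + a - b))
    (hc : ¬ IsNonposInt (1 + a - c)) (hs : 0 < (2 + a - 2 * b - 2 * c).re) :
    dixonSum a b c = (2 : ℂ) ^ (-a) * (Real.sqrt Real.pi : ℂ) * Gamma (1 + a - b) *
      Gamma (1 + a - c) * Gamma (1 + a / 2 - b - c) * ((Gamma (1 + a - b - c))⁻¹ *
      (Gamma (1 + a / 2 - b))⁻¹ * (Gamma (1 + a / 2 - c))⁻¹ * (Gamma ((1 + a) / 2))⁻¹) := by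
  have h := mul_prod_inv_gamma_eq_of_tendsto
    ![(1 + a - b) / 2, (1 + a - b) / 2 + 1 / 2, (1 + a - c) / 2, (1 + a - c) / 2 + 1 / 2,
      1 + a / 2 - b - c]
    ![(1 + a - b - c) / 2, (1 + a - b - c) / 2 + 1 / 2, 1 + a / 2 - b, 1 + a / 2 - c, (1 + a) / 2]
    (by simp [Fin.sum_univ_five]; ring) (A := dixonSum a b c) (tendsto_dixonSum a b c)
    (fun n => by simpa [Fin.prod_univ_five] using dixonSum_mul_prod_poch hb hc hs n)
  simp only [Fin.prod_univ_five, Matrix.cons_val] at h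
  have d1 := gamma_duplication (1 + a - b)
  have d2 := gamma_duplication (1 + a - c)
  have d3 := gamma_duplication (1 + a - b - c)
  have g1 := gamma_ne_zero hb
  have g2 := gamma_ne_zero hc
  have g3 : Gamma (1 + a / 2 - b - c) ≠ 0 := by
    refine gamma_ne_zero (not_isNonposInt_of_re_pos ?_)
    have : 1 + a / 2 - b - c = (2 + a - 2 * b - 2 * c) / (2 : ℝ) := by push_cast; ring
    rw [this, div_ofReal_re]
    positivity
  have h' : dixonSum a b c * ((Gamma (1 + a - b) * (2 : ℂ) ^ (1 - (1 + a - b)) *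
      (Real.sqrt Real.pi : ℂ))⁻¹ * (Gamma (1 + a - c) * (2 : ℂ) ^ (1 - (1 + a - c)) *
      (Real.sqrt Real.pi : ℂ))⁻¹ * (Gamma (1 + a / 2 - b - c))⁻¹) =
      (Gamma (1 + a - b - c) * (2 : ℂ) ^ (1 - (1 + a - b - c)) * (Real.sqrt Real.pi : ℂ))⁻¹ *
      ((Gamma (1 + a / 2 - b))⁻¹ * (Gamma (1 + a / 2 - c))⁻¹ * (Gamma ((1 + a) / 2))⁻¹) := by
    rw [← d1, ← d2, ← d3]
    simp only [mul_inv]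
    linear_combination h
  -- The duplication formula has merged three pairs of half-argument gamma values; the powers of `2`
  -- left over combine to `2 ^ (-a)`.
  have p1 : (2 : ℂ) ^ (1 - (1 + a - b)) * (2 : ℂ) ^ (1 - (1 + a - c)) =
      (2 : ℂ) ^ (-a) * (2 : ℂ) ^ (1 - (1 + a - b - c)) := by
    rw [← cpow_add _ _ two_ne_zero, ← cpow_add _ _ two_ne_zero]; ring_nf
  have n0 := sqrt_pi_ne_zero
  have n1 := two_cpow_ne_zero (1 - (1 + a - b))
  have n2 := two_cpow_ne_zero (1 - (1 + a - c))
  have n3 := two_cpow_ne_zero (1 - (1 + a - b - c))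
  generalize (2 : ℂ) ^ (1 - (1 + a - b)) = X1 at *
  generalize (2 : ℂ) ^ (1 - (1 + a - c)) = X2 at *
  generalize (2 : ℂ) ^ (1 - (1 + a - b - c)) = X3 at *
  generalize (Real.sqrt Real.pi : ℂ) = R at *
  have h2 : dixonSum a b c = (X1 * X2 / X3) * R * Gamma (1 + a - b) *
      Gamma (1 + a - c) * Gamma (1 + a / 2 - b - c) * ((Gamma (1 + a - b - c))⁻¹ *
      (Gamma (1 + a / 2 - b))⁻¹ * (Gamma (1 + a / 2 - c))⁻¹ * (Gamma ((1 + a) / 2))⁻¹) := by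
    have h3 := congrArg (fun x => x * (Gamma (1 + a - b) * X1 * R * (Gamma (1 + a - c) * X2 * R) *
      Gamma (1 + a / 2 - b - c))) h'
    simp only [mul_inv] at h3
    -- These reciprocals may be `0`, so they are kept as atoms and never cleared from denominators.
    generalize (Gamma (1 + a - b - c))⁻¹ = Y1 at *
    generalize (Gamma (1 + a / 2 - b))⁻¹ = Y2 at *
    generalize (Gamma (1 + a / 2 - c))⁻¹ = Y3 at *
    generalize (Gamma ((1 + a) / 2))⁻¹ = Y4 at *
    generalize Gamma (1 + a / 2 - b - c) = Y5 at g3 h3 ⊢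
    field_simp at h3 ⊢
    linear_combination h3
  rw [h2, p1, mul_div_assoc, div_self n3, mul_one]

/-- The sum of the companion of Dixon's series. -/
theorem veryWellPoisedSum_eq {a b c : ℂ} (hb : ¬ IsNonposInt (1 + a - b))
    (hc : ¬ IsNonposInt (1 + a - c)) (hs : 0 < (1 + a - 2 * b - 2 * c).re) :
    veryWellPoisedSum a b c = (2 : ℂ) ^ (-a) * (Real.sqrt Real.pi : ℂ) * Gamma (1 + a - b) *
      Gamma (1 + a - c) * Gamma ((1 + a) / 2 - b - c) * ((Gamma (1 + a - b - c))⁻¹ *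
      (Gamma ((1 + a) / 2 - b))⁻¹ * (Gamma ((1 + a) / 2 - c))⁻¹ * (Gamma (1 + a / 2))⁻¹) := by
  have hb1 : ¬ IsNonposInt (1 + (a + 1) - b) := by
    convert not_isNonposInt_add_one hb using 2; ring
  have hc1 : ¬ IsNonposInt (1 + (a + 1) - c) := by
    convert not_isNonposInt_add_one hc using 2; ring
  have h := veryWellPoisedSum_eq_dixonSum hb hc hs
  rw [dixonSum_eq hb1 hc1 (by
    have : 2 + (a + 1) - 2 * b - 2 * c = 1 + a - 2 * b - 2 * c + 2 := by ring
    rw [this, add_re]; simp only [re_ofNat]; linarith)] at h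
  have n1 := ne_zero_of_not_isNonposInt hb
  have n2 := ne_zero_of_not_isNonposInt hc
  have n3 : a + 1 - 2 * b - 2 * c ≠ 0 := by
    rw [show a + 1 - 2 * b - 2 * c = 1 + a - 2 * b - 2 * c by ring]
    exact ne_zero_of_not_isNonposInt (not_isNonposInt_of_re_pos hs)
  have n3' : (1 + a) / 2 - b - c ≠ 0 := fun h0 => n3 (by linear_combination 2 * h0)
  rw [show 1 + (a + 1) - b - c = 1 + a - b - c + 1 by ring,
    show 1 + (a + 1) - b = 1 + a - b + 1 by ring, show 1 + (a + 1) - c = 1 + a - c + 1 by ring,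
    show 1 + (a + 1) / 2 - b - c = (1 + a) / 2 - b - c + 1 by ring,
    show 1 + (a + 1) / 2 - b = (1 + a) / 2 - b + 1 by ring,
    show 1 + (a + 1) / 2 - c = (1 + a) / 2 - c + 1 by ring,
    show (1 + (a + 1)) / 2 = 1 + a / 2 by ring, Gamma_add_one _ n1, Gamma_add_one _ n2,
    Gamma_add_one _ n3', show -(a + 1) = -a + -1 by ring, cpow_add _ _ two_ne_zero,
    cpow_neg_one] at h
  rw [inv_gamma_eq (1 + a - b - c), inv_gamma_eq ((1 + a) / 2 - b), inv_gamma_eq ((1 + a) / 2 - c)]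
  refine mul_left_cancel₀ (mul_ne_zero (mul_ne_zero n1 n2) n3) ?_
  linear_combination h

/-! ### The closed forms of `X₋₁,₀` and `X₂,₀` where the series converges. -/

theorem hasSum_dixonClosedNegOne {p : ℂ × ℂ × ℂ} (hp : p ∈ dixonDomainNegOne)
    (hs : 0 < (dixonParams (-1) 0 p).excess.re) :
    HasSum (dixonParams (-1) 0 p).term (dixonClosedNegOne p) := by
  obtain ⟨a, b, c⟩ := p
  obtain ⟨hb, hc, -⟩ := hp
  have key := HypParams.hasSum _ hb hc hs
  convert key using 1
  have hP : dixonParams (-1) 0 (a, b, c) =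
      ⟨a - 1 + 1, b, c, 1 + (a - 1) - b, 1 + (a - 1) - c⟩ := by
    simp only [dixonParams]
    push_cast
    congr 1 <;> ring
  rw [hP] at hb hc hs ⊢
  simp only [HypParams.excess] at hb hc hs
  have hV := veryWellPoisedSum_eq hb hc (by ring_nf at hs ⊢; exact hs)
  have hD := dixonSum_eq hb hc (by
    have : 2 + (a - 1) - 2 * b - 2 * c =
      1 + (a - 1) - b + (1 + (a - 1) - c) - (a - 1 + 1) - b - c + 1 := by ring
    rw [this, add_re, one_re]; linarith)
  -- With `a - 1` as base, `X₋₁,₀` is the series with top parameter raised by one, which is the one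
  -- that defines the companion; hence it is the mean of the two known sums.
  have hS : (HypParams.mk (a - 1 + 1) b c (1 + (a - 1) - b) (1 + (a - 1) - c)).sum =
      1 / 2 * (veryWellPoisedSum (a - 1) b c + dixonSum (a - 1) b c) := by
    rw [veryWellPoisedSum]; ring
  rw [hS, hV, hD, dixonClosedNegOne]
  simp only
  rw [show -(a - 1) = -a + 1 by ring, cpow_add _ _ two_ne_zero, cpow_one,
    show 1 + (a - 1) - b - c = a - b - c by ring, show 1 + (a - 1) - b = a - b by ring,
    show 1 + (a - 1) - c = a - c by ring, show (1 + (a - 1)) / 2 = a / 2 by ring,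
    show 1 + (a - 1) / 2 - b - c = a / 2 - c - b + 1 / 2 by ring,
    show 1 + (a - 1) / 2 - b = 1 / 2 + a / 2 - b by ring,
    show 1 + (a - 1) / 2 - c = 1 / 2 + a / 2 - c by ring,
    show 1 + (a - 1) / 2 = a / 2 + 1 / 2 by ring, show a / 2 - b - c = a / 2 - c - b by ring]
  simp only [div_eq_mul_inv, mul_inv]
  ring


/-- A contiguous relation expressing `X₂,₀` through Dixon's series and its companion. -/
theorem dixonTwo_contiguous {a b c : ℂ} (hb : ¬ IsNonposInt (3 + a - b))
    (hc : ¬ IsNonposInt (3 + a - c)) (hs : 0 < (6 + a - 2 * b - 2 * c).re) :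
    2 * (b - 1) * (b - 2) * (c - 1) * (c - 2) * (4 + a - 2 * b - 2 * c) *
        (HypParams.mk a b c (3 + a - b) (3 + a - c)).sum =
      (a + 1) * (3 + a - b - c) * ((2 + a - 2 * c) * (2 + a - 2 * b) * (a + 5 - 2 * b - 2 * c) -
        2 * (b - 1) * (c - 1) * (a + 6 - 2 * b - 2 * c)) *
        veryWellPoisedSum (a + 1) (b - 1) (c - 1) -
      a * (3 + a - 2 * b) * (3 + a - 2 * c) * (3 + a - b - c) * (4 + a - 2 * b - 2 * c) *
        dixonSum (a + 1) (b - 1) (c - 1) := by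
  have h0 := HypParams.hasSum ⟨a, b, c, 3 + a - b, 3 + a - c⟩ hb hc (by
    simp only [HypParams.excess]; ring_nf at hs ⊢; exact hs)
  have h1 := HypParams.hasSum ⟨a + 1 + 1, b - 1, c - 1, 3 + a - b, 3 + a - c⟩ hb hc (by
    simp only [HypParams.excess]; ring_nf at hs ⊢; exact hs)
  have h2 := HypParams.hasSum ⟨a + 1, b - 1, c - 1, 3 + a - b, 3 + a - c⟩ hb hc (by
    have : (HypParams.mk (a + 1) (b - 1) (c - 1) (3 + a - b) (3 + a - c)).excess =
      6 + a - 2 * b - 2 * c + 1 := by simp only [HypParams.excess]; ring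
    rw [this, add_re, one_re]; linarith)
  -- This auxiliary series has excess `s - 1` and need not converge. The real part exceeds `-1`, so
  -- its terms still tend to `0`, and no more is needed.
  have hG := HypParams.tendsto_pow_mul_term ⟨a + 1, b, c, 3 + a - b, 3 + a - c⟩ hb hc 0 (by
    have : (HypParams.mk (a + 1) b c (3 + a - b) (3 + a - c)).excess =
      6 + a - 2 * b - 2 * c - 1 := by simp only [HypParams.excess]; ring
    rw [this, sub_re, one_re]; push_cast; linarith)
  have hV : veryWellPoisedSum (a + 1) (b - 1) (c - 1) =
      2 * (HypParams.mk (a + 1 + 1) (b - 1) (c - 1) (3 + a - b) (3 + a - c)).sum -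
      (HypParams.mk (a + 1) (b - 1) (c - 1) (3 + a - b) (3 + a - c)).sum := by
    rw [veryWellPoisedSum, dixonSum, show 1 + (a + 1) - (b - 1) = 3 + a - b by ring,
      show 1 + (a + 1) - (c - 1) = 3 + a - c by ring]
  have hD : dixonSum (a + 1) (b - 1) (c - 1) =
      (HypParams.mk (a + 1) (b - 1) (c - 1) (3 + a - b) (3 + a - c)).sum := by
    rw [dixonSum, show 1 + (a + 1) - (b - 1) = 3 + a - b by ring,
      show 1 + (a + 1) - (c - 1) = 3 + a - c by ring]
  rw [hV, hD]
  set A := 2 * (b - 1) * (b - 2) * (c - 1) * (c - 2) * (4 + a - 2 * b - 2 * c) with hA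
  set B := (3 + a - b - c) * ((2 + a - 2 * c) * (2 + a - 2 * b) * (a + 5 - 2 * b - 2 * c) -
        2 * (b - 1) * (c - 1) * (a + 6 - 2 * b - 2 * c)) with hB
  set C := a * (3 + a - 2 * b) * (3 + a - 2 * c) * (3 + a - b - c) * (4 + a - 2 * b - 2 * c)
    with hC
  have h := ((h0.mul_left A).sub (((h1.mul_left 2).sub h2).mul_left ((a + 1) * B))).add
    (h2.mul_left C)
  -- The polynomial factor of the certificate is constant, so it must be the zeroth combined summand
  -- `A - (a + 1) B + C`.
  have h' := h.eq_of_partial_sums (G := fun n => (A - (a + 1) * B + C) *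
    (HypParams.mk (a + 1) b c (3 + a - b) (3 + a - c)).term n) (by simp; ring) ?_
    (by simpa using hG.const_mul (A - (a + 1) * B + C))
  · rw [hB] at h'
    linear_combination h'
  · intro n
    set Q : HypParams := ⟨a + 1, b, c, 3 + a - b, 3 + a - c⟩ with hQ
    have n1 : (n : ℂ) + 1 ≠ 0 := by exact_mod_cast n.succ_ne_zero
    have nf : (n.factorial : ℂ) ≠ 0 := by exact_mod_cast n.factorial_ne_zero
    have dn := add_natCast_ne_zero hb n
    have en := add_natCast_ne_zero hc n
    have dp := poch_ne_zero hb n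
    have ep := poch_ne_zero hc n
    have t0 : (HypParams.mk a b c (3 + a - b) (3 + a - c)).term (n + 1) = Q.term n *
        (a * (b + n) * (c + n) / ((3 + a - b + n) * (3 + a - c + n) * (n + 1))) := by
      simp only [HypParams.term_eq, hQ, poch_succ_left a, poch_succ (3 + a - b),
        poch_succ (3 + a - c), poch_succ b, poch_succ c, Nat.factorial_succ]
      push_cast
      field_simp
    have t1 : (a + 1) * (HypParams.mk (a + 1 + 1) (b - 1) (c - 1) (3 + a - b)
        (3 + a - c)).term (n + 1) = Q.term n * ((a + 1 + n) * (a + 2 + n) * (b - 1) * (c - 1) /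
          ((3 + a - b + n) * (3 + a - c + n) * (n + 1))) := by
      have := poch_add_two_mul a n
      rw [show a + 2 = a + 1 + 1 by ring] at this
      simp only [HypParams.term_eq, hQ, poch_succ_left (b - 1), poch_succ_left (c - 1),
        sub_add_cancel, poch_succ (3 + a - b), poch_succ (3 + a - c), Nat.factorial_succ]
      push_cast
      field_simp
      linear_combination (b - 1) * poch b n * (c - 1) * poch c n * this
    have t2 : (HypParams.mk (a + 1) (b - 1) (c - 1) (3 + a - b) (3 + a - c)).term (n + 1) =
        Q.term n * ((a + 1 + n) * (b - 1) * (c - 1) /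
          ((3 + a - b + n) * (3 + a - c + n) * (n + 1))) := by
      simp only [HypParams.term_eq, hQ, poch_succ_left (b - 1), poch_succ_left (c - 1),
        sub_add_cancel, poch_succ (a + 1), poch_succ (3 + a - b), poch_succ (3 + a - c),
        Nat.factorial_succ]
      push_cast
      field_simp
    have key : A * (a * (b + n) * (c + n) / ((3 + a - b + n) * (3 + a - c + n) * (n + 1))) -
        B * (2 * ((a + 1 + n) * (a + 2 + n) * (b - 1) * (c - 1) /
          ((3 + a - b + n) * (3 + a - c + n) * (n + 1))) -
          (a + 1) * ((a + 1 + n) * (b - 1) * (c - 1) /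
          ((3 + a - b + n) * (3 + a - c + n) * (n + 1)))) +
        C * ((a + 1 + n) * (b - 1) * (c - 1) /
          ((3 + a - b + n) * (3 + a - c + n) * (n + 1))) =
        (A - (a + 1) * B + C) * (Q.ratio n - 1) := by
      simp only [HypParams.ratio, hQ]
      field_simp
      simp only [hA, hB, hC]
      ring
    rw [t0, t2, Q.term_succ n]
    linear_combination (-2 * B) * t1 + Q.term n * key

theorem hasSum_dixonClosedTwo {p : ℂ × ℂ × ℂ} (hp : p ∈ dixonDomainTwo)
    (hs : 0 < (dixonParams 2 0 p).excess.re) :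
    HasSum (dixonParams 2 0 p).term (dixonClosedTwo p) := by
  obtain ⟨a, b, c⟩ := p
  obtain ⟨⟨hb, hc, -⟩, h2, b1, b2, c1, c2⟩ := hp
  have key := HypParams.hasSum _ hb hc hs
  convert key using 1
  have hP : dixonParams 2 0 (a, b, c) = ⟨a, b, c, 3 + a - b, 3 + a - c⟩ := by
    simp only [dixonParams]
    push_cast
    congr 1 <;> ring
  rw [hP] at hb hc hs h2 ⊢
  have hex : (HypParams.mk a b c (3 + a - b) (3 + a - c)).excess = 6 + a - 2 * b - 2 * c := by
    simp only [HypParams.excess]; ring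
  rw [hex] at hs h2
  simp only at hb hc b1 b2 c1 c2
  have h := dixonTwo_contiguous hb hc hs
  rw [show 3 + a - b = 1 + (a + 1) - (b - 1) by ring] at hb
  rw [show 3 + a - c = 1 + (a + 1) - (c - 1) by ring] at hc
  have hs0 : 2 + (a + 1) - 2 * (b - 1) - 2 * (c - 1) = 6 + a - 2 * b - 2 * c + 1 := by ring
  rw [veryWellPoisedSum_eq hb hc (by ring_nf at hs ⊢; exact hs),
    dixonSum_eq hb hc (by rw [hs0, add_re, one_re]; linarith)] at h
  have n2 : 4 + a - 2 * b - 2 * c ≠ 0 := fun h0 => h2 (by linear_combination h0)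
  have n2' : 2 + a / 2 - c - b ≠ 0 := fun h0 => n2 (by linear_combination 2 * h0)
  have m1 : b - 1 ≠ 0 := sub_ne_zero.2 b1
  have m2 : b - 2 ≠ 0 := sub_ne_zero.2 b2
  have m3 : c - 1 ≠ 0 := sub_ne_zero.2 c1
  have m4 : c - 2 ≠ 0 := sub_ne_zero.2 c2
  rw [show -(a + 1) = -a + -1 by ring, cpow_add _ _ two_ne_zero, cpow_neg_one,
    show 1 + (a + 1) - (b - 1) - (c - 1) = a + 3 - b - c + 1 by ring,
    show 1 + (a + 1) - (b - 1) = 3 + a - b by ring, show 1 + (a + 1) - (c - 1) = 3 + a - c by ring,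
    show (1 + (a + 1)) / 2 - (b - 1) - (c - 1) = 2 + a / 2 - c - b + 1 by ring,
    Gamma_add_one _ n2',
    show (1 + (a + 1)) / 2 - (b - 1) = a / 2 - b + 2 by ring,
    show (1 + (a + 1)) / 2 - (c - 1) = a / 2 + 2 - c by ring,
    show 1 + (a + 1) / 2 = a / 2 + 1 / 2 + 1 by ring,
    show a / 2 + 1 / 2 + 1 - (b - 1) - (c - 1) = 7 / 2 + a / 2 - b - c by ring,
    show a / 2 + 1 / 2 + 1 - (b - 1) = 3 / 2 + a / 2 - b + 1 by ring,
    show a / 2 + 1 / 2 + 1 - (c - 1) = 3 / 2 + a / 2 - c + 1 by ring,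
    show (1 + (a + 1)) / 2 = a / 2 + 1 by ring] at h
  have i1 := inv_gamma_eq (a + 3 - b - c)
  have i2 := inv_gamma_eq (a / 2 + 1 / 2)
  have i3 := inv_gamma_eq (3 / 2 + a / 2 - b)
  have i4 := inv_gamma_eq (3 / 2 + a / 2 - c)
  have i5 := inv_gamma_eq (a / 2)
  have p1 : ((2 : ℂ) ^ a)⁻¹ = (2 : ℂ) ^ (-a) := (cpow_neg _ _).symm
  have p2 : ((2 : ℂ) ^ (-2 + a))⁻¹ = 4 * (2 : ℂ) ^ (-a) := by
    rw [← cpow_neg, show -(-2 + a) = 2 + -a by ring, cpow_add _ _ two_ne_zero]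
    norm_num
  -- The cancelled coefficient is nonzero exactly because `b, c ∉ {1, 2}` and the excess is not `2`;
  -- its last factor is the excess minus `2`.
  refine mul_left_cancel₀ (mul_ne_zero (mul_ne_zero (mul_ne_zero (mul_ne_zero
    (mul_ne_zero two_ne_zero m1) m2) m3) m4) n2) (Eq.trans ?_ h.symm)
  simp only [dixonClosedTwo, div_eq_mul_inv _ (_ * _ : ℂ), mul_inv, p1, p2]
  rw [i1, i2, i3, i4, i5]
  rw [show -2 + b = b - 2 by ring, show -2 + c = c - 2 by ring]
  generalize (Gamma (a + 3 - b - c + 1))⁻¹ = y1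
  generalize (Gamma (a / 2 + 1 / 2 + 1))⁻¹ = y2
  generalize (Gamma (3 / 2 + a / 2 - b + 1))⁻¹ = y3
  generalize (Gamma (3 / 2 + a / 2 - c + 1))⁻¹ = y4
  generalize (Gamma (a / 2 + 1))⁻¹ = y5
  generalize (Gamma (a / 2 - b + 2))⁻¹ = y6
  generalize (Gamma (a / 2 + 2 - c))⁻¹ = y7
  generalize Gamma (7 / 2 + a / 2 - b - c) = y8
  generalize Gamma (2 + a / 2 - c - b) = y9
  generalize Gamma (3 + a - c) = y10
  generalize Gamma (3 + a - b) = y11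
  generalize (2 : ℂ) ^ (-a) = y12
  generalize (Real.sqrt Real.pi : ℂ) = y13
  field_simp
  ring


/-! ### Watson's theorem by way of Gauss's second summation theorem. -/

/-- Watson's series `₃F₂(a, b, c; (a + b + 1) / 2, 2 c | 1)`. -/
noncomputable def watsonSum (a b c : ℂ) : ℂ := (HypParams.mk a b c ((a + b + 1) / 2) (2 * c)).sum

/-- The recurrence in `c` with `a, b` fixed. The certificate is `-(a + n)(b + n)` times the term of
the series at `c + 1`. -/
theorem watsonSum_add_one {a b c : ℂ} (hd : ¬ IsNonposInt ((a + b + 1) / 2))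
    (hc : ¬ IsNonposInt (2 * c)) (hs : 0 < (c + 1 / 2 - a / 2 - b / 2).re) :
    watsonSum a b c * ((c + 1 / 2) * (c + 1 / 2 - a / 2 - b / 2)) =
      watsonSum a b (c + 1) * ((c + 1 / 2 - a / 2) * (c + 1 / 2 - b / 2)) := by
  have hc2 : ¬ IsNonposInt (2 * (c + 1)) := by
    convert not_isNonposInt_add_natCast hc 2 using 2; push_cast; ring
  have ex0 : (HypParams.mk a b c ((a + b + 1) / 2) (2 * c)).excess =
    c + 1 / 2 - a / 2 - b / 2 := by simp only [HypParams.excess]; ring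
  have ex1 : (HypParams.mk a b (c + 1) ((a + b + 1) / 2) (2 * (c + 1))).excess =
    c + 1 / 2 - a / 2 - b / 2 + 1 := by simp only [HypParams.excess]; ring
  have hex1 : 1 < (HypParams.mk a b (c + 1) ((a + b + 1) / 2) (2 * (c + 1))).excess.re := by
    rw [ex1, add_re, one_re]; linarith
  have h0 := HypParams.hasSum _ hd hc (ex0 ▸ hs)
  have h1 := HypParams.hasSum _ hd hc2 (by linarith)
  have h := (h0.mul_left ((2 * c + 1) * (2 * c + 1 - a - b))).sub
    (h1.mul_left ((2 * c + 1 - a) * (2 * c + 1 - b)))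
  have hG := HypParams.tendsto_quadratic_mul_term
    ⟨a, b, c + 1, (a + b + 1) / 2, 2 * (c + 1)⟩ hd hc2 hex1 (-(a * b)) (-(a + b)) (-1)
  have h' := h.eq_of_partial_sums ?_ ?_ hG
  · rw [watsonSum, watsonSum]
    linear_combination h' / 4
  · simp; ring
  · intro n
    set Q : HypParams := ⟨a, b, c + 1, (a + b + 1) / 2, 2 * (c + 1)⟩ with hQ
    have n1 : (n : ℂ) + 1 ≠ 0 := by exact_mod_cast n.succ_ne_zero
    have nf : (n.factorial : ℂ) ≠ 0 := by exact_mod_cast n.factorial_ne_zero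
    have dn := add_natCast_ne_zero hd n
    have dp := poch_ne_zero hd n
    have ep := poch_ne_zero hc2 n
    have ep' := poch_ne_zero hc (n + 1)
    have en := add_natCast_ne_zero hc2 n
    have c0 : c ≠ 0 := fun h => ne_zero_of_not_isNonposInt hc (by rw [h, mul_zero])
    have c1 : 2 * c + 1 ≠ 0 := by simpa using add_natCast_ne_zero hc 1
    have en1 : 2 * c + 1 + (n : ℂ) ≠ 0 := by
      have := add_natCast_ne_zero hc (n + 1)
      push_cast at this
      rwa [add_assoc, add_comm 1]
    have hrel : poch (2 * c) (n + 1) * (2 * c + 1 + n) =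
        2 * c * (2 * c + 1) * poch (2 * (c + 1)) n := by
      have e1 := poch_succ (2 * c) (n + 1)
      have e2 := poch_succ_left (2 * c) (n + 1)
      have e3 := poch_succ_left (2 * c + 1) n
      rw [show 2 * c + 1 + 1 = 2 * (c + 1) by ring] at e3
      rw [e3, e1] at e2
      push_cast at e2
      linear_combination e2
    have t0 : (HypParams.mk a b c ((a + b + 1) / 2) (2 * c)).term (n + 1) = Q.term n *
        ((a + n) * (b + n) * (2 * c + 1 + n) /
          (((a + b + 1) / 2 + n) * (2 * (2 * c + 1)) * (n + 1))) := by
      simp only [HypParams.term_eq, hQ, poch_succ a, poch_succ b, poch_succ_left c,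
        poch_succ ((a + b + 1) / 2), Nat.factorial_succ]
      push_cast
      generalize poch (2 * c) (n + 1) = X at *
      generalize poch (2 * (c + 1)) n = Y at *
      generalize poch ((a + b + 1) / 2) n = Z at *
      generalize (a + b + 1) / 2 + (n : ℂ) = D at *
      generalize 2 * c + 1 + (n : ℂ) = F at *
      generalize 2 * c + 1 = E at *
      have hX : X = 2 * c * E * Y / F := by rw [eq_div_iff en1, hrel]
      rw [hX]
      field_simp
    have key : (2 * c + 1) * (2 * c + 1 - a - b) * ((a + n) * (b + n) * (2 * c + 1 + n) /
          (((a + b + 1) / 2 + n) * (2 * (2 * c + 1)) * (n + 1))) -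
        (2 * c + 1 - a) * (2 * c + 1 - b) * Q.ratio n =
        -((a + n + 1) * (b + n + 1)) * Q.ratio n + (a + n) * (b + n) := by
      simp only [HypParams.ratio, hQ]
      generalize hD : (a + b + 1) / 2 + (n : ℂ) = D at *
      -- Solving the denominator for `b` leaves a rational identity with `D` as a variable.
      have hb : b = 2 * D - 2 * n - 1 - a := by rw [← hD]; ring
      subst hb
      field_simp
      ring
    rw [t0, Q.term_succ n]
    push_cast
    linear_combination Q.term n * key

/-- The terms of `₂F₁(a, b; (a + b + 1) / 2 | 1 / 2)`. -/
noncomputable def gaussHalfTerm (a b : ℂ) (k : ℕ) : ℂ :=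
  poch a k * poch b k / (poch ((a + b + 1) / 2) k * (k.factorial : ℂ) * 2 ^ k)

theorem gaussHalfTerm_comm (a b : ℂ) (k : ℕ) : gaussHalfTerm a b k = gaussHalfTerm b a k := by
  rw [gaussHalfTerm, gaussHalfTerm, add_comm a b, mul_comm (poch a k)]

theorem gaussHalfTerm_succ (a b : ℂ) (k : ℕ) : gaussHalfTerm a b (k + 1) = gaussHalfTerm a b k *
    ((a + k) * (b + k) / (((a + b + 1) / 2 + k) * (k + 1)) * (1 / 2)) := by
  simp only [gaussHalfTerm, poch_succ, Nat.factorial_succ, pow_succ, div_mul_div_comm]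
  push_cast
  ring_nf

/-- As `c` grows, `(c)ₖ / (2c)ₖ → 2 ^ (-k)`, which turns Watson's series termwise into a `₂F₁` at
`1/2`. One majorant serves both the passage to the limit and the summability of the limit terms. -/
theorem watsonSum_tendsto_aux {a b : ℂ} (hd : ¬ IsNonposInt ((a + b + 1) / 2)) (c : ℂ) :
    Summable (gaussHalfTerm a b) ∧
    Tendsto (fun N : ℕ => watsonSum a b (c + N)) atTop (𝓝 (∑' k, gaussHalfTerm a b k)) := by
  set d : ℂ := (a + b + 1) / 2 with hdd
  -- Large enough that the majorant `Q` has excess with real part at least `1`. The factor `(T + |Im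
  -- c| + k) / (2T + k)` decreases in `T`, so it is bounded by its value at `T = M`.
  set M : ℝ := 1 + |c.im| + ‖a‖ + ‖b‖ + ‖d‖ with hM
  set Q : HypParams := ⟨a, b, (M + |c.im| : ℝ), d, (2 * M : ℝ)⟩ with hQ
  have hy0 := abs_nonneg c.im
  have hbre := abs_le.1 (abs_re_le_norm b)
  have hare := abs_le.1 (abs_re_le_norm a)
  have hdre := abs_le.1 (abs_re_le_norm d)
  have ha0 := norm_nonneg a
  have hb0 := norm_nonneg b
  have hd0 := norm_nonneg d
  have hM0 : 0 < M := by linarith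
  have hsum : Summable fun k => ‖Q.term k‖ := by
    refine Q.summable_norm hd ?_ ?_
    · exact not_isNonposInt_of_re_pos (by simp only [hQ, ofReal_re]; linarith)
    · simp only [HypParams.excess, hQ, sub_re, add_re, ofReal_re]
      linarith [hbre.2, hare.2, hdre.1]
  have hlim : ∀ k : ℕ, Tendsto (fun N : ℕ => (HypParams.mk a b (c + N) d
      (2 * (c + N))).term k) atTop (𝓝 (gaussHalfTerm a b k)) := by
    have hr : ∀ k : ℕ, Tendsto (fun N : ℕ => (HypParams.mk a b (c + N) d
      (2 * (c + N))).ratio k) atTop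
        (𝓝 ((a + k) * (b + k) / ((d + k) * (k + 1)) * (1 / 2))) := by
      intro k
      have h1 := tendsto_natCast_mul_add_inv (2 * c + k) two_ne_zero
      have h3 := ((h1.const_mul (k / 2 : ℂ)).const_add (1 / 2)).const_mul
        ((a + k) * (b + k) / ((d + k) * (k + 1)))
      simp only [mul_zero, add_zero] at h3
      refine h3.congr' ?_
      filter_upwards [eventually_gt_atTop ⌈‖2 * c + k‖⌉₊] with N hN
      have hne : (2 * c + k + 2 * N : ℂ) ≠ 0 := by
        intro h
        have h5 : (2 * c + k : ℂ) = -(2 * N) := by linear_combination h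
        have h6 := Nat.lt_of_ceil_lt hN
        rw [h5, norm_neg, norm_mul, Complex.norm_natCast] at h6
        simp at h6
        linarith [(Nat.cast_nonneg N : (0 : ℝ) ≤ N)]
      simp only [HypParams.ratio]
      push_cast
      rw [show (2 * (c + N) + k : ℂ) = 2 * c + k + 2 * N by ring]
      have : (1 / 2 + k / 2 * (2 * c + k + 2 * N)⁻¹ : ℂ) = (c + N + k) * (2 * c + k + 2 * N)⁻¹ := by
        generalize hX : (2 * c + k + 2 * N : ℂ) = X at *
        have : c = (X - k - 2 * N) / 2 := by rw [← hX]; ring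
        subst this
        field_simp
        ring
      rw [this, div_eq_mul_inv, div_eq_mul_inv, mul_inv, mul_inv, mul_inv]
      ring
    intro k
    induction k with
    | zero => simp [gaussHalfTerm]
    | succ k ih =>
      simp_rw [HypParams.term_succ, gaussHalfTerm_succ]
      exact ih.mul (hr k)
  have hbd : ∀ᶠ N : ℕ in atTop, ∀ k, ‖(HypParams.mk a b (c + N) d (2 * (c + N))).term k‖ ≤
      ‖Q.term k‖ := by
    filter_upwards [eventually_ge_atTop ⌈M + ‖c‖⌉₊] with N hN
    have hN' : M + ‖c‖ ≤ N := Nat.ceil_le.1 hN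
    have hcre := abs_le.1 (abs_re_le_norm c)
    refine HypParams.norm_term_le fun k => ?_
    have hk : (0 : ℝ) ≤ k := Nat.cast_nonneg k
    simp only [HypParams.ratio, hQ, norm_div, norm_mul]
    set T : ℝ := c.re + N with hT
    have hTM : M ≤ T := by linarith [hcre.1]
    have e1 : ‖c + N + k‖ ≤ T + |c.im| + k := by
      refine (norm_le_abs_re_add_abs_im _).trans ?_
      have : (c + N + k).re = T + k := by simp [hT]
      rw [this, abs_of_nonneg (by linarith)]
      have : (c + N + k).im = c.im := by simp
      rw [this]; linarith
    have e2 : 2 * T + k ≤ ‖2 * (c + N) + k‖ := by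
      refine le_trans (le_of_eq ?_) (re_le_norm _)
      simp [hT]
    have e3 : ‖((M + |c.im| : ℝ) : ℂ) + k‖ = M + |c.im| + k := by
      rw [← ofReal_natCast, ← ofReal_add, norm_real, Real.norm_of_nonneg (by linarith)]
    have e4 : ‖((2 * M : ℝ) : ℂ) + k‖ = 2 * M + k := by
      rw [← ofReal_natCast, ← ofReal_add, norm_real, Real.norm_of_nonneg (by linarith)]
    rw [e3, e4]
    have q1 : ‖c + N + k‖ / ‖2 * (c + N) + k‖ ≤ (M + |c.im| + k) / (2 * M + k) := by
      calc _ ≤ (T + |c.im| + k) / (2 * T + k) :=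
            div_le_div₀ (by linarith) e1 (by linarith) e2
        _ ≤ _ := by
          rw [div_le_div_iff₀ (by linarith) (by linarith)]
          nlinarith
    calc ‖a + k‖ * ‖b + k‖ * ‖c + N + k‖ / (‖d + k‖ * ‖2 * (c + N) + k‖ * ‖(k : ℂ) + 1‖)
        = (‖c + N + k‖ / ‖2 * (c + N) + k‖) *
          (‖a + k‖ * ‖b + k‖ / (‖d + k‖ * ‖(k : ℂ) + 1‖)) := by
          simp only [div_eq_mul_inv, mul_inv]; ring
      _ ≤ ((M + |c.im| + k) / (2 * M + k)) *
          (‖a + k‖ * ‖b + k‖ / (‖d + k‖ * ‖(k : ℂ) + 1‖)) := by gcongr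
      _ = _ := by simp only [div_eq_mul_inv, mul_inv]; ring
  refine ⟨Summable.of_norm_bounded hsum fun k => ?_,
    tendsto_tsum_of_dominated_convergence hsum hlim hbd⟩
  exact le_of_tendsto (hlim k).norm (hbd.mono fun N h => h k)

/-- The sum `₂F₁(a, b; (a + b + 1) / 2 | 1 / 2)`. -/
noncomputable def gaussHalfSum (a b : ℂ) : ℂ := ∑' k, gaussHalfTerm a b k

theorem summable_gaussHalfTerm {a b : ℂ} (hd : ¬ IsNonposInt ((a + b + 1) / 2)) :
    Summable (gaussHalfTerm a b) := (watsonSum_tendsto_aux hd 0).1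

theorem tendsto_watsonSum {a b : ℂ} (hd : ¬ IsNonposInt ((a + b + 1) / 2)) (c : ℂ) :
    Tendsto (fun N : ℕ => watsonSum a b (c + N)) atTop (𝓝 (gaussHalfSum a b)) :=
  (watsonSum_tendsto_aux hd c).2

theorem gaussHalfSum_comm (a b : ℂ) : gaussHalfSum a b = gaussHalfSum b a := by
  simp only [gaussHalfSum, gaussHalfTerm_comm a b]

/-- This recurrence carries the evaluation from `Re a, Re b > 0` to all admissible parameters. The
certificate is `-b` times the term with `a` and `b` both raised by one. -/
theorem gaussHalfSum_add_two {a b : ℂ} (hd : ¬ IsNonposInt ((a + b + 1) / 2)) :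
    (a + 1) * gaussHalfSum (a + 2) b = (a + b + 1) * gaussHalfSum a b := by
  have hd1 : ¬ IsNonposInt ((a + 2 + b + 1) / 2) := by
    convert not_isNonposInt_add_one hd using 2; ring
  have hd2 : ¬ IsNonposInt ((a + 1 + (b + 1) + 1) / 2) := by
    convert not_isNonposInt_add_one hd using 2; ring
  have h := ((summable_gaussHalfTerm hd1).hasSum.mul_left (a + 1)).sub
    ((summable_gaussHalfTerm hd).hasSum.mul_left (a + b + 1))
  have hG := (summable_gaussHalfTerm hd2).tendsto_atTop_zero.const_mul (-b)
  rw [mul_zero] at hG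
  refine sub_eq_zero.1 (h.eq_of_partial_sums ?_ ?_ hG)
  · simp [gaussHalfTerm]
  · intro n
    have n1 : (n : ℂ) + 1 ≠ 0 := by exact_mod_cast n.succ_ne_zero
    have nf : (n.factorial : ℂ) ≠ 0 := by exact_mod_cast n.factorial_ne_zero
    have d0 := ne_zero_of_not_isNonposInt hd
    have dn := add_natCast_ne_zero hd2 n
    have dp := poch_ne_zero hd2 n
    have t0 : gaussHalfTerm a b (n + 1) = gaussHalfTerm (a + 1) (b + 1) n *
        (a * b / (2 * ((a + b + 1) / 2) * (n + 1))) := by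
      simp only [gaussHalfTerm, poch_succ_left, Nat.factorial_succ, pow_succ]
      rw [show (a + b + 1) / 2 + 1 = (a + 1 + (b + 1) + 1) / 2 by ring]
      push_cast
      generalize poch ((a + 1 + (b + 1) + 1) / 2) n = X at *
      generalize (a + b + 1) / 2 = Y at *
      field_simp
    have t1 : (a + 1) * gaussHalfTerm (a + 2) b (n + 1) = gaussHalfTerm (a + 1) (b + 1) n *
        ((a + 1 + n) * (a + 2 + n) * b / (2 * ((a + 1 + (b + 1) + 1) / 2 + n) * (n + 1))) := by
      have := poch_add_two_mul a n
      rw [gaussHalfTerm, gaussHalfTerm, poch_succ_left b,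
        show (a + 2 + b + 1) / 2 = (a + 1 + (b + 1) + 1) / 2 by ring,
        poch_succ ((a + 1 + (b + 1) + 1) / 2) n, Nat.factorial_succ, pow_succ]
      push_cast
      generalize poch ((a + 1 + (b + 1) + 1) / 2) n = X at *
      generalize (a + 1 + (b + 1) + 1) / 2 + (n : ℂ) = Y at *
      field_simp
      linear_combination b * poch (b + 1) n * this
    have key : (a + 1 + n) * (a + 2 + n) * b / (2 * ((a + 1 + (b + 1) + 1) / 2 + n) * (n + 1)) -
        (a + b + 1) * (a * b / (2 * ((a + b + 1) / 2) * (n + 1))) =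
        -b * ((a + 1 + n) * (b + 1 + n) / (((a + 1 + (b + 1) + 1) / 2 + n) * (n + 1)) * (1 / 2))
        + b := by
      have e1 : (a + 1 + (b + 1) + 1) / 2 + (n : ℂ) ≠ 0 := dn
      have e2 : (a + b + 1) / 2 ≠ 0 := d0
      generalize hY : (a + 1 + (b + 1) + 1) / 2 + (n : ℂ) = Y at *
      have hb : b = 2 * Y - 2 * n - 3 - a := by rw [← hY]; ring
      have e3 : a + b + 1 ≠ 0 := fun h => e2 (by rw [h, zero_div])
      rw [show 2 * ((a + b + 1) / 2) = a + b + 1 by ring]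
      have e4 : (a + b + 1) * (a * b / ((a + b + 1) * (n + 1))) = a * b / (n + 1) := by
        field_simp
      rw [e4, hb]
      field_simp
      ring
    rw [t0, gaussHalfTerm_succ (a + 1) (b + 1) n]
    linear_combination t1 + gaussHalfTerm (a + 1) (b + 1) n * key

/-- Watson's series with `c` eliminated: it is determined by its limit as `c` grows. -/
theorem watsonSum_mul_inv_gamma {a b c : ℂ} (hd : ¬ IsNonposInt ((a + b + 1) / 2))
    (hc : ¬ IsNonposInt (2 * c)) (hs : 0 < (c + 1 / 2 - a / 2 - b / 2).re) :
    watsonSum a b c * ((Gamma (c + 1 / 2))⁻¹ * (Gamma (c + 1 / 2 - a / 2 - b / 2))⁻¹) =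
      gaussHalfSum a b * ((Gamma (c + 1 / 2 - a / 2))⁻¹ * (Gamma (c + 1 / 2 - b / 2))⁻¹) := by
  have h := mul_prod_inv_gamma_eq_of_tendsto ![c + 1 / 2, c + 1 / 2 - a / 2 - b / 2]
    ![c + 1 / 2 - a / 2, c + 1 / 2 - b / 2] (by simp [Fin.sum_univ_two]; ring)
    (A := watsonSum a b c) (tendsto_watsonSum hd c) fun n => ?_
  · simpa only [Fin.prod_univ_two, Matrix.cons_val] using h
  simp only [Fin.prod_univ_two, Matrix.cons_val]
  induction n with
  | zero => simp
  | succ n ih =>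
    have hc1 : ¬ IsNonposInt (2 * (c + n)) := by
      convert not_isNonposInt_add_natCast hc (2 * n) using 2; push_cast; ring
    have hs1 : 0 < (c + n + 1 / 2 - a / 2 - b / 2).re := by
      have : c + n + 1 / 2 - a / 2 - b / 2 = c + 1 / 2 - a / 2 - b / 2 + n := by ring
      rw [this, add_re, natCast_re]; positivity
    have h := watsonSum_add_one hd hc1 hs1
    simp only [poch_succ]
    push_cast
    rw [← add_assoc]
    linear_combination ((c + 1 / 2 + n) * (c + 1 / 2 - a / 2 - b / 2 + n)) * ih +
      poch (c + 1 / 2 - a / 2) n * poch (c + 1 / 2 - b / 2) n * h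

/-- The special case `c = a + b + 1` of Gauss's theorem on `₂F₁(a, b; c | 1)`. -/
theorem gaussSum_eq {a b : ℂ} (hd : ¬ IsNonposInt ((a + b + 1) / 2))
    (hc : ¬ IsNonposInt (a + b + 1)) :
    watsonSum a b ((a + b + 1) / 2) =
      Gamma (a + b + 1) * ((Gamma (a + 1))⁻¹ * (Gamma (b + 1))⁻¹) := by
  have h2 : 2 * ((a + b + 1) / 2) = a + b + 1 := by ring
  have hP := HypParams.hasSum ⟨a, b, (a + b + 1) / 2, (a + b + 1) / 2, a + b + 1⟩ hd hc (by
    have : (HypParams.mk a b ((a + b + 1) / 2) ((a + b + 1) / 2) (a + b + 1)).excess = 1 := by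
      simp only [HypParams.excess]; ring
    rw [this]; simp)
  have h1 : ∀ n : ℕ, poch 1 n = (n.factorial : ℂ) := fun n => ascPochhammer_eval_one ℂ n
  -- At excess `1` the partial sums are closed: the first `n + 1` terms add up to `(a + 1)ₙ (b + 1)ₙ
  -- / ((a + b + 1)ₙ (1)ₙ)`.
  have h := mul_prod_inv_gamma_eq_of_tendsto ![a + 1, b + 1] ![a + b + 1, 1]
    (by simp [Fin.sum_univ_two]; ring) (A := 1)
    (hP.tendsto_sum_nat.comp (tendsto_add_atTop_nat 1)) fun n => ?_
  · simp only [Fin.prod_univ_two, Matrix.cons_val, Gamma_one, inv_one, mul_one, one_mul] at h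
    rw [watsonSum, h2, h]
    have := gamma_ne_zero hc
    field_simp
  simp only [Fin.prod_univ_two, Matrix.cons_val, Function.comp, one_mul]
  induction n with
  | zero => simp
  | succ n ih =>
    rw [Finset.sum_range_succ, add_mul]
    have ht : (HypParams.mk a b ((a + b + 1) / 2) ((a + b + 1) / 2) (a + b + 1)).term (n + 1) *
        (poch (a + b + 1) (n + 1) * poch 1 (n + 1)) = a * poch (a + 1) n * (b * poch (b + 1) n) := by
      have e1 := poch_ne_zero hc (n + 1)
      have e2 := poch_ne_zero hd (n + 1)
      have e3 : ((n + 1).factorial : ℂ) ≠ 0 := by exact_mod_cast (n + 1).factorial_ne_zero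
      rw [h1, HypParams.term_eq, ← poch_succ_left, ← poch_succ_left]
      generalize poch (a + b + 1) (n + 1) = X at *
      generalize poch ((a + b + 1) / 2) (n + 1) = Y at *
      simp only
      field_simp
    rw [ht, poch_succ (a + b + 1), poch_succ 1, poch_succ (a + 1), poch_succ (b + 1)]
    linear_combination (a + b + 1 + n) * (1 + n) * ih

/-- At `c = (a + b + 1)/2` the left side of `watsonSum_mul_inv_gamma` is known from Gauss's theorem,
so the relation can be solved for the limit. Positive real parts keep every gamma value involved
finite and nonzero; duplication then halves the arguments. -/
theorem gaussHalfSum_eq_of_re_pos {a b : ℂ} (ha : 0 < a.re) (hb : 0 < b.re) :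
    gaussHalfSum a b = (Real.sqrt Real.pi : ℂ) * Gamma ((a + b + 1) / 2) *
      ((Gamma ((a + 1) / 2))⁻¹ * (Gamma ((b + 1) / 2))⁻¹) := by
  have hpos : 0 < (a + b + 1).re := by rw [add_re, add_re, one_re]; linarith
  have hc := not_isNonposInt_of_re_pos hpos
  have half : ∀ z : ℂ, 0 < z.re → ¬ IsNonposInt (z / 2) := by
    intro z hz
    refine not_isNonposInt_of_re_pos ?_
    rw [show z / 2 = z / (2 : ℝ) by push_cast; rfl, div_ofReal_re]
    positivity
  have h2 : 2 * ((a + b + 1) / 2) = a + b + 1 := by ring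
  have h := watsonSum_mul_inv_gamma (c := (a + b + 1) / 2) (half _ hpos) (by rwa [h2]) (by
    rw [show (a + b + 1) / 2 + 1 / 2 - a / 2 - b / 2 = 1 by ring]; simp)
  have d1 := gamma_duplication (a + b + 1)
  have d2 := gamma_duplication (a + 1)
  have d3 := gamma_duplication (b + 1)
  rw [gaussSum_eq (half _ hpos) hc,
    show (a + b + 1) / 2 + 1 / 2 - a / 2 - b / 2 = 1 by ring, Gamma_one,
    show (a + b + 1) / 2 + 1 / 2 - a / 2 = (b + 1) / 2 + 1 / 2 by ring,
    show (a + b + 1) / 2 + 1 / 2 - b / 2 = (a + 1) / 2 + 1 / 2 by ring] at h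
  have p1 : (2 : ℂ) ^ (1 - (a + 1)) * (2 : ℂ) ^ (1 - (b + 1)) = (2 : ℂ) ^ (1 - (a + b + 1)) := by
    rw [← cpow_add _ _ two_ne_zero]; ring_nf
  have ha1 : 0 < (a + 1).re := by rw [add_re, one_re]; linarith
  have hb1 : 0 < (b + 1).re := by rw [add_re, one_re]; linarith
  have n0 := sqrt_pi_ne_zero
  have n1 := two_cpow_ne_zero (1 - (a + 1))
  have n2 := two_cpow_ne_zero (1 - (b + 1))
  have g1 := gamma_ne_zero (not_isNonposInt_of_re_pos ha1)
  have g2 := gamma_ne_zero (not_isNonposInt_of_re_pos hb1)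
  have g3 := gamma_ne_zero hc
  have g4 := gamma_ne_zero (half _ hpos)
  have g5 := gamma_ne_zero (half _ ha1)
  have g6 := gamma_ne_zero (half _ hb1)
  rw [← p1] at d1
  generalize (2 : ℂ) ^ (1 - (a + 1)) = X1 at *
  generalize (2 : ℂ) ^ (1 - (b + 1)) = X2 at *
  generalize (Real.sqrt Real.pi : ℂ) = R at *
  generalize Gamma (a + 1) = G1 at *
  generalize Gamma (b + 1) = G2 at *
  generalize Gamma (a + b + 1) = G3 at *
  generalize Gamma ((a + b + 1) / 2 + 1 / 2) = G4' at *
  generalize Gamma ((a + 1) / 2 + 1 / 2) = G5' at *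
  generalize Gamma ((b + 1) / 2 + 1 / 2) = G6' at *
  generalize Gamma ((a + b + 1) / 2) = G4 at *
  generalize Gamma ((a + 1) / 2) = G5 at *
  generalize Gamma ((b + 1) / 2) = G6 at *
  have e4 : G4' = G3 * (X1 * X2) * R / G4 := by rw [eq_div_iff g4, ← d1, mul_comm]
  have e5 : G5' = G1 * X1 * R / G5 := by rw [eq_div_iff g5, ← d2, mul_comm]
  have e6 : G6' = G2 * X2 * R / G6 := by rw [eq_div_iff g6, ← d3, mul_comm]
  rw [e4, e5, e6] at h
  field_simp at h ⊢
  exact h.symm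

theorem gaussHalfSum_eq_of_add_two {a b : ℂ} (hd : ¬ IsNonposInt ((a + b + 1) / 2))
    (h : gaussHalfSum (a + 2) b = (Real.sqrt Real.pi : ℂ) * Gamma ((a + 2 + b + 1) / 2) *
      ((Gamma ((a + 2 + 1) / 2))⁻¹ * (Gamma ((b + 1) / 2))⁻¹)) :
    gaussHalfSum a b = (Real.sqrt Real.pi : ℂ) * Gamma ((a + b + 1) / 2) *
      ((Gamma ((a + 1) / 2))⁻¹ * (Gamma ((b + 1) / 2))⁻¹) := by
  have d0 := ne_zero_of_not_isNonposInt hd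
  have h2 := gaussHalfSum_add_two hd
  have d1 : a + b + 1 ≠ 0 := fun h => d0 (by rw [h, zero_div])
  refine mul_left_cancel₀ d1 ?_
  rw [← h2, h, show (a + 2 + b + 1) / 2 = (a + b + 1) / 2 + 1 by ring, Gamma_add_one _ d0,
    inv_gamma_eq ((a + 1) / 2), show (a + 2 + 1) / 2 = (a + 1) / 2 + 1 by ring]
  ring

/-- Gauss's second summation theorem. -/
theorem gaussHalfSum_eq {a b : ℂ} (hd : ¬ IsNonposInt ((a + b + 1) / 2)) :
    gaussHalfSum a b = (Real.sqrt Real.pi : ℂ) * Gamma ((a + b + 1) / 2) *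
      ((Gamma ((a + 1) / 2))⁻¹ * (Gamma ((b + 1) / 2))⁻¹) := by
  have step : ∀ (n : ℕ) (a b : ℂ), ¬ IsNonposInt ((a + b + 1) / 2) →
      gaussHalfSum (a + 2 * n) b =
        (Real.sqrt Real.pi : ℂ) * Gamma ((a + 2 * n + b + 1) / 2) *
        ((Gamma ((a + 2 * n + 1) / 2))⁻¹ * (Gamma ((b + 1) / 2))⁻¹) →
      gaussHalfSum a b = (Real.sqrt Real.pi : ℂ) * Gamma ((a + b + 1) / 2) *
        ((Gamma ((a + 1) / 2))⁻¹ * (Gamma ((b + 1) / 2))⁻¹) := by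
    intro n
    induction n with
    | zero => intro a b _ h; simpa using h
    | succ n ih =>
      intro a b hd h
      refine gaussHalfSum_eq_of_add_two hd (ih (a + 2) b ?_ ?_)
      · convert not_isNonposInt_add_one hd using 2; ring
      · push_cast at h
        rwa [show a + 2 * (n + 1 : ℂ) = a + 2 + 2 * n by ring] at h
  -- The recurrence shifts only the first parameter. It is applied once to `a` and, after exchanging
  -- the two by symmetry, once to `b`, until both real parts are positive.
  obtain ⟨n, hn⟩ := exists_nat_gt (‖a‖ + ‖b‖)
  have hare := (abs_le.1 (abs_re_le_norm a)).1
  have hbre := (abs_le.1 (abs_re_le_norm b)).1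
  have ha0 := norm_nonneg a
  have hb0 := norm_nonneg b
  have ha : 0 < (a + 2 * n).re := by simp; linarith
  have hb : 0 < (b + 2 * n).re := by simp; linarith
  refine step n a b hd ?_
  have hd1 : ¬ IsNonposInt ((b + (a + 2 * n) + 1) / 2) := by
    convert not_isNonposInt_add_natCast hd n using 2; ring
  have h := step n b (a + 2 * n) hd1 (by
    rw [gaussHalfSum_eq_of_re_pos hb ha])
  rw [gaussHalfSum_comm, h, add_comm b, mul_comm (Gamma ((b + 1) / 2))⁻¹]

/-- Watson's theorem. -/
theorem watsonSum_eq {a b c : ℂ} (hd : ¬ IsNonposInt ((a + b + 1) / 2))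
    (hc : ¬ IsNonposInt (2 * c)) (hs : 0 < (c + 1 / 2 - a / 2 - b / 2).re) :
    watsonSum a b c = (Real.sqrt Real.pi : ℂ) * Gamma ((a + b + 1) / 2) * Gamma (c + 1 / 2) *
      Gamma (c + 1 / 2 - a / 2 - b / 2) * ((Gamma ((a + 1) / 2))⁻¹ * (Gamma ((b + 1) / 2))⁻¹ *
      (Gamma (c + 1 / 2 - a / 2))⁻¹ * (Gamma (c + 1 / 2 - b / 2))⁻¹) := by
  have h := watsonSum_mul_inv_gamma hd hc hs
  rw [gaussHalfSum_eq hd] at h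
  -- A pole at `c + 1/2 = -k` would make `2c = -(2k + 1)` a nonpositive integer.
  have g1 : Gamma (c + 1 / 2) ≠ 0 := by
    refine gamma_ne_zero fun ⟨k, hk⟩ => hc ⟨2 * k + 1, ?_⟩
    push_cast; linear_combination 2 * hk
  have g2 := gamma_ne_zero (not_isNonposInt_of_re_pos hs)
  rw [← mul_inv, ← div_eq_mul_inv, div_eq_iff (mul_ne_zero g1 g2)] at h
  rw [h]
  ring


/-! ### The closed forms of `W₋₁,₀` and `W₂,₀` where the series converges. -/

/-- A contiguous relation expressing `W₋₁,₀` through Watson's series. -/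
theorem watsonNegOne_contiguous {a b c : ℂ} (hd : ¬ IsNonposInt ((a + b) / 2))
    (hc : ¬ IsNonposInt (2 * c)) (hs : 0 < (c - a / 2 - b / 2).re) :
    (2 * c - a - b) * (HypParams.mk a b c ((a + b) / 2) (2 * c)).sum =
      (2 * c - b) * watsonSum a (b - 1) c + (2 * c - a) * watsonSum (a - 1) b c := by
  have ex0 : (HypParams.mk a b c ((a + b) / 2) (2 * c)).excess = c - a / 2 - b / 2 := by
    simp only [HypParams.excess]; ring
  have h0 := HypParams.hasSum _ hd hc (ex0 ▸ hs)
  have h1 := HypParams.hasSum ⟨a, b - 1, c, (a + b) / 2, 2 * c⟩ hd hc (by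
    have : (HypParams.mk a (b - 1) c ((a + b) / 2) (2 * c)).excess = c - a / 2 - b / 2 + 1 := by
      simp only [HypParams.excess]; ring
    rw [this, add_re, one_re]; linarith)
  have h2 := HypParams.hasSum ⟨a - 1, b, c, (a + b) / 2, 2 * c⟩ hd hc (by
    have : (HypParams.mk (a - 1) b c ((a + b) / 2) (2 * c)).excess = c - a / 2 - b / 2 + 1 := by
      simp only [HypParams.excess]; ring
    rw [this, add_re, one_re]; linarith)
  rw [watsonSum, watsonSum, show (a + (b - 1) + 1) / 2 = (a + b) / 2 by ring,
    show (a - 1 + b + 1) / 2 = (a + b) / 2 by ring]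
  have h := (h0.mul_left (2 * c - a - b)).sub
    ((h1.mul_left (2 * c - b)).add (h2.mul_left (2 * c - a)))
  set T : HypParams := ⟨a, b, c, (a + b) / 2, 2 * c⟩ with hT
  -- Lowering `a` or `b` by one keeps the bottom parameters, so the certificate uses the series
  -- `W₋₁,₀` itself. Its linear factor is harmless because the excess has positive real part.
  have hG : Tendsto (fun n : ℕ => -2 * (c + n) * T.term n) atTop (𝓝 0) := by
    have t0 := (T.tendsto_pow_mul_term hd hc 0 (by rw [ex0]; push_cast; linarith)).const_mul (-2 * c)
    have t1 := (T.tendsto_pow_mul_term hd hc 1 (by rw [ex0]; push_cast; linarith)).const_mul (-2)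
    have := t0.add t1
    simp only [mul_zero, add_zero] at this
    exact this.congr fun n => by ring
  refine sub_eq_zero.1 (h.eq_of_partial_sums ?_ ?_ hG)
  · simp; ring
  · intro n
    have n1 : (n : ℂ) + 1 ≠ 0 := by exact_mod_cast n.succ_ne_zero
    have nf : (n.factorial : ℂ) ≠ 0 := by exact_mod_cast n.factorial_ne_zero
    have dn := add_natCast_ne_zero hd n
    have dp := poch_ne_zero hd n
    have ep := poch_ne_zero hc n
    have en := add_natCast_ne_zero hc n
    have t1 : (HypParams.mk a (b - 1) c ((a + b) / 2) (2 * c)).term (n + 1) = T.term n *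
        ((a + n) * (b - 1) * (c + n) / (((a + b) / 2 + n) * (2 * c + n) * (n + 1))) := by
      simp only [HypParams.term_eq, hT, poch_succ a, poch_succ_left (b - 1), sub_add_cancel,
        poch_succ c, poch_succ ((a + b) / 2), poch_succ (2 * c), Nat.factorial_succ]
      push_cast
      generalize poch ((a + b) / 2) n = Z at *
      generalize (a + b) / 2 + (n : ℂ) = D at *
      field_simp
    have t2 : (HypParams.mk (a - 1) b c ((a + b) / 2) (2 * c)).term (n + 1) = T.term n *
        ((a - 1) * (b + n) * (c + n) / (((a + b) / 2 + n) * (2 * c + n) * (n + 1))) := by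
      simp only [HypParams.term_eq, hT, poch_succ b, poch_succ_left (a - 1), sub_add_cancel,
        poch_succ c, poch_succ ((a + b) / 2), poch_succ (2 * c), Nat.factorial_succ]
      push_cast
      generalize poch ((a + b) / 2) n = Z at *
      generalize (a + b) / 2 + (n : ℂ) = D at *
      field_simp
    have key : (2 * c - a - b) * T.ratio n -
        ((2 * c - b) * ((a + n) * (b - 1) * (c + n) / (((a + b) / 2 + n) * (2 * c + n) * (n + 1))) +
        (2 * c - a) * ((a - 1) * (b + n) * (c + n) / (((a + b) / 2 + n) * (2 * c + n) * (n + 1)))) =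
        -2 * (c + n + 1) * T.ratio n + 2 * (c + n) := by
      simp only [HypParams.ratio, hT]
      generalize hD : (a + b) / 2 + (n : ℂ) = D at *
      have hb : b = 2 * D - 2 * n - a := by rw [← hD]; ring
      subst hb
      field_simp
      ring
    rw [t1, t2, T.term_succ n]
    push_cast
    linear_combination T.term n * key

theorem hasSum_watsonClosedNegOne {p : ℂ × ℂ × ℂ} (hp : p ∈ watsonDomainNegOne)
    (hs : 0 < (watsonParams (-1) 0 p).excess.re) :
    HasSum (watsonParams (-1) 0 p).term (watsonClosedNegOne p) := by
  obtain ⟨a, b, c⟩ := p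
  obtain ⟨hd, hc, -⟩ := hp
  have key := HypParams.hasSum _ hd hc hs
  convert key using 1
  have hP : watsonParams (-1) 0 (a, b, c) = ⟨a, b, c, (a + b) / 2, 2 * c⟩ := by
    simp only [watsonParams]
    push_cast
    congr 1 <;> ring
  rw [hP] at hd hc hs ⊢
  have hex : (HypParams.mk a b c ((a + b) / 2) (2 * c)).excess = c - a / 2 - b / 2 := by
    simp only [HypParams.excess]; ring
  rw [hex] at hs
  simp only at hd hc
  have h := watsonNegOne_contiguous hd hc hs
  have hs1 : 0 < (c - a / 2 - b / 2 + 1).re := by rw [add_re, one_re]; linarith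
  rw [watsonSum_eq (a := a) (b := b - 1) (by convert hd using 2; ring) hc (by
      convert hs1 using 2; ring),
    watsonSum_eq (a := a - 1) (b := b) (by convert hd using 2; ring) hc (by
      convert hs1 using 2; ring)] at h
  have n0 := ne_zero_of_not_isNonposInt (not_isNonposInt_of_re_pos hs)
  have n1 : 2 * c - a - b ≠ 0 := fun h0 => n0 (by linear_combination h0 / 2)
  -- The leading coefficient `2c - a - b` is twice the excess, so it is nonzero without a further
  -- restriction.
  refine mul_left_cancel₀ n1 (Eq.trans ?_ h.symm)
  rw [show (a + (b - 1) + 1) / 2 = a / 2 + b / 2 by ring,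
    show (a - 1 + b + 1) / 2 = a / 2 + b / 2 by ring,
    show c + 1 / 2 - a / 2 - (b - 1) / 2 = c - a / 2 - b / 2 + 1 by ring,
    show c + 1 / 2 - (a - 1) / 2 - b / 2 = c - a / 2 - b / 2 + 1 by ring,
    Gamma_add_one _ n0, show (b - 1 + 1) / 2 = b / 2 by ring,
    show (a - 1 + 1) / 2 = a / 2 by ring, show (a + 1) / 2 = a / 2 + 1 / 2 by ring,
    show (b + 1) / 2 = b / 2 + 1 / 2 by ring,
    show c + 1 / 2 - (b - 1) / 2 = c - b / 2 + 1 by ring,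
    show c + 1 / 2 - (a - 1) / 2 = c - a / 2 + 1 by ring, watsonClosedNegOne]
  simp only
  rw [show -a / 2 - b / 2 + c = c - a / 2 - b / 2 by ring,
    show 1 / 2 - a / 2 + c = c + 1 / 2 - a / 2 by ring,
    show 1 / 2 - b / 2 + c = c + 1 / 2 - b / 2 by ring]
  simp only [one_div, mul_inv]
  rw [inv_gamma_eq (c - a / 2), inv_gamma_eq (c - b / 2)]
  ring


set_option maxHeartbeats 4000000 in
/-- The rational identity behind the contiguous relation for `W₂,₀`. -/
theorem exists_watsonTwo_telescoping {a b c q den p0 : ℂ}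
    (h1 : 2 * c + 1 ≠ 0) (h2 : c + 1 ≠ 0) (h3 : 2 * c + 3 ≠ 0)
    (hq : q = a ^ 2 - 2 * c * a - 2 * c * b - 1 + 2 * c + b ^ 2)
    (hden : den = 2 * (2 * c + 3) * (2 * c + 1) * (2 * c - 1 - a - b) * (2 * c + 1 - a - b) *
      (b - a - 1) * (b - a + 1))
    (h_p0 : p0 = den + 2 * q * (a + 1) * (2 * c + 1 - a) * (2 * c + 1 - b) * (2 * c + 3 - b) +
      4 * a * b * (2 * c - a) * (2 * c + 2 - a) * (2 * c - b) * (2 * c + 2 - b)) :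
    ∃ p1 p2 : ℂ, ∀ n : ℂ, a + b + 3 + 2 * n ≠ 0 → 2 * c + 4 + n ≠ 0 → n + 1 ≠ 0 →
    (c + 1) * den * (2 * a * b * (2 * c + 1 + n) * (2 * c + 2 + n) * (2 * c + 3 + n) /
        ((a + b + 3 + 2 * n) * (4 * (2 * c + 1) * (c + 1) * (2 * c + 3)) * (n + 1))) +
      2 * q * (2 * c + 1 - a) * (2 * c + 1 - b) * (2 * c + 3 - b) *
        (2 * b * (a + 1 + n) * (a + 2 + n) * (c + 1 + n) * (c + 2 + n) /
          ((a + b + 3 + 2 * n) * (2 * c + 4 + n) * (n + 1))) +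
      4 * a * b * (2 * c - a) * (2 * c + 2 - a) * (2 * c - b) * (2 * c + 2 - b) *
        (2 * (a + 1 + n) * (b + 1 + n) * (c + 1 + n) * (c + 2 + n) /
          ((a + b + 3 + 2 * n) * (2 * c + 4 + n) * (n + 1))) =
      ((c + 1) * p0 + p1 * (n + 1) + p2 * (n + 1) ^ 2) *
        (2 * (a + 1 + n) * (b + 1 + n) * (c + 1 + n) /
          ((a + b + 3 + 2 * n) * (2 * c + 4 + n) * (n + 1))) -
      ((c + 1) * p0 + p1 * n + p2 * n ^ 2) := by
  -- The certificate is a quadratic in `n` whose constant term `(c + 1) p0` is forced by the zeroth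
  -- summands. These polynomials are its other two coefficients.
  obtain ⟨p1, h_p1⟩ : ∃ p1, p1 = b*(((12 + 32*c - 32*c^2 - 128*c^3 - 64*c^4) +
      (-12 + 16*c + 160*c^2 + 192*c^3 + 64*c^4)*b + (-12 - 80*c - 144*c^2 - 64*c^3)*b^2 +
      (12 + 32*c + 16*c^2)*b^3) + ((-5 + 34*c + 32*c^2 - 96*c^3 - 64*c^4) +
      (5 + 48*c^2 + 32*c^3)*b + (5 + 14*c)*b^2 + (-5)*b^3)*a + ((-19 - 16*c + 48*c^2 + 32*c^3) +
      (-8 - 28*c)*b + (5)*b^2 + (-2)*b^3)*a^2 + ((5 - 10*c - 16*c^2) + (-7 - 8*c)*b + (4)*b^2)*a^3 +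
      ((7 + 8*c) + (-2)*b)*a^4) := ⟨_, rfl⟩
  obtain ⟨p2, h_p2⟩ : ∃ p2, p2 = b*(((4 + 8*c - 16*c^2 - 32*c^3) + (-4 + 8*c + 48*c^2 + 32*c^3)*b +
      (-4 - 24*c - 32*c^2)*b^2 + (4 + 8*c)*b^3) + ((-3 + 10*c - 32*c^3) + (3 + 16*c^2)*b +
      (3 + 6*c)*b^2 + (-3)*b^3)*a + ((-5 + 16*c^2) + (-6 - 12*c)*b + (3)*b^2)*a^2 +
      ((3 - 2*c) + (-1)*b)*a^3 + a^4) := ⟨_, rfl⟩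
  refine ⟨p1, p2, fun n hD hE hn => ?_⟩
  -- Cancels `2c + 1`, `2c + 3` and `c + 1` between `den` and the first quotient. Then `e1` clears
  -- the common denominator `D E N`, leaving a polynomial identity.
  have e : ∀ c1 c3 C X Y D N : ℂ, c1 ≠ 0 → c3 ≠ 0 → C ≠ 0 → D ≠ 0 → N ≠ 0 →
      C * (2 * c3 * c1 * X) * (2 * Y / (D * (4 * c1 * C * c3) * N)) = X * Y / (D * N) := by
    intro c1 c3 C X Y D N _ _ _ _ _
    field_simp
    ring
  have e1 : ∀ K1 u K2 v K3 P' S P D E N : ℂ, D ≠ 0 → E ≠ 0 → N ≠ 0 →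
      K1 * E + u * K2 + v * K3 = P' * S - P * (D * E * N) →
      K1 / (D * N) + u * (K2 / (D * E * N)) + v * (K3 / (D * E * N)) =
        P' * (S / (D * E * N)) - P := by
    intro K1 u K2 v K3 P' S P D E N hD hE hN h
    have : K1 / (D * N) = K1 * E / (D * E * N) := by field_simp
    rw [this, ← mul_div_assoc, ← mul_div_assoc, ← mul_div_assoc, ← add_div, ← add_div, h, sub_div,
      mul_div_assoc P, div_self (mul_ne_zero (mul_ne_zero hD hE) hN), mul_one]
  have e2 := e (2 * c + 1) (2 * c + 3) (c + 1)
    ((2 * c - 1 - a - b) * (2 * c + 1 - a - b) * (b - a - 1) * (b - a + 1))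
    (a * b * (2 * c + 1 + n) * (2 * c + 2 + n) * (2 * c + 3 + n)) (a + b + 3 + 2 * n) (n + 1)
    h1 h3 h2 hD hn
  have e3 : (c + 1) * den * (2 * a * b * (2 * c + 1 + n) * (2 * c + 2 + n) * (2 * c + 3 + n) /
        ((a + b + 3 + 2 * n) * (4 * (2 * c + 1) * (c + 1) * (2 * c + 3)) * (n + 1))) = _ :=
    Eq.trans (by rw [hden]; ring) e2
  rw [e3]
  refine e1 _ _ _ _ _ _ _ _ _ _ _ hD hE hn ?_
  rw [h_p0, h_p1, h_p2, hden, hq]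
  ring


/-- Both sides are `(z)ₙ₊₄`. With `z = 2c` this compares the bottom parameters `2c` and `2c + 4`. -/
theorem poch_succ_mul_prod_three (z : ℂ) (n : ℕ) :
    poch z (n + 1) * ((z + 1 + n) * (z + 2 + n) * (z + 3 + n)) =
      z * (z + 1) * (z + 2) * (z + 3) * poch (z + 4) n := by
  have e := poch_succ_left z (n + 1 + 1 + 1)
  rw [poch_succ_left (z + 1), poch_succ_left (z + 1 + 1), poch_succ_left (z + 1 + 1 + 1),
    poch_succ z (n + 1 + 1 + 1), poch_succ z (n + 1 + 1), poch_succ z (n + 1),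
    show z + 1 + 1 + 1 + 1 = z + 4 by ring] at e
  push_cast at e
  linear_combination e

/-- A contiguous relation expressing `W₂,₀` through Watson's series. -/
theorem watsonTwo_contiguous {a b c : ℂ} (hd : ¬ IsNonposInt ((a + b + 3) / 2))
    (hc : ¬ IsNonposInt (2 * c)) (hs : 0 < (c + 3 / 2 - a / 2 - b / 2).re) :
    2 * (2 * c + 3) * (2 * c + 1) * (2 * c - 1 - a - b) * (2 * c + 1 - a - b) *
        (b - a - 1) * (b - a + 1) * (HypParams.mk a b c ((a + b + 3) / 2) (2 * c)).sum +
      2 * (a ^ 2 - 2 * c * a - 2 * c * b - 1 + 2 * c + b ^ 2) * (a + 1) * (2 * c + 1 - a) *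
        (2 * c + 1 - b) * (2 * c + 3 - b) * watsonSum (a + 2) b (c + 2) +
      4 * a * b * (2 * c - a) * (2 * c + 2 - a) * (2 * c - b) * (2 * c + 2 - b) *
        watsonSum (a + 1) (b + 1) (c + 2) = 0 := by
  have hc4 : ¬ IsNonposInt (2 * c + 4) := by simpa using not_isNonposInt_add_natCast hc 4
  have h0 := HypParams.hasSum ⟨a, b, c, (a + b + 3) / 2, 2 * c⟩ hd hc (by
    convert hs using 2; simp only [HypParams.excess]; ring)
  have h1 := HypParams.hasSum ⟨a + 2, b, c + 2, (a + b + 3) / 2, 2 * c + 4⟩ hd hc4 (by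
    convert hs using 2; simp only [HypParams.excess]; ring)
  have h2 := HypParams.hasSum ⟨a + 1, b + 1, c + 2, (a + b + 3) / 2, 2 * c + 4⟩ hd hc4 (by
    convert hs using 2; simp only [HypParams.excess]; ring)
  rw [watsonSum, watsonSum, show (a + 2 + b + 1) / 2 = (a + b + 3) / 2 by ring,
    show (a + 1 + (b + 1) + 1) / 2 = (a + b + 3) / 2 by ring, show 2 * (c + 2) = 2 * c + 4 by ring]
  obtain ⟨q, hq⟩ : ∃ q, q = a ^ 2 - 2 * c * a - 2 * c * b - 1 + 2 * c + b ^ 2 := ⟨_, rfl⟩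
  obtain ⟨den, hden⟩ : ∃ den, den = 2 * (2 * c + 3) * (2 * c + 1) * (2 * c - 1 - a - b) *
    (2 * c + 1 - a - b) * (b - a - 1) * (b - a + 1) := ⟨_, rfl⟩
  obtain ⟨p0, h_p0⟩ : ∃ p0, p0 = den + 2 * q * (a + 1) * (2 * c + 1 - a) * (2 * c + 1 - b) *
    (2 * c + 3 - b) + 4 * a * b * (2 * c - a) * (2 * c + 2 - a) * (2 * c - b) *
    (2 * c + 2 - b) := ⟨_, rfl⟩
  rw [← hq, ← hden]
  have c1 : 2 * c + 1 ≠ 0 := by simpa using add_natCast_ne_zero hc 1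
  have c2 : c + 1 ≠ 0 := fun h => add_natCast_ne_zero hc 2 (by push_cast; linear_combination 2 * h)
  have c3 : 2 * c + 3 ≠ 0 := by simpa using add_natCast_ne_zero hc 3
  have c0 : c ≠ 0 := fun h => ne_zero_of_not_isNonposInt hc (by rw [h, mul_zero])
  obtain ⟨p1, p2, key⟩ := exists_watsonTwo_telescoping c1 c2 c3 hq hden h_p0
  -- The factor `a + 1` is left out of `A`; it is absorbed by the term identity `t1`, where `(a +
  -- 1)(a + 2)ₙ₊₁` appears.
  obtain ⟨A, hA⟩ : ∃ A, A = 2 * q * (2 * c + 1 - a) * (2 * c + 1 - b) * (2 * c + 3 - b) := ⟨_, rfl⟩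
  obtain ⟨B, hB⟩ : ∃ B, B = 4 * a * b * (2 * c - a) * (2 * c + 2 - a) * (2 * c - b) *
    (2 * c + 2 - b) := ⟨_, rfl⟩
  have hA' : 2 * q * (a + 1) * (2 * c + 1 - a) * (2 * c + 1 - b) * (2 * c + 3 - b) =
    (a + 1) * A := by rw [hA]; ring
  rw [← hA, ← hB] at key
  rw [hA', ← hB] at h_p0 ⊢
  clear hden hq hA hB hA'
  have ex : (HypParams.mk (a + 1) (b + 1) (c + 1) ((a + b + 3) / 2) (2 * c + 4)).excess =
    c + 3 / 2 - a / 2 - b / 2 + 1 := by simp only [HypParams.excess]; ring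
  -- The auxiliary series has excess one more than the common excess of the three sums, which pays
  -- for the quadratic certificate.
  have hG := HypParams.tendsto_quadratic_mul_term
    ⟨a + 1, b + 1, c + 1, (a + b + 3) / 2, 2 * c + 4⟩ hd hc4
    (by rw [ex, add_re, one_re]; linarith) ((c + 1) * p0) p1 p2
  have h := ((h0.mul_left ((c + 1) * den)).add (h1.mul_left ((c + 1) * (a + 1) * A))).add
    (h2.mul_left ((c + 1) * B))
  -- The telescoping identity is for `c + 1` times the claim, since `(c + 2)ₙ₊₁` is compared with
  -- `(c + 1)ₙ` through that factor.
  refine (mul_eq_zero.1 ((?_ : (c + 1) * _ = (0 : ℂ)))).resolve_left c2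
  refine Eq.trans ?_ (h.eq_of_partial_sums ?_ ?_ hG)
  · ring
  · simp [h_p0]; ring
  · intro n
    set Q : HypParams := ⟨a + 1, b + 1, c + 1, (a + b + 3) / 2, 2 * c + 4⟩ with hQ
    have n1 : (n : ℂ) + 1 ≠ 0 := by exact_mod_cast n.succ_ne_zero
    have nf : (n.factorial : ℂ) ≠ 0 := by exact_mod_cast n.factorial_ne_zero
    have dn : a + b + 3 + 2 * n ≠ 0 := fun h0 =>
      add_natCast_ne_zero hd n (by linear_combination h0 / 2)
    have dp := poch_ne_zero hd n
    have ep := poch_ne_zero hc4 n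
    have ep' := poch_ne_zero hc (n + 1)
    have en := add_natCast_ne_zero hc4 n
    have e1 : 2 * c + 1 + n ≠ 0 := fun h0 =>
      add_natCast_ne_zero hc (n + 1) (by push_cast; linear_combination h0)
    have e2 : 2 * c + 2 + n ≠ 0 := fun h0 =>
      add_natCast_ne_zero hc (n + 2) (by push_cast; linear_combination h0)
    have e3 : 2 * c + 3 + n ≠ 0 := fun h0 =>
      add_natCast_ne_zero hc (n + 3) (by push_cast; linear_combination h0)
    have hdn : (a + b + 3) / 2 + (n : ℂ) = (a + b + 3 + 2 * n) / 2 := by ring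
    have t0 : (HypParams.mk a b c ((a + b + 3) / 2) (2 * c)).term (n + 1) = Q.term n *
        (2 * a * b * (2 * c + 1 + n) * (2 * c + 2 + n) * (2 * c + 3 + n) /
        ((a + b + 3 + 2 * n) * (4 * (2 * c + 1) * (c + 1) * (2 * c + 3)) * (n + 1))) := by
      have hX : poch (2 * c) (n + 1) = 4 * c * (2 * c + 1) * (c + 1) * (2 * c + 3) *
          poch (2 * c + 4) n / ((2 * c + 1 + n) * (2 * c + 2 + n) * (2 * c + 3 + n)) := by
        rw [eq_div_iff (mul_ne_zero (mul_ne_zero e1 e2) e3), poch_succ_mul_prod_three]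
        ring
      simp only [HypParams.term_eq, hQ, hX, poch_succ_left a, poch_succ_left b, poch_succ_left c,
        poch_succ ((a + b + 3) / 2), hdn, Nat.factorial_succ]
      push_cast
      clear hX
      generalize poch (2 * c + 4) n = X at *
      generalize poch ((a + b + 3) / 2) n = Z at *
      generalize a + b + 3 + 2 * (n : ℂ) = D at *
      generalize 2 * c + 1 + (n : ℂ) = F1 at *
      generalize 2 * c + 2 + (n : ℂ) = F2 at *
      generalize 2 * c + 3 + (n : ℂ) = F3 at *
      generalize poch (c + 1) n = C' at *
      generalize 2 * c + 1 = E1 at *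
      generalize 2 * c + 3 = E3 at *
      field_simp
    have t1 : (c + 1) * ((a + 1) * (HypParams.mk (a + 2) b (c + 2) ((a + b + 3) / 2)
        (2 * c + 4)).term (n + 1)) = Q.term n *
        (2 * b * (a + 1 + n) * (a + 2 + n) * (c + 1 + n) * (c + 2 + n) /
          ((a + b + 3 + 2 * n) * (2 * c + 4 + n) * (n + 1))) := by
      have h5 := poch_add_two_mul a n
      have h6 := poch_add_two_mul c n
      simp only [HypParams.term_eq, hQ, poch_succ_left b, poch_succ ((a + b + 3) / 2), hdn,
        poch_succ (2 * c + 4), Nat.factorial_succ]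
      push_cast
      generalize poch (2 * c + 4) n = X at *
      generalize poch ((a + b + 3) / 2) n = Z at *
      generalize a + b + 3 + 2 * (n : ℂ) = D at *
      generalize 2 * c + 4 + (n : ℂ) = F at *
      generalize poch (c + 2) (n + 1) = U at *
      generalize poch (a + 2) (n + 1) = V at *
      field_simp
      linear_combination (poch (b + 1) n * b) * ((c + 1) * U * h5 +
        poch (a + 1) n * (a + 1 + n) * (a + 2 + n) * h6)
    have t2 : (c + 1) * (HypParams.mk (a + 1) (b + 1) (c + 2) ((a + b + 3) / 2)
        (2 * c + 4)).term (n + 1) = Q.term n *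
        (2 * (a + 1 + n) * (b + 1 + n) * (c + 1 + n) * (c + 2 + n) /
          ((a + b + 3 + 2 * n) * (2 * c + 4 + n) * (n + 1))) := by
      have h6 := poch_add_two_mul c n
      simp only [HypParams.term_eq, hQ, poch_succ (a + 1), poch_succ (b + 1),
        poch_succ ((a + b + 3) / 2), hdn, poch_succ (2 * c + 4), Nat.factorial_succ]
      push_cast
      generalize poch (2 * c + 4) n = X at *
      generalize poch ((a + b + 3) / 2) n = Z at *
      generalize a + b + 3 + 2 * (n : ℂ) = D at *
      generalize 2 * c + 4 + (n : ℂ) = F at *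
      generalize poch (c + 2) (n + 1) = U at *
      field_simp
      linear_combination (poch (a + 1) n * (a + 1 + n) * poch (b + 1) n * (b + 1 + n)) * h6
    have hr : Q.ratio n = 2 * (a + 1 + n) * (b + 1 + n) * (c + 1 + n) /
          ((a + b + 3 + 2 * n) * (2 * c + 4 + n) * (n + 1)) := by
      simp only [HypParams.ratio, hQ, hdn]
      field_simp
    have hk := key n dn en n1
    rw [← hr] at hk
    rw [t0, Q.term_succ n]
    push_cast
    linear_combination A * t1 + B * t2 + Q.term n * hk

theorem hasSum_watsonClosedTwo {p : ℂ × ℂ × ℂ} (hp : p ∈ watsonDomainTwo)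
    (hs : 0 < (watsonParams 2 0 p).excess.re) :
    HasSum (watsonParams 2 0 p).term (watsonClosedTwo p) := by
  obtain ⟨a, b, c⟩ := p
  obtain ⟨⟨hd, hc, -⟩, hs1, hs2, ab1, ab2⟩ := hp
  have key := HypParams.hasSum _ hd hc hs
  convert key using 1
  have hP : watsonParams 2 0 (a, b, c) = ⟨a, b, c, (a + b + 3) / 2, 2 * c⟩ := by
    simp only [watsonParams]
    push_cast
    congr 1 <;> ring
  rw [hP] at hd hc hs hs1 hs2 ⊢
  have hex : (HypParams.mk a b c ((a + b + 3) / 2) (2 * c)).excess =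
      c + 3 / 2 - a / 2 - b / 2 := by simp only [HypParams.excess]; ring
  rw [hex] at hs hs1 hs2
  simp only at hd hc ab1 ab2
  have h := watsonTwo_contiguous hd hc hs
  have hc2 : ¬ IsNonposInt (2 * (c + 2)) := by
    convert not_isNonposInt_add_natCast hc 4 using 2; push_cast; ring
  rw [watsonSum_eq (a := a + 2) (b := b) (c := c + 2) (by convert hd using 2; ring) hc2 (by
      convert hs using 2; ring),
    watsonSum_eq (a := a + 1) (b := b + 1) (c := c + 2) (by convert hd using 2; ring) hc2 (by
      convert hs using 2; ring)] at h
  have n1 : 2 * c - 1 - a - b ≠ 0 := fun h0 => hs2 (by linear_combination h0 / 2)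
  have n2 : 2 * c + 1 - a - b ≠ 0 := fun h0 => hs1 (by linear_combination h0 / 2)
  have n3 : b - a - 1 ≠ 0 := fun h0 => ab2 (by linear_combination -h0)
  have n4 : b - a + 1 ≠ 0 := fun h0 => ab1 (by linear_combination -h0)
  have n5 : 2 * c + 1 ≠ 0 := by simpa using add_natCast_ne_zero hc 1
  have n6 : 2 * c + 3 ≠ 0 := by simpa using add_natCast_ne_zero hc 3
  have m1 : -1 / 2 - a / 2 - b / 2 + c ≠ 0 := fun h0 => n1 (by linear_combination 2 * h0)
  have m2 : -1 / 2 - a / 2 - b / 2 + c + 1 ≠ 0 := fun h0 => n2 (by linear_combination 2 * h0)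
  have m3 : c + 1 / 2 ≠ 0 := fun h0 => n5 (by linear_combination 2 * h0)
  have m4 : c + 1 / 2 + 1 ≠ 0 := fun h0 => n6 (by linear_combination 2 * h0)
  -- The factors `2c - 1 - a - b` and `2c + 1 - a - b` vanish at excess `2` and `1`, the last two at
  -- `a - b = -1` and `a - b = 1`; `2c + 1` and `2c + 3` are nonzero because `2c` is admissible.
  have hden : 2 * (2 * c + 3) * (2 * c + 1) * (2 * c - 1 - a - b) * (2 * c + 1 - a - b) *
        (b - a - 1) * (b - a + 1) ≠ 0 := by
    simp only [ne_eq, mul_eq_zero, not_or]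
    exact ⟨⟨⟨⟨⟨⟨two_ne_zero, n6⟩, n5⟩, n1⟩, n2⟩, n3⟩, n4⟩
  refine mul_left_cancel₀ hden ?_
  rw [add_assoc, add_eq_zero_iff_eq_neg] at h
  rw [h, show (a + 2 + b + 1) / 2 = a / 2 + b / 2 + 3 / 2 by ring,
    show (a + 1 + (b + 1) + 1) / 2 = a / 2 + b / 2 + 3 / 2 by ring,
    show c + 2 + 1 / 2 - (a + 2) / 2 - b / 2 = -1 / 2 - a / 2 - b / 2 + c + 1 + 1 by ring,
    show c + 2 + 1 / 2 - (a + 1) / 2 - (b + 1) / 2 = -1 / 2 - a / 2 - b / 2 + c + 1 + 1 by ring,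
    show c + 2 + 1 / 2 - (a + 2) / 2 = 1 / 2 - a / 2 + c + 1 by ring,
    show c + 2 + 1 / 2 - b / 2 = 1 / 2 - b / 2 + c + 1 + 1 by ring,
    show c + 2 + 1 / 2 - (a + 1) / 2 = c - a / 2 + 1 + 1 by ring,
    show c + 2 + 1 / 2 - (b + 1) / 2 = c - b / 2 + 1 + 1 by ring,
    show c + 2 + 1 / 2 = c + 1 / 2 + 1 + 1 by ring,
    show (a + 2 + 1) / 2 = a / 2 + 1 / 2 + 1 by ring,
    show (a + 1 + 1) / 2 = a / 2 + 1 by ring, show (b + 1 + 1) / 2 = b / 2 + 1 by ring,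
    show (b + 1) / 2 = b / 2 + 1 / 2 by ring,
    Gamma_add_one _ m2, Gamma_add_one _ m1, Gamma_add_one _ m4, Gamma_add_one _ m3]
  simp only [watsonClosedTwo, div_eq_mul_inv _ (_ * _ : ℂ), mul_inv]
  rw [inv_gamma_eq (a / 2 + 1 / 2), inv_gamma_eq (1 / 2 - a / 2 + c),
    inv_gamma_eq (1 / 2 - b / 2 + c), inv_gamma_eq (1 / 2 - b / 2 + c + 1),
    inv_gamma_eq (a / 2), inv_gamma_eq (b / 2), inv_gamma_eq (c - a / 2),
    inv_gamma_eq (c - a / 2 + 1), inv_gamma_eq (c - b / 2), inv_gamma_eq (c - b / 2 + 1)]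
  generalize (Gamma (a / 2 + 1 / 2 + 1))⁻¹ = y1
  generalize (Gamma (1 / 2 - a / 2 + c + 1))⁻¹ = y2
  generalize (Gamma (1 / 2 - b / 2 + c + 1 + 1))⁻¹ = y3
  generalize (Gamma (a / 2 + 1))⁻¹ = y4
  generalize (Gamma (b / 2 + 1))⁻¹ = y5
  generalize (Gamma (c - a / 2 + 1 + 1))⁻¹ = y6
  generalize (Gamma (c - b / 2 + 1 + 1))⁻¹ = y7
  generalize (Gamma (b / 2 + 1 / 2))⁻¹ = y8
  generalize Gamma (-1 / 2 - a / 2 - b / 2 + c) = z1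
  generalize Gamma (a / 2 + b / 2 + 3 / 2) = z2
  generalize Gamma (c + 1 / 2) = z3
  generalize (Real.sqrt Real.pi : ℂ) = z4
  have r1 : (b - a - 1) * (-1 - a + b)⁻¹ = 1 := by
    rw [show -1 - a + b = b - a - 1 by ring, mul_inv_cancel₀ n3]
  have r2 : (b - a + 1) * (-a + b + 1)⁻¹ = 1 := by
    rw [show -a + b + 1 = b - a + 1 by ring, mul_inv_cancel₀ n4]
  generalize (-1 - a + b)⁻¹ = i1 at *
  generalize (-a + b + 1)⁻¹ = i2 at *
  have r3 : ∀ x y u v w : ℂ, u * (b - a - 1) * (b - a + 1) * (x * y * v * w * (i1 * i2)) =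
      u * (x * y * v * w) := by
    intro x y u v w
    linear_combination u * x * y * v * w * ((b - a + 1) * i2) * r1 + u * x * y * v * w * r2
  rw [r3]
  ring


/-! ### Analytic continuation along complex lines. -/

theorem countable_setOf_line_mem {S : Set ℂ} (hS : S.Countable) {α β : ℂ} (h : α ∉ S) :
    {t : ℂ | α + t * β ∈ S}.Countable := by
  by_cases hβ : β = 0
  · simp [hβ, h]
  · refine hS.preimage_of_injOn (f := fun t : ℂ => α + t * β) fun x _ y _ hxy => ?_
    exact mul_right_cancel₀ hβ (add_left_cancel hxy)

theorem countable_setOf_isNonposInt : {z : ℂ | IsNonposInt z}.Countable := by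
  refine (Set.countable_range fun k : ℕ => -(k : ℂ)).mono ?_
  rintro _ ⟨k, rfl⟩
  exact ⟨k, rfl⟩

theorem countable_setOf_line_isNonposInt {α : ℂ} (β : ℂ) (h : ¬ IsNonposInt α) :
    {t : ℂ | IsNonposInt (α + t * β)}.Countable :=
  countable_setOf_line_mem countable_setOf_isNonposInt h

theorem countable_setOf_line_eq {α γ : ℂ} (β : ℂ) (h : α ≠ γ) :
    {t : ℂ | α + t * β = γ}.Countable :=
  countable_setOf_line_mem (Set.countable_singleton γ) h

/-- Two functions that are analytic off a countable set of the plane and agree on a half plane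
`0 < Re (σ + r t)`, where `0 < r`, agree at the origin. -/
theorem eq_zero_of_eq_on_halfPlane {C : Set ℂ} (hC : Cᶜ.Countable) (h0 : (0 : ℂ) ∈ C)
    {g₁ g₂ : ℂ → ℂ} (h₁ : AnalyticOnNhd ℂ g₁ C) (h₂ : AnalyticOnNhd ℂ g₂ C) {σ : ℂ} {r : ℝ}
    (hr : 0 < r) (h : ∀ t ∈ C, 0 < (σ + t * r).re → g₁ t = g₂ t) : g₁ 0 = g₂ 0 := by
  -- The plane has real dimension two, so removing a countable set leaves it connected.
  have hconn : IsPreconnected C := by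
    have := (hC.isConnected_compl_of_one_lt_rank (by simp)).isPreconnected
    rwa [compl_compl] at this
  have hopen : IsOpen {t : ℂ | 0 < (σ + t * r).re} :=
    isOpen_lt continuous_const (by fun_prop)
  have hne : (((1 - σ.re) / r : ℝ) : ℂ) ∈ {t : ℂ | 0 < (σ + t * r).re} := by
    rw [Set.mem_ofPred_eq, add_re, ← ofReal_mul, ofReal_re, div_mul_cancel₀ _ hr.ne']
    linarith
  have hdense : Dense C := by
    have := hC.dense_compl ℂ
    rwa [compl_compl] at this
  obtain ⟨t₀, ht₀, ht₀C⟩ := hdense.inter_open_nonempty _ hopen ⟨_, hne⟩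
  refine h₁.eqOn_of_preconnected_of_frequently_eq h₂ hconn ht₀C ?_ h0
  rw [frequently_iff]
  intro V hV
  obtain ⟨W, hWo, htW, hWV⟩ := mem_nhdsWithin.1 hV
  -- Removing `t₀` as well still leaves a dense set, so every neighbourhood of `t₀` has a point
  -- other than `t₀` at which the functions agree, as the identity theorem requires.
  have hC' : (Cᶜ ∪ {t₀}).Countable := hC.union (Set.countable_singleton t₀)
  obtain ⟨x, ⟨hxW, hxH⟩, hx⟩ := (hC'.dense_compl ℂ).inter_open_nonempty _ (hWo.inter hopen)
    ⟨t₀, htW, ht₀⟩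
  simp only [Set.compl_union, compl_compl, Set.mem_inter_iff, Set.mem_compl_iff,
    Set.mem_singleton_iff] at hx
  exact ⟨x, hWV ⟨hxW, hx.2⟩, h x hx.1 hxH⟩

/-- The line through `p` in direction `v` leaves `U` at countably many parameters only, and the
excess grows along it. -/
def IsAscendingLine (P : ℂ × ℂ × ℂ → HypParams) (U : Set (ℂ × ℂ × ℂ)) (p v : ℂ × ℂ × ℂ) : Prop :=
  {t : ℂ | p + t • v ∉ U}.Countable ∧
    ∃ r : ℝ, 0 < r ∧ ∀ t : ℂ, (P (p + t • v)).excess = (P p).excess + t * r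

theorem analyticAt_line (p v : ℂ × ℂ × ℂ) (t : ℂ) :
    AnalyticAt ℂ (fun t : ℂ => p + t • v) t := by fun_prop

/-- Restriction to a line replaces continuation in three variables by the one-variable identity
theorem, so connectedness of `U` is never needed. -/
theorem IsAscendingLine.eq {P : ℂ × ℂ × ℂ → HypParams} {U : Set (ℂ × ℂ × ℂ)} {p v : ℂ × ℂ × ℂ}
    (hv : IsAscendingLine P U p v) (hp : p ∈ U) {f g : ℂ × ℂ × ℂ → ℂ}
    (hf : AnalyticOnNhd ℂ f U) (hg : AnalyticOnNhd ℂ g U)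
    (h : ∀ t : ℂ, p + t • v ∈ U → 0 < (P (p + t • v)).excess.re →
      f (p + t • v) = g (p + t • v)) : f p = g p := by
  obtain ⟨hC, r, hr, hex⟩ := hv
  have h0 : p + (0 : ℂ) • v = p := by simp
  have := eq_zero_of_eq_on_halfPlane (C := {t | p + t • v ∈ U})
    (g₁ := fun t => f (p + t • v)) (g₂ := fun t => g (p + t • v)) hC (by simpa using hp)
    (fun t ht => AnalyticAt.fun_comp (f := fun t : ℂ => p + t • v) (hf _ ht) (analyticAt_line p v t))
    (fun t ht => AnalyticAt.fun_comp (f := fun t : ℂ => p + t • v) (hg _ ht) (analyticAt_line p v t)) hr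
    (σ := (P p).excess) (fun t ht hs => h t ht (by rwa [hex]))
  simpa only [h0] using this

theorem HypParams.term_eq_zero {P : HypParams} {n k : ℕ} (hk : n < k)
    (h : P.a = -(n : ℂ) ∨ P.b = -(n : ℂ) ∨ P.c = -(n : ℂ)) : P.term k = 0 := by
  rw [HypParams.term_eq]
  rcases h with h | h | h <;> simp [h, poch_neg_natCast_eq_zero hk]

theorem analyticAt_poch (n : ℕ) {g : ℂ × ℂ × ℂ → ℂ} {p : ℂ × ℂ × ℂ} (hg : AnalyticAt ℂ g p) :
    AnalyticAt ℂ (fun p => poch (g p) n) p := by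
  induction n with
  | zero => simpa using analyticAt_const
  | succ n ih =>
    simp only [poch_succ]
    exact ih.mul (hg.add analyticAt_const)

/-- A function represents a family of sums if it is analytic and equals the sum where the excess
has positive real part, provided that each point lies on suitable lines. -/
theorem representsThreeFTwo_of_lines {P : ℂ × ℂ × ℂ → HypParams} {U : Set (ℂ × ℂ × ℂ)}
    {f : ℂ × ℂ × ℂ → ℂ}
    (ha : ∀ p, AnalyticAt ℂ (fun p => (P p).a) p) (hb : ∀ p, AnalyticAt ℂ (fun p => (P p).b) p)
    (hc : ∀ p, AnalyticAt ℂ (fun p => (P p).c) p) (hd : ∀ p, AnalyticAt ℂ (fun p => (P p).d) p)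
    (he : ∀ p, AnalyticAt ℂ (fun p => (P p).e) p)
    (hU : ∀ p ∈ U, ¬ IsNonposInt (P p).d ∧ ¬ IsNonposInt (P p).e)
    (hf : AnalyticOnNhd ℂ f U)
    (hsum : ∀ p ∈ U, 0 < (P p).excess.re → HasSum (P p).term (f p))
    (hline : ∀ p ∈ U, ∃ v, IsAscendingLine P U p v)
    (hterm : ∀ p ∈ U, (P p).Terminates → ∃ v, IsAscendingLine P U p v ∧
      ((IsNonposInt (P p).a ∧ ∀ t : ℂ, (P (p + t • v)).a = (P p).a) ∨
       (IsNonposInt (P p).b ∧ ∀ t : ℂ, (P (p + t • v)).b = (P p).b) ∨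
       (IsNonposInt (P p).c ∧ ∀ t : ℂ, (P (p + t • v)).c = (P p).c))) :
    RepresentsThreeFTwo P U f := by
  refine ⟨hf, ?_, ?_⟩
  · rintro p hp (hs | ht)
    · exact hsum p hp hs
    -- On a line that fixes the terminating parameter, the series stops at the same index `n`
    -- everywhere. Its finite sum is analytic on `U` and equals `f` where the excess has positive
    -- real part, hence also at `p`.
    obtain ⟨v, hv, hconst⟩ := hterm p hp ht
    obtain ⟨n, hn⟩ : ∃ n : ℕ, ∀ t : ℂ, (P (p + t • v)).a = -(n : ℂ) ∨
        (P (p + t • v)).b = -(n : ℂ) ∨ (P (p + t • v)).c = -(n : ℂ) := by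
      rcases hconst with ⟨⟨n, h0⟩, h⟩ | ⟨⟨n, h0⟩, h⟩ | ⟨⟨n, h0⟩, h⟩
      · exact ⟨n, fun t => .inl ((h t).trans h0)⟩
      · exact ⟨n, fun t => .inr (.inl ((h t).trans h0))⟩
      · exact ⟨n, fun t => .inr (.inr ((h t).trans h0))⟩
    have hfin : ∀ t : ℂ, HasSum (P (p + t • v)).term
        (∑ k ∈ Finset.range (n + 1), (P (p + t • v)).term k) := fun t =>
      hasSum_sum_of_ne_finset_zero fun k hk =>
        HypParams.term_eq_zero (by simpa [Nat.lt_succ_iff] using hk) (hn t)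
    have key := hv.eq hp hf (g := fun q => ∑ k ∈ Finset.range (n + 1), (P q).term k) ?_
      fun t htU hs => (hsum _ htU hs).unique (hfin t)
    · rw [key]
      simpa using hfin 0
    · intro q hq
      refine Finset.analyticAt_fun_sum _ fun k _ => ?_
      simp only [HypParams.term_eq]
      refine AnalyticAt.div (((analyticAt_poch k (ha q)).mul (analyticAt_poch k (hb q))).mul
        (analyticAt_poch k (hc q))) (((analyticAt_poch k (hd q)).mul
        (analyticAt_poch k (he q))).mul analyticAt_const) ?_
      exact mul_ne_zero (mul_ne_zero (poch_ne_zero (hU q hq).1 k) (poch_ne_zero (hU q hq).2 k))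
        (by exact_mod_cast k.factorial_ne_zero)
  · intro F hF hFs p hp
    obtain ⟨v, hv⟩ := hline p hp
    exact hv.eq hp hF hf fun t htU hs => (hFs _ htU hs).unique (hsum _ htU hs)

/-! ### Analyticity of the closed forms. -/

theorem analyticAt_inv_gamma {g : ℂ × ℂ × ℂ → ℂ} {p : ℂ × ℂ × ℂ} (hg : AnalyticAt ℂ g p) :
    AnalyticAt ℂ (fun p => (Gamma (g p))⁻¹) p :=
  AnalyticAt.fun_comp (g := fun s : ℂ => (Gamma s)⁻¹) (differentiable_one_div_Gamma.analyticAt (g p)) hg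

theorem analyticAt_gamma {g : ℂ × ℂ × ℂ → ℂ} {p : ℂ × ℂ × ℂ} (hg : AnalyticAt ℂ g p)
    (h : ¬ IsNonposInt (g p)) : AnalyticAt ℂ (fun p => Gamma (g p)) p := by
  simpa using (analyticAt_inv_gamma hg).fun_inv (inv_ne_zero (gamma_ne_zero h))

theorem analyticAt_two_cpow {g : ℂ × ℂ × ℂ → ℂ} {p : ℂ × ℂ × ℂ} (hg : AnalyticAt ℂ g p) :
    AnalyticAt ℂ (fun p => (2 : ℂ) ^ (g p)) p := by
  simp only [cpow_def_of_ne_zero (two_ne_zero (α := ℂ))]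
  exact (analyticAt_const.mul hg).cexp


theorem not_isNonposInt_div_two {z w : ℂ} (hz : ¬ IsNonposInt z) (h : 2 * w = z) :
    ¬ IsNonposInt w := by
  rintro ⟨k, rfl⟩
  exact hz ⟨2 * k, by rw [← h]; push_cast; ring⟩

/-- Shifting down by one creates a single new pole, at `z = 1`. This is where the excluded values of
the excess enter. -/
theorem not_isNonposInt_of_eq_sub_one {z w : ℂ} (hz : ¬ IsNonposInt z) (h1 : z ≠ 1)
    (h : w = z - 1) : ¬ IsNonposInt w := by
  rintro ⟨k, hk⟩
  rcases k with _ | k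
  · exact h1 (by rw [hk] at h; push_cast at h; linear_combination -h)
  · refine hz ⟨k, ?_⟩
    rw [hk] at h; push_cast at h; linear_combination -h

theorem analyticAt_of_contDiff {g : ℂ × ℂ × ℂ → ℂ} (hg : ContDiff ℂ ⊤ g) {p : ℂ × ℂ × ℂ} :
    AnalyticAt ℂ g p :=
  hg.contDiffAt.analyticAt

theorem analyticOnNhd_dixonClosedNegOne : AnalyticOnNhd ℂ dixonClosedNegOne dixonDomainNegOne := by
  intro p hp
  obtain ⟨hd, he, hs⟩ := hp
  simp only [dixonParams, HypParams.excess] at hd he hs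
  push_cast at hd he hs
  unfold dixonClosedNegOne
  simp only [div_eq_mul_inv _ (_ * _ : ℂ), mul_inv]
  have g1 : ¬ IsNonposInt (p.1 - p.2.2) := by convert he using 2; ring
  have g2 : ¬ IsNonposInt (p.1 - p.2.1) := by convert hd using 2; ring
  have g3 : ¬ IsNonposInt (p.1 / 2 - p.2.2 - p.2.1) := not_isNonposInt_div_two hs (by ring)
  have g4 : ¬ IsNonposInt (p.1 / 2 - p.2.2 - p.2.1 + 1 / 2) :=
    not_isNonposInt_div_two (not_isNonposInt_add_one hs) (by ring)
  refine AnalyticAt.fun_add ?_ ?_ <;>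
  repeat' first
    | exact analyticAt_inv_gamma (analyticAt_of_contDiff (by fun_prop))
    | exact analyticAt_two_cpow (analyticAt_of_contDiff (by fun_prop))
    | exact analyticAt_const
    | exact analyticAt_gamma (analyticAt_of_contDiff (by fun_prop)) ‹_›
    | apply AnalyticAt.fun_mul

theorem analyticOnNhd_dixonClosedTwo : AnalyticOnNhd ℂ dixonClosedTwo dixonDomainTwo := by
  intro p hp
  obtain ⟨⟨hd, he, hs⟩, h2, b1, b2, c1, c2⟩ := hp
  simp only [dixonParams, HypParams.excess] at hd he hs h2
  push_cast at hd he hs h2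
  unfold dixonClosedTwo
  simp only [div_eq_mul_inv _ (_ * _ : ℂ), mul_inv]
  have g1 : ¬ IsNonposInt (3 + p.1 - p.2.2) := by convert he using 2; ring
  have g2 : ¬ IsNonposInt (3 + p.1 - p.2.1) := by convert hd using 2; ring
  have g3 : ¬ IsNonposInt (7 / 2 + p.1 / 2 - p.2.1 - p.2.2) :=
    not_isNonposInt_div_two (not_isNonposInt_add_one hs) (by ring)
  -- Half the excess is not a nonpositive integer and, as the excess is not `2`, is not `1`; so half
  -- the excess minus `1` is regular too.
  have g4 : ¬ IsNonposInt (2 + p.1 / 2 - p.2.2 - p.2.1) := by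
    refine not_isNonposInt_of_eq_sub_one (z := 3 + p.1 / 2 - p.2.2 - p.2.1)
      (not_isNonposInt_div_two hs (by ring)) (fun h => h2 ?_) (by ring)
    linear_combination 2 * h
  have n1 : p.2.1 - 1 ≠ 0 := sub_ne_zero.2 b1
  have n2 : -2 + p.2.1 ≠ 0 := fun h => b2 (by linear_combination h)
  have n3 : p.2.2 - 1 ≠ 0 := sub_ne_zero.2 c1
  have n4 : -2 + p.2.2 ≠ 0 := fun h => c2 (by linear_combination h)
  have i1 := (analyticAt_of_contDiff (g := fun q => q.2.1 - 1) (by fun_prop)).fun_inv n1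
  have i2 := (analyticAt_of_contDiff (g := fun q => -2 + q.2.1) (by fun_prop)).fun_inv n2
  have i3 := (analyticAt_of_contDiff (g := fun q => q.2.2 - 1) (by fun_prop)).fun_inv n3
  have i4 := (analyticAt_of_contDiff (g := fun q => -2 + q.2.2) (by fun_prop)).fun_inv n4
  have i5 := (analyticAt_two_cpow (p := p) (g := fun q => q.1)
    (analyticAt_of_contDiff (by fun_prop))).fun_inv (two_cpow_ne_zero _)
  have i6 := (analyticAt_two_cpow (p := p) (g := fun q => -2 + q.1)
    (analyticAt_of_contDiff (by fun_prop))).fun_inv (two_cpow_ne_zero _)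
  refine AnalyticAt.fun_add (analyticAt_const.fun_mul ?_)
    (AnalyticAt.fun_mul (AnalyticAt.fun_sub (analyticAt_const.fun_mul ?_)
      (analyticAt_const.fun_mul ?_)) ?_) <;>
  repeat' first
    | exact i1
    | exact i2
    | exact i3
    | exact i4
    | exact i5
    | exact i6
    | exact analyticAt_inv_gamma (analyticAt_of_contDiff (by fun_prop))
    | exact analyticAt_gamma (analyticAt_of_contDiff (by fun_prop)) ‹_›
    | exact analyticAt_const
    | apply AnalyticAt.fun_mul
    | exact analyticAt_of_contDiff (by fun_prop)

theorem analyticOnNhd_watsonClosedNegOne :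
    AnalyticOnNhd ℂ watsonClosedNegOne watsonDomainNegOne := by
  intro p hp
  obtain ⟨hd, he, hs⟩ := hp
  simp only [watsonParams, HypParams.excess] at hd he hs
  push_cast at hd he hs
  unfold watsonClosedNegOne
  simp only [div_eq_mul_inv _ (_ * _ : ℂ), mul_inv]
  have g1 : ¬ IsNonposInt (-p.1 / 2 - p.2.1 / 2 + p.2.2) := by convert hs using 2; ring
  have g2 : ¬ IsNonposInt (p.1 / 2 + p.2.1 / 2) := by convert hd using 2; ring
  have g3 : ¬ IsNonposInt (p.2.2 + 1 / 2) :=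
    not_isNonposInt_div_two (not_isNonposInt_add_one he) (by ring)
  repeat' first
    | exact analyticAt_inv_gamma (analyticAt_of_contDiff (by fun_prop))
    | exact analyticAt_const
    | exact analyticAt_gamma (analyticAt_of_contDiff (by fun_prop)) ‹_›
    | exact analyticAt_of_contDiff (by fun_prop)
    | apply AnalyticAt.fun_mul
    | apply AnalyticAt.fun_add

theorem analyticOnNhd_watsonClosedTwo : AnalyticOnNhd ℂ watsonClosedTwo watsonDomainTwo := by
  intro p hp
  obtain ⟨⟨hd, he, hs⟩, h1, h2, ab1, ab2⟩ := hp
  simp only [watsonParams, HypParams.excess] at hd he hs h1 h2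
  push_cast at hd he hs h1 h2
  unfold watsonClosedTwo
  simp only [div_eq_mul_inv _ (_ * _ : ℂ), mul_inv]
  -- This argument is the excess minus `2`; excluding the excesses `1` and `2` allows both downward
  -- shifts.
  have g1 : ¬ IsNonposInt (-1 / 2 - p.1 / 2 - p.2.1 / 2 + p.2.2) := by
    refine not_isNonposInt_of_eq_sub_one (z := 1 / 2 - p.1 / 2 - p.2.1 / 2 + p.2.2)
      (not_isNonposInt_of_eq_sub_one hs h1 (by ring)) (fun h => h2 ?_) (by ring)
    linear_combination h
  have g2 : ¬ IsNonposInt (p.1 / 2 + p.2.1 / 2 + 3 / 2) := by convert hd using 2; ring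
  have g3 : ¬ IsNonposInt (p.2.2 + 1 / 2) :=
    not_isNonposInt_div_two (not_isNonposInt_add_one he) (by ring)
  have n1 : -1 - p.1 + p.2.1 ≠ 0 := fun h => ab2 (by linear_combination -h)
  have n2 : -p.1 + p.2.1 + 1 ≠ 0 := fun h => ab1 (by linear_combination -h)
  repeat' first
    | exact analyticAt_inv_gamma (analyticAt_of_contDiff (by fun_prop))
    | exact AnalyticAt.fun_inv (analyticAt_of_contDiff (by fun_prop)) ‹_›
    | exact analyticAt_const
    | exact analyticAt_gamma (analyticAt_of_contDiff (by fun_prop)) ‹_›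
    | exact analyticAt_of_contDiff (by fun_prop)
    | apply AnalyticAt.fun_mul
    | apply AnalyticAt.fun_neg
    | apply AnalyticAt.fun_sub

/-! ### Suitable lines in the four parameter sets. -/

/-- On a line through an admissible point all but countably many points are admissible. -/
theorem countable_setOf_not_admissible_line {P : ℂ × ℂ × ℂ → HypParams} {p v : ℂ × ℂ × ℂ}
    (hp : (P p).Admissible) {β γ δ : ℂ} (hd : ∀ t : ℂ, (P (p + t • v)).d = (P p).d + t * β)
    (he : ∀ t : ℂ, (P (p + t • v)).e = (P p).e + t * γ)
    (hex : ∀ t : ℂ, (P (p + t • v)).excess = (P p).excess + t * δ) :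
    {t : ℂ | ¬ (P (p + t • v)).Admissible}.Countable := by
  refine ((countable_setOf_line_isNonposInt β hp.1).union
    ((countable_setOf_line_isNonposInt γ hp.2.1).union
    (countable_setOf_line_isNonposInt δ hp.2.2))).mono fun t ht => ?_
  by_contra h
  refine ht ⟨fun h1 => h (.inl ?_), fun h1 => h (.inr (.inl ?_)), fun h1 => h (.inr (.inr ?_))⟩
  · rwa [hd] at h1
  · rwa [he] at h1
  · rwa [hex] at h1


theorem dixonParams_line (m n : ℤ) (p v : ℂ × ℂ × ℂ) (t : ℂ) :
    (dixonParams m n (p + t • v)).d = (dixonParams m n p).d + t * (v.1 - v.2.1) ∧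
    (dixonParams m n (p + t • v)).e = (dixonParams m n p).e + t * (v.1 - v.2.2) ∧
    (dixonParams m n (p + t • v)).excess =
      (dixonParams m n p).excess + t * (v.1 - 2 * v.2.1 - 2 * v.2.2) := by
  simp only [dixonParams, HypParams.excess, Prod.fst_add, Prod.snd_add, Prod.smul_fst,
    Prod.smul_snd, smul_eq_mul]
  refine ⟨?_, ?_, ?_⟩ <;> ring

theorem watsonParams_line (m n : ℤ) (p v : ℂ × ℂ × ℂ) (t : ℂ) :
    (watsonParams m n (p + t • v)).d = (watsonParams m n p).d + t * ((v.1 + v.2.1) / 2) ∧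
    (watsonParams m n (p + t • v)).e = (watsonParams m n p).e + t * (2 * v.2.2) ∧
    (watsonParams m n (p + t • v)).excess =
      (watsonParams m n p).excess + t * (v.2.2 - (v.1 + v.2.1) / 2) := by
  simp only [watsonParams, HypParams.excess, Prod.fst_add, Prod.snd_add, Prod.smul_fst,
    Prod.smul_snd, smul_eq_mul]
  refine ⟨?_, ?_, ?_⟩ <;> ring

theorem countable_setOf_dixonParams_not_admissible {m n : ℤ} {p : ℂ × ℂ × ℂ}
    (hp : (dixonParams m n p).Admissible) (v : ℂ × ℂ × ℂ) :
    {t : ℂ | ¬ (dixonParams m n (p + t • v)).Admissible}.Countable :=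
  countable_setOf_not_admissible_line hp (fun t => (dixonParams_line m n p v t).1)
    (fun t => (dixonParams_line m n p v t).2.1) (fun t => (dixonParams_line m n p v t).2.2)

theorem countable_setOf_watsonParams_not_admissible {m n : ℤ} {p : ℂ × ℂ × ℂ}
    (hp : (watsonParams m n p).Admissible) (v : ℂ × ℂ × ℂ) :
    {t : ℂ | ¬ (watsonParams m n (p + t • v)).Admissible}.Countable :=
  countable_setOf_not_admissible_line hp (fun t => (watsonParams_line m n p v t).1)
    (fun t => (watsonParams_line m n p v t).2.1) (fun t => (watsonParams_line m n p v t).2.2)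

theorem representsThreeFTwo_dixon_of_lines {m n : ℤ} {U : Set (ℂ × ℂ × ℂ)} {f : ℂ × ℂ × ℂ → ℂ}
    (hU : ∀ p ∈ U, (dixonParams m n p).Admissible)
    (hline : ∀ p ∈ U, ∀ v, {t : ℂ | p + t • v ∉ U}.Countable)
    (hf : AnalyticOnNhd ℂ f U)
    (hsum : ∀ p ∈ U, 0 < (dixonParams m n p).excess.re → HasSum (dixonParams m n p).term (f p)) :
    RepresentsThreeFTwo (dixonParams m n) U f := by
  -- Raising `a` fixes `b` and `c`, and lowering `b` fixes `a`; both raise the excess. Together they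
  -- serve every kind of termination.
  have h1 : ∀ p ∈ U, IsAscendingLine (dixonParams m n) U p (1, 0, 0) := fun p hp =>
    ⟨hline p hp _, 1, one_pos,
      fun t => ((dixonParams_line m n p _ t).2.2).trans (by norm_num)⟩
  have h2 : ∀ p ∈ U, IsAscendingLine (dixonParams m n) U p (0, -1, 0) := fun p hp =>
    ⟨hline p hp _, 2, two_pos,
      fun t => ((dixonParams_line m n p _ t).2.2).trans (by norm_num)⟩
  refine representsThreeFTwo_of_lines ?_ ?_ ?_ ?_ ?_
    (fun p hp => ⟨(hU p hp).1, (hU p hp).2.1⟩) hf hsum (fun p hp => ⟨_, h1 p hp⟩)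
    fun p hp ht => ?_
  iterate 5
    intro p
    simp only [dixonParams]
    exact analyticAt_of_contDiff (by fun_prop)
  rcases ht with ha | hb | hc
  · exact ⟨_, h2 p hp, .inl ⟨ha, fun t => by simp [dixonParams]⟩⟩
  · exact ⟨_, h1 p hp, .inr (.inl ⟨hb, fun t => by simp [dixonParams]⟩)⟩
  · exact ⟨_, h1 p hp, .inr (.inr ⟨hc, fun t => by simp [dixonParams]⟩)⟩

/-- Raising `c` alone suffices: it raises the excess and fixes `a` and `b`, while termination
through `c` would make the bottom parameter `2c` a nonpositive integer. -/
theorem representsThreeFTwo_watson_of_lines {m : ℤ} {U : Set (ℂ × ℂ × ℂ)} {f : ℂ × ℂ × ℂ → ℂ}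
    (hU : ∀ p ∈ U, (watsonParams m 0 p).Admissible)
    (hline : ∀ p ∈ U, ({t : ℂ | p + t • ((0, 0, 1) : ℂ × ℂ × ℂ) ∉ U}).Countable)
    (hf : AnalyticOnNhd ℂ f U)
    (hsum : ∀ p ∈ U, 0 < (watsonParams m 0 p).excess.re →
      HasSum (watsonParams m 0 p).term (f p)) :
    RepresentsThreeFTwo (watsonParams m 0) U f := by
  have h1 : ∀ p ∈ U, IsAscendingLine (watsonParams m 0) U p (0, 0, 1) := fun p hp =>
    ⟨hline p hp, 1, one_pos, fun t => ((watsonParams_line m 0 p _ t).2.2).trans (by norm_num)⟩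
  refine representsThreeFTwo_of_lines ?_ ?_ ?_ ?_ ?_
    (fun p hp => ⟨(hU p hp).1, (hU p hp).2.1⟩) hf hsum (fun p hp => ⟨_, h1 p hp⟩)
    fun p hp ht => ⟨_, h1 p hp, ?_⟩
  iterate 5
    intro p
    simp only [watsonParams]
    exact analyticAt_of_contDiff (by fun_prop)
  rcases ht with ha | hb | ⟨k, hk⟩
  · exact .inl ⟨ha, fun t => by simp [watsonParams]⟩
  · exact .inr (.inl ⟨hb, fun t => by simp [watsonParams]⟩)
  · refine absurd ⟨2 * k, ?_⟩ (hU p hp).2.1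
    simp only [watsonParams] at hk ⊢
    rw [hk]
    push_cast
    ring

theorem representsThreeFTwo_dixonClosedNegOne :
    RepresentsThreeFTwo (dixonParams (-1) 0) dixonDomainNegOne dixonClosedNegOne :=
  representsThreeFTwo_dixon_of_lines (fun _ hp => hp)
    (fun _ hp v => countable_setOf_dixonParams_not_admissible hp v)
    analyticOnNhd_dixonClosedNegOne fun _ => hasSum_dixonClosedNegOne

theorem representsThreeFTwo_dixonClosedTwo :
    RepresentsThreeFTwo (dixonParams 2 0) dixonDomainTwo dixonClosedTwo := by
  refine representsThreeFTwo_dixon_of_lines (fun _ hp => hp.1) (fun p hp v => ?_)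
    analyticOnNhd_dixonClosedTwo fun _ => hasSum_dixonClosedTwo
  obtain ⟨hp, h2, b1, b2, c1, c2⟩ := hp
  refine ((countable_setOf_dixonParams_not_admissible hp v).union
    ((countable_setOf_line_eq (v.1 - 2 * v.2.1 - 2 * v.2.2) h2).union
    ((countable_setOf_line_eq v.2.1 b1).union ((countable_setOf_line_eq v.2.1 b2).union
    ((countable_setOf_line_eq v.2.2 c1).union (countable_setOf_line_eq v.2.2 c2)))))).mono
    fun t ht => ?_
  rw [Set.mem_ofPred_eq, dixonDomainTwo, Set.mem_ofPred_eq,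
    (dixonParams_line 2 0 p v t).2.2] at ht
  simp only [Set.mem_union, Set.mem_ofPred_eq]
  simp only [Prod.fst_add, Prod.snd_add, Prod.smul_fst, Prod.smul_snd, smul_eq_mul] at ht
  tauto

theorem representsThreeFTwo_watsonClosedNegOne :
    RepresentsThreeFTwo (watsonParams (-1) 0) watsonDomainNegOne watsonClosedNegOne :=
  representsThreeFTwo_watson_of_lines (fun _ hp => hp)
    (fun _ hp => countable_setOf_watsonParams_not_admissible hp _)
    analyticOnNhd_watsonClosedNegOne fun _ => hasSum_watsonClosedNegOne

theorem representsThreeFTwo_watsonClosedTwo :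
    RepresentsThreeFTwo (watsonParams 2 0) watsonDomainTwo watsonClosedTwo := by
  refine representsThreeFTwo_watson_of_lines (fun _ hp => hp.1) (fun p hp => ?_)
    analyticOnNhd_watsonClosedTwo fun _ => hasSum_watsonClosedTwo
  obtain ⟨hp, h1, h2, ab1, ab2⟩ := hp
  -- The conditions on `a - b` are constant along this line, so only the excess contributes further
  -- exceptional points.
  refine ((countable_setOf_watsonParams_not_admissible hp (0, 0, 1)).union
    ((countable_setOf_line_eq 1 h1).union (countable_setOf_line_eq 1 h2))).mono fun t ht => ?_
  have hex : (watsonParams 2 0 (p + t • (0, 0, 1))).excess =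
      (watsonParams 2 0 p).excess + t * 1 :=
    ((watsonParams_line 2 0 p _ t).2.2).trans (by norm_num)
  rw [Set.mem_ofPred_eq, watsonDomainTwo, Set.mem_ofPred_eq, hex] at ht
  simp only [Set.mem_union, Set.mem_ofPred_eq]
  simp only [Prod.fst_add, Prod.snd_add, Prod.smul_fst, Prod.smul_snd, smul_eq_mul, mul_zero,
    add_zero] at ht
  tauto


/-! ### The relation between the Watson and Dixon closed forms. -/

theorem gamma_eq_of_not_isNonposInt {z : ℂ} (hz : ¬ IsNonposInt z) :
    Gamma (z / 2) ≠ 0 ∧ Gamma (z / 2 + 1 / 2) ≠ 0 ∧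
    Gamma z = Gamma (z / 2) * Gamma (z / 2 + 1 / 2) * (2 : ℂ) ^ z /
      (2 * (Real.sqrt Real.pi : ℂ)) := by
  refine ⟨gamma_ne_zero (not_isNonposInt_div_two hz (by ring)),
    gamma_ne_zero (not_isNonposInt_div_two (not_isNonposInt_add_one hz) (by ring)), ?_⟩
  have h := two_cpow_ne_zero z
  have hpi := sqrt_pi_ne_zero
  rw [gamma_duplication, cpow_sub _ _ two_ne_zero, cpow_one]
  field_simp

theorem watsonClosedNegOne_eq_dixonClosedNegOne {p : ℂ × ℂ × ℂ} (hp : p ∈ watsonDomainNegOne)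
    (hq : watsonToDixon (-1) 0 p ∈ dixonDomainNegOne) :
    watsonClosedNegOne p =
      dixonClosedNegOne (watsonToDixon (-1) 0 p) * watsonDixonFactor (-1) 0 p := by
  obtain ⟨a, b, c⟩ := p
  obtain ⟨-, he, -⟩ := hp
  obtain ⟨hd', he', hs'⟩ := hq
  simp only [watsonParams] at he
  simp only [dixonParams, watsonToDixon, HypParams.excess] at hd' he' hs'
  push_cast at he hd' he' hs'
  have hc : ¬ IsNonposInt (2 * c) := by convert he using 2; ring
  -- The excess of the transformed Dixon parameters is `a`, and their bottom parameters supply `g1`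
  -- and `g2`; so the denominator of the gamma factor is nonzero.
  have ha : ¬ IsNonposInt a := by convert hs' using 2; ring
  have g1 : Gamma (c + (b - a) / 2) ≠ 0 := gamma_ne_zero (by convert he' using 2; ring)
  have g2 : Gamma (2 * c - (a + b) / 2) ≠ 0 := gamma_ne_zero (by convert hd' using 2; ring)
  obtain ⟨a1, a2, a3⟩ := gamma_eq_of_not_isNonposInt ha
  obtain ⟨c1, c2, c3⟩ := gamma_eq_of_not_isNonposInt hc
  rw [mul_div_cancel_left₀ c two_ne_zero] at c1 c2 c3
  have hpi := sqrt_pi_ne_zero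
  have hx := two_cpow_ne_zero (2 * c)
  have hy := two_cpow_ne_zero a
  have hxy : (2 : ℂ) ^ (-(2 * c - a)) = (2 : ℂ) ^ a / (2 : ℂ) ^ (2 * c) := by
    rw [neg_sub, cpow_sub _ _ two_ne_zero]
  simp only [watsonClosedNegOne, dixonClosedNegOne, watsonToDixon, watsonDixonFactor]
  push_cast
  rw [show 2 * c + 0 - a - ((1 + -1 - a - b) / 2 + c + 0) = c + (b - a) / 2 by ring,
    show 2 * c + 0 - a - (b - a + -1 + 1) / 2 = 2 * c - (a + b) / 2 by ring,
    show (2 * c + 0 - a) / 2 - ((1 + -1 - a - b) / 2 + c + 0) - (b - a + -1 + 1) / 2 = a / 2 by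
      ring,
    show (2 * c + 0 - a) / 2 + 1 / 2 = 1 / 2 - a / 2 + c by ring,
    show (2 * c + 0 - a) / 2 - (b - a + -1 + 1) / 2 = c - b / 2 by ring,
    show (2 * c + 0 - a) / 2 - ((1 + -1 - a - b) / 2 + c + 0) = b / 2 by ring,
    show 2 * c - (a + b) / 2 - ((1 + -1 - a - b) / 2 + c + 0) = c by ring,
    show 1 / 2 + (2 * c + 0 - a) / 2 - (b - a + -1 + 1) / 2 = 1 / 2 - b / 2 + c by ring,
    show 1 / 2 + (2 * c + 0 - a) / 2 - ((1 + -1 - a - b) / 2 + c + 0) = b / 2 + 1 / 2 by ring,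
    show (2 * c + 0 - a) / 2 = c - a / 2 by ring,
    show c + 0 + 1 / 2 * (1 + -1 - a - b) = -a / 2 - b / 2 + c by ring,
    show 2 * c + 0 + 1 / 2 * (1 + -1 - a - b) = 2 * c - (a + b) / 2 by ring,
    show 1 / 2 * (a + b + 1 + -1) = a / 2 + b / 2 by ring,
    show c + 0 + 1 / 2 * (1 + -1 + b - a) = c + (b - a) / 2 by ring,
    show -(2 * c + 0 - a) = -(2 * c - a) by ring, show 2 * c + 0 = 2 * c by ring, hxy, a3, c3]
  simp only [div_eq_mul_inv _ (_ * _ : ℂ), mul_inv]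
  generalize (Gamma (1 / 2 - a / 2 + c))⁻¹ = i1
  generalize (Gamma (c - b / 2))⁻¹ = i2
  generalize (Gamma (b / 2))⁻¹ = i3
  generalize (Gamma (1 / 2 - b / 2 + c))⁻¹ = i4
  generalize (Gamma (b / 2 + 1 / 2))⁻¹ = i5
  generalize (Gamma (c - a / 2))⁻¹ = i6
  generalize Gamma (a / 2) = k1 at a1 ⊢
  generalize Gamma (a / 2 + 1 / 2) = k2 at a2 ⊢
  generalize Gamma c = k3 at c1 ⊢
  generalize Gamma (c + 1 / 2) = k4 at c2 ⊢
  generalize Gamma (c + (b - a) / 2) = k5 at g1 ⊢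
  generalize Gamma (2 * c - (a + b) / 2) = k6 at g2 ⊢
  generalize Gamma (a / 2 + b / 2) = k7
  generalize Gamma (-a / 2 - b / 2 + c) = k8
  field_simp

/-- After duplication, two gamma arguments still differ by integers; the functional equation removes
these shifts, and the two polynomial brackets then agree. The Dixon excess is again `a`, so its
restriction gives `a ≠ 2`. -/
theorem watsonClosedTwo_eq_dixonClosedTwo {p : ℂ × ℂ × ℂ} (hp : p ∈ watsonDomainTwo)
    (hq : watsonToDixon 2 0 p ∈ dixonDomainTwo) :
    watsonClosedTwo p = dixonClosedTwo (watsonToDixon 2 0 p) * watsonDixonFactor 2 0 p := by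
  obtain ⟨a, b, c⟩ := p
  obtain ⟨⟨-, he, -⟩, hs1, hs2, ab1, ab2⟩ := hp
  obtain ⟨⟨hd', he', hs'⟩, ha2, -⟩ := hq
  simp only [watsonParams, HypParams.excess] at he hs1 hs2
  simp only [dixonParams, watsonToDixon, HypParams.excess] at hd' he' hs' ha2
  push_cast at he hs1 hs2 hd' he' hs' ha2
  have hc : ¬ IsNonposInt (2 * c) := by convert he using 2; ring
  have ha : ¬ IsNonposInt a := by convert hs' using 2; ring
  have g1 : Gamma (c + (b - a) / 2 + 3 / 2) ≠ 0 := gamma_ne_zero (by convert he' using 2; ring)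
  have g2 : Gamma (2 * c - (a + b) / 2 + 3 / 2) ≠ 0 :=
    gamma_ne_zero (by convert hd' using 2; ring)
  have n1 : c + 1 / 2 - a / 2 - b / 2 ≠ 0 := fun h => hs1 (by linear_combination h)
  have n2 : c - 1 / 2 - a / 2 - b / 2 ≠ 0 := fun h => hs2 (by linear_combination h)
  have n3 : b - a - 1 ≠ 0 := fun h => ab2 (by linear_combination -h)
  have n4 : b - a + 1 ≠ 0 := fun h => ab1 (by linear_combination -h)
  have n5 : a - 2 ≠ 0 := fun h => ha2 (by linear_combination h)
  obtain ⟨a1, a2, a3⟩ := gamma_eq_of_not_isNonposInt ha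
  obtain ⟨c1, c2, c3⟩ := gamma_eq_of_not_isNonposInt hc
  rw [mul_div_cancel_left₀ c two_ne_zero] at c1 c2 c3
  have hpi := sqrt_pi_ne_zero
  have hx := two_cpow_ne_zero (2 * c)
  have hy := two_cpow_ne_zero a
  have hxy : (2 : ℂ) ^ (2 * c - a) = (2 : ℂ) ^ (2 * c) / (2 : ℂ) ^ a :=
    cpow_sub _ _ two_ne_zero
  have hxy' : (2 : ℂ) ^ (-2 + (2 * c - a)) = (2 : ℂ) ^ (2 * c) / (2 : ℂ) ^ a / 4 := by
    rw [cpow_add _ _ two_ne_zero, hxy, cpow_neg]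
    norm_num
    ring
  have ga : Gamma (a / 2 - 1) = Gamma (a / 2) * 2 / (a - 2) := by
    rw [eq_div_iff n5]
    have := Gamma_add_one (a / 2 - 1) fun h => n5 (by linear_combination 2 * h)
    rw [sub_add_cancel] at this
    rw [this]
    ring
  have gc : Gamma (c + (3 - a - b) / 2) = (c + 1 / 2 - a / 2 - b / 2) *
      ((c - 1 / 2 - a / 2 - b / 2) * Gamma (-1 / 2 - a / 2 - b / 2 + c)) := by
    rw [show c + (3 - a - b) / 2 = c + 1 / 2 - a / 2 - b / 2 + 1 by ring, Gamma_add_one _ n1,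
      show c + 1 / 2 - a / 2 - b / 2 = c - 1 / 2 - a / 2 - b / 2 + 1 by ring, Gamma_add_one _ n2]
    ring_nf
  simp only [watsonClosedTwo, dixonClosedTwo, watsonToDixon, watsonDixonFactor]
  push_cast
  obtain ⟨A, hA⟩ : ∃ A, 2 * c + 0 - a = A := ⟨_, rfl⟩
  obtain ⟨B, hB⟩ : ∃ B, (b - a + 2 + 1) / 2 = B := ⟨_, rfl⟩
  obtain ⟨C, hC⟩ : ∃ C, (1 + 2 - a - b) / 2 + c + 0 = C := ⟨_, rfl⟩
  rw [hA, hB, hC,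
    show 7 / 2 + A / 2 - B - C = a / 2 + 1 / 2 by rw [← hA, ← hB, ← hC]; ring,
    show 3 + A - C = c + (b - a) / 2 + 3 / 2 by rw [← hA, ← hC]; ring,
    show 3 + A - B = 2 * c - (a + b) / 2 + 3 / 2 by rw [← hA, ← hB]; ring,
    show A + 3 - B - C = c by rw [← hA, ← hB, ← hC]; ring,
    show 3 / 2 + A / 2 - C = b / 2 by rw [← hA, ← hC]; ring,
    show 3 / 2 + A / 2 - B = c - b / 2 by rw [← hA, ← hB]; ring,
    show 2 + A / 2 - C - B = a / 2 - 1 by rw [← hA, ← hB, ← hC]; ring,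
    show A / 2 + 1 / 2 = 1 / 2 - a / 2 + c by rw [← hA]; ring,
    show A / 2 + 2 - C = b / 2 + 1 / 2 by rw [← hA, ← hC]; ring,
    show A / 2 - B + 2 = 1 / 2 - b / 2 + c by rw [← hA, ← hB]; ring,
    show A / 2 = c - a / 2 by rw [← hA]; ring,
    show -2 + B = (b - a - 1) / 2 by rw [← hB]; ring,
    show B - 1 = (b - a + 1) / 2 by rw [← hB]; ring,
    show -2 + C = c - 1 / 2 - a / 2 - b / 2 by rw [← hC]; ring,
    show C - 1 = c + 1 / 2 - a / 2 - b / 2 by rw [← hC]; ring,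
    show 2 + A - 2 * C = b - 1 by rw [← hA, ← hC]; ring,
    show -2 * B + A + 2 = 2 * c - b - 1 by rw [← hA, ← hB]; ring,
    show A + 5 - 2 * C - 2 * B = a - 1 by rw [← hA, ← hB, ← hC]; ring,
    show -2 * B - 2 * C + A + 6 = a by rw [← hA, ← hB, ← hC]; ring,
    show A = 2 * c - a by rw [← hA]; ring,
    show c + 0 + 1 / 2 * (1 + 2 - a - b) = c + (3 - a - b) / 2 by ring,
    show 2 * c + 0 + 1 / 2 * (1 + 2 - a - b) = 2 * c - (a + b) / 2 + 3 / 2 by ring,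
    show 1 / 2 * (a + b + 1 + 2) = a / 2 + b / 2 + 3 / 2 by ring,
    show c + 0 + 1 / 2 * (1 + 2 + b - a) = c + (b - a) / 2 + 3 / 2 by ring,
    show -1 - a + b = b - a - 1 by ring, show -a + b + 1 = b - a + 1 by ring,
    show 2 * c + 0 = 2 * c by ring, hxy, hxy', ga, gc, a3, c3]
  simp only [div_eq_mul_inv _ (_ * _ : ℂ), mul_inv]
  generalize (Gamma (1 / 2 - a / 2 + c))⁻¹ = i1
  generalize (Gamma (c - b / 2))⁻¹ = i2
  generalize (Gamma (b / 2))⁻¹ = i3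
  generalize (Gamma (1 / 2 - b / 2 + c))⁻¹ = i4
  generalize (Gamma (b / 2 + 1 / 2))⁻¹ = i5
  generalize (Gamma (c - a / 2))⁻¹ = i6
  generalize Gamma (a / 2) = k1 at a1 ⊢
  generalize Gamma (a / 2 + 1 / 2) = k2 at a2 ⊢
  generalize Gamma c = k3 at c1 ⊢
  generalize Gamma (c + 1 / 2) = k4 at c2 ⊢
  generalize Gamma (c + (b - a) / 2 + 3 / 2) = k5 at g1 ⊢
  generalize Gamma (2 * c - (a + b) / 2 + 3 / 2) = k6 at g2 ⊢
  generalize Gamma (a / 2 + b / 2 + 3 / 2) = k7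
  generalize Gamma (-1 / 2 - a / 2 - b / 2 + c) = k8
  obtain ⟨u, hu⟩ : ∃ u, c + 1 / 2 - a / 2 - b / 2 = u := ⟨_, rfl⟩
  obtain ⟨v, hv⟩ : ∃ v, c - 1 / 2 - a / 2 - b / 2 = v := ⟨_, rfl⟩
  rw [hu] at n1 ⊢
  rw [hv] at n2 ⊢
  field_simp
  -- `u`, `v` and `c` are dependent; eliminating `u` and `c` leaves a polynomial identity in
  -- independent variables.
  have hc' : c = v + 1 / 2 + a / 2 + b / 2 := by rw [← hv]; ring
  have hu' : u = v + 1 := by rw [← hu, ← hv]; ring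
  rw [hu', hc']
  ring

theorem mainTheorem5 :
    RepresentsThreeFTwo (dixonParams (-1) 0) dixonDomainNegOne dixonClosedNegOne ∧
    RepresentsThreeFTwo (dixonParams 2 0) dixonDomainTwo dixonClosedTwo ∧
    RepresentsThreeFTwo (watsonParams (-1) 0) watsonDomainNegOne watsonClosedNegOne ∧
    RepresentsThreeFTwo (watsonParams 2 0) watsonDomainTwo watsonClosedTwo ∧
    (∀ p ∈ watsonDomainNegOne, watsonToDixon (-1) 0 p ∈ dixonDomainNegOne →
      watsonClosedNegOne p =
        dixonClosedNegOne (watsonToDixon (-1) 0 p) * watsonDixonFactor (-1) 0 p) ∧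
    (∀ p ∈ watsonDomainTwo, watsonToDixon 2 0 p ∈ dixonDomainTwo →
      watsonClosedTwo p =
        dixonClosedTwo (watsonToDixon 2 0 p) * watsonDixonFactor 2 0 p) :=
  ⟨representsThreeFTwo_dixonClosedNegOne, representsThreeFTwo_dixonClosedTwo,
    representsThreeFTwo_watsonClosedNegOne, representsThreeFTwo_watsonClosedTwo,
    fun _ => watsonClosedNegOne_eq_dixonClosedNegOne,
    fun _ => watsonClosedTwo_eq_dixonClosedTwo⟩
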